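/- Let $p>1$ and $Q>1$, put $p_1=-1/(p-1)$, and let $s^+\in[0,1]$ and $s^-\in[1/p_1,0]$ be the unique solutions $u$, in the respective interval, of $$(1-u)(1-p_1u)^{-1/p_1}=1/Q .$$ For a Radon measure $\mu$ on $\mathbb R^n$ and a weight $w$ (a measurable function that is positive $\mu$-a.e.), write $\langle f\rangle_R=\frac1{\mu(R)}\int_R f\,d\mu$ and $$[w]_q=\sup_R\,\langle w\rangle_R\,\langle w^{-1/(q-1)}\rangle_R^{\,q-1}\quad(q>1),\qquad [w]_{RH_q}=\sup_R\,\langle w^q\rangle_R^{1/q}\,\langle w\rangle_R^{-1}\quad(q\ge 1),$$ where the suprema are over all bounded boxes $R\subset\mathbb R^n$ with edges parallel to the coordinate axes and $\mu(R)>0$. Write $w\in A_q^*$ if $[w]_q<\infty$, and $w\in RH_q^*$ if $[w]_{RH_q}<\infty$. (1) For every $q$ with $1-s^-<q<\infty$ there is a finite constant $C=C(p,Q,q)$ such that, for every $n$, every Radon measure $\mu$ on $\mathbb R^n$ with $\mu(H)=0$ for every hyperplane $H$ orthogonal to one of the coordinate axes, and every weight $w$ with $[w]_p=Q$, we have $w\in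 A_q^*$, with $[w]_q\le C$. (2) For every $q$ with $1\le q<1/s^+$ there is a finite constant $C=C(p,Q,q)$ such that, for all $n$, $\mu$, $w$ as in (1), we have $w\in RH_q^*$, with $[w]_{RH_q}\le C$. (3) These ranges for $q$ are sharp for $n=1$ and Lebesgue measure $\mu=dx$ on $\mathbb R$: for every $q$ with $1<q\le 1-s^-$ there is a weight $w$ on $\mathbb R$ with $[w]_p=Q$ and $w\notin A_q^*$, and for every $q\ge 1/s^+$ there is a weight $w$ on $\mathbb R$ with $[w]_p=Q$ and $w\notin RH_q^*$. -/

import Mathlib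

open MeasureTheory Set
open scoped ENNReal NNReal

namespace StrongWeights

/-- The left-hand side `(1 - u) (1 - p₁ u) ^ (-1 / p₁)` of the equation that defines `u^±_{p₁}`. -/
noncomputable def charFun (p₁ u : ℝ) : ℝ := (1 - u) * (1 - p₁ * u) ^ (-1 / p₁)

/-- `u^+_{p₁}(t)`: the solution in `[0, 1]` of `(1 - u) (1 - p₁ u) ^ (-1 / p₁) = t`.
The solution set is a singleton for `p₁ < 0` and `t ∈ [0, 1]`, see `uPlus_spec`. -/
noncomputable def uPlus (p₁ t : ℝ) : ℝ := sSup {u | u ∈ Icc (0 : ℝ) 1 ∧ charFun p₁ u = t}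

/-- `u^-_{p₁}(t)`: the solution in `[1 / p₁, 0]` of `(1 - u) (1 - p₁ u) ^ (-1 / p₁) = t`.
The solution set is a singleton for `p₁ < 0` and `t ∈ [0, 1]`, see `uMinus_spec`. -/
noncomputable def uMinus (p₁ t : ℝ) : ℝ :=
  sSup {u | u ∈ Icc (1 / p₁) (0 : ℝ) ∧ charFun p₁ u = t}

/-- `s^+_{p₁}(Q) = u^+_{p₁}(1 / Q)`. -/
noncomputable def sPlus (p₁ Q : ℝ) : ℝ := uPlus p₁ (1 / Q)

/-- `s^-_{p₁}(Q) = u^-_{p₁}(1 / Q)`. -/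
noncomputable def sMinus (p₁ Q : ℝ) : ℝ := uMinus p₁ (1 / Q)

theorem charFun_continuous {p₁ : ℝ} (hp : p₁ < 0) : Continuous (charFun p₁) := by
  have h : 0 ≤ -1 / p₁ := (div_pos_of_neg_of_neg (by norm_num) hp).le
  unfold charFun
  exact (by fun_prop : Continuous fun u : ℝ => 1 - u).mul
    ((by fun_prop : Continuous fun u : ℝ => 1 - p₁ * u).rpow_const fun _ => Or.inr h)

theorem charFun_hasDerivAt {p₁ u : ℝ} (hp : p₁ < 0) (hu : 0 < 1 - p₁ * u) :
    HasDerivAt (charFun p₁) ((1 - p₁ * u) ^ (-1 / p₁ - 1) * ((p₁ - 1) * u)) u := by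
  have h1 : HasDerivAt (fun u : ℝ => 1 - u) (-1) u := by
    simpa using (hasDerivAt_id u).const_sub 1
  have h2 : HasDerivAt (fun u : ℝ => 1 - p₁ * u) (-(p₁ * 1)) u :=
    ((hasDerivAt_id u).const_mul p₁).const_sub 1
  have h3 := h1.mul (h2.rpow_const (p := -1 / p₁) (Or.inl hu.ne'))
  refine h3.congr_deriv ?_
  have h4 : (1 - p₁ * u) ^ (-1 / p₁) = (1 - p₁ * u) ^ (-1 / p₁ - 1) * (1 - p₁ * u) := by
    rw [← Real.rpow_add_one hu.ne']; congr 1; ring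
  rw [h4]
  field_simp [hp.ne]
  ring

theorem charFun_strictAntiOn {p₁ : ℝ} (hp : p₁ < 0) : StrictAntiOn (charFun p₁) (Icc 0 1) := by
  refine strictAntiOn_of_deriv_neg (convex_Icc 0 1) (charFun_continuous hp).continuousOn ?_
  intro u hu
  rw [interior_Icc] at hu
  have h : 0 < 1 - p₁ * u := by nlinarith [hu.1]
  rw [(charFun_hasDerivAt hp h).deriv]
  exact mul_neg_of_pos_of_neg (Real.rpow_pos_of_pos h _) (by nlinarith [hu.1])

theorem charFun_strictMonoOn {p₁ : ℝ} (hp : p₁ < 0) :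
    StrictMonoOn (charFun p₁) (Icc (1 / p₁) 0) := by
  refine strictMonoOn_of_deriv_pos (convex_Icc _ 0) (charFun_continuous hp).continuousOn ?_
  intro u hu
  rw [interior_Icc] at hu
  have h : 0 < 1 - p₁ * u := by
    have := mul_lt_mul_of_neg_left hu.1 hp
    rw [mul_one_div_cancel hp.ne] at this
    linarith
  rw [(charFun_hasDerivAt hp h).deriv]
  exact mul_pos (Real.rpow_pos_of_pos h _) (by nlinarith [hu.2])

/-- `uPlus p₁ t` is the unique solution in `[0, 1]`. -/
theorem uPlus_spec {p₁ t : ℝ} (hp : p₁ < 0) (ht : t ∈ Icc (0 : ℝ) 1) :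
    {u | u ∈ Icc (0 : ℝ) 1 ∧ charFun p₁ u = t} = {uPlus p₁ t} := by
  obtain ⟨u, hu, hut⟩ := intermediate_value_Icc' zero_le_one
    (charFun_continuous hp).continuousOn (f := charFun p₁) (by simpa [charFun] using ht)
  have h : {v | v ∈ Icc (0 : ℝ) 1 ∧ charFun p₁ v = t} = {u} := by
    ext v
    constructor
    · rintro ⟨hv, hvt⟩
      exact (charFun_strictAntiOn hp).injOn hv hu (hvt.trans hut.symm)
    · rintro rfl
      exact ⟨hu, hut⟩
  rw [uPlus, h, csSup_singleton]

/-- `uMinus p₁ t` is the unique solution in `[1 / p₁, 0]`. -/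
theorem uMinus_spec {p₁ t : ℝ} (hp : p₁ < 0) (ht : t ∈ Icc (0 : ℝ) 1) :
    {u | u ∈ Icc (1 / p₁) (0 : ℝ) ∧ charFun p₁ u = t} = {uMinus p₁ t} := by
  have h0 : charFun p₁ (1 / p₁) = 0 := by
    rw [charFun, mul_one_div_cancel hp.ne, sub_self, Real.zero_rpow
      (div_pos_of_neg_of_neg (by norm_num) hp).ne', mul_zero]
  obtain ⟨u, hu, hut⟩ := intermediate_value_Icc (one_div_neg.2 hp).le
    (charFun_continuous hp).continuousOn (f := charFun p₁)
    (by rw [h0]; simpa [charFun] using ht)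
  have h : {v | v ∈ Icc (1 / p₁) (0 : ℝ) ∧ charFun p₁ v = t} = {u} := by
    ext v
    constructor
    · rintro ⟨hv, hvt⟩
      exact (charFun_strictMonoOn hp).injOn hv hu (hvt.trans hut.symm)
    · rintro rfl
      exact ⟨hu, hut⟩
  rw [uMinus, h, csSup_singleton]

/-- The average `⟨w ^ r⟩_R = μ(R)⁻¹ ∫_R w ^ r dμ` over the box `R = ∏ [a i, b i]`, as an extended
nonnegative number, so that a function that is not integrable has average `∞`. -/
noncomputable def boxAvg {n : ℕ} (μ : Measure (Fin n → ℝ)) (w : (Fin n → ℝ) → ℝ) (r : ℝ)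
    (a b : Fin n → ℝ) : ℝ≥0∞ :=
  ⨍⁻ x in Icc a b, ENNReal.ofReal (w x ^ r) ∂μ

/-- A weight with respect to `μ`: a (measurable) function that is positive `μ`-a.e. -/
structure IsWeight {n : ℕ} (μ : Measure (Fin n → ℝ)) (w : (Fin n → ℝ) → ℝ) : Prop where
  aemeasurable : AEMeasurable w μ
  pos : ∀ᵐ x ∂μ, 0 < w x

/-- The strong Muckenhoupt characteristic `[w]_p = sup_R ⟨w⟩_R ⟨w ^ (-1/(p-1))⟩_R ^ (p-1)`, over
all axis-parallel boxes `R` with `μ(R) ≠ 0` (otherwise the averages are not defined). -/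
noncomputable def apChar {n : ℕ} (μ : Measure (Fin n → ℝ)) (p : ℝ) (w : (Fin n → ℝ) → ℝ) :
    ℝ≥0∞ :=
  ⨆ (a : Fin n → ℝ) (b : Fin n → ℝ) (_ : ∀ i, a i < b i) (_ : μ (Icc a b) ≠ 0),
    boxAvg μ w 1 a b * boxAvg μ w (-1 / (p - 1)) a b ^ (p - 1)

/-- The strong reverse Hölder characteristic `[w]_{RH_p} = sup_R ⟨w ^ p⟩_R ^ (1/p) ⟨w⟩_R ^ (-1)`,
over all axis-parallel boxes `R` with `μ(R) ≠ 0`. -/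
noncomputable def rhChar {n : ℕ} (μ : Measure (Fin n → ℝ)) (p : ℝ) (w : (Fin n → ℝ) → ℝ) :
    ℝ≥0∞ :=
  ⨆ (a : Fin n → ℝ) (b : Fin n → ℝ) (_ : ∀ i, a i < b i) (_ : μ (Icc a b) ≠ 0),
    boxAvg μ w p a b ^ (1 / p) * (boxAvg μ w 1 a b)⁻¹

/-- The weight `w` belongs to the strong Muckenhoupt class `A_p^*` with respect to `μ`. -/
def MemAp {n : ℕ} (μ : Measure (Fin n → ℝ)) (p : ℝ) (w : (Fin n → ℝ) → ℝ) : Prop :=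
  apChar μ p w < ∞

/-- The weight `w` belongs to the strong reverse Hölder class `RH_p^*` with respect to `μ`. -/
def MemRH {n : ℕ} (μ : Measure (Fin n → ℝ)) (p : ℝ) (w : (Fin n → ℝ) → ℝ) : Prop :=
  rhChar μ p w < ∞

end StrongWeights

/-!
Put `k = 1 / (p - 1)`. The hypothesis `[w]_p ≤ Q` says `⟨w⟩ ^ k ⟨w ^ (-k)⟩ ≤ K` on all boxes, with
`K = Q ^ k` (`HasJointBound`), and the number `s⁺` is the solution in `(0, 1)` of
`K * criticalFun k s = 1`. The condition is symmetric under the exchange of `w` with `w ^ (-k)` and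
of `k` with `1 / k`, and this exchange turns `s⁺` into `-k s⁻`. So the statements on `A_q^*` are
those on reverse Hölder inequalities for the dual weight, and only the latter need a proof.

*Reverse Hölder inequality for exponents `r < 1 / s⁺`.* Choose `s` with `s⁺ < s < 1 / r`. On the
domain `1 ≤ x ^ k * y ≤ K`, the infimum `B` of the affine functions `supportFn k r s u` over
`u ≥ (1 - s) x` is comparable to `x ^ r`. Since `s` lies strictly beyond `s⁺`, there is some room:
`B` satisfies the concavity inequality for a splitting of `(x, y)` into two points of the domain as
soon as their abscissas do not exceed `(1 + ε) x`, even if the segment between them leaves the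
domain (`exists_bellman`). As hyperplanes are null sets, every box can be cut in every direction
into two boxes of comparable mass whose averages of `w` are at most `(1 + ε)` times that of the box
(`exists_cut`). Cutting in all directions again and again, `∑ μ(P) B(⟨w⟩_P, ⟨w ^ (-k)⟩_P)` does not
increase, while `w` approaches its means in `L¹` (`exists_partition_integral_abs_sub_le`). This is
enough to pass to the limit in `∑ μ(P) ⟨w⟩_P ^ r`, with truncated powers, and no differentiation
theorem for boxes is needed (`exists_boxAvg_rpow_le`).

*Sharpness.* The pairs of means `(⟨w⟩, ⟨w ^ (-k)⟩)` of the power weight `x ^ (-s)` over intervals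
`[0, a]` lie on the critical curve, but this weight lives on a half-line only. Instead, weights on
the whole line are built from bumps. Given a bump with base value `1`, many copies of it are
multiplied by a factor `lam > 1` close to `1` and placed side by side, separated by gaps of fixed
relative length. Intervals shorter than the gaps see a single copy. On longer intervals, the means
are close to those of a function that takes only the values `1`, `lam` and `lam` times the mean of
the bump, and these values, paired with the corresponding ones for the power `-k`, all lie below one
line that is nearly tangent to the critical curve (`IsBump.exists_tile`,
`exists_bump_parameters`). Iteration gives bumps with the critical joint bound and bounded mean, but
with arbitrarily large mean of the power `1 / s` (`exists_isBump`). Such bumps, put on the line at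
large distances, form one weight with no reverse Hölder inequality for the exponent `1 / s`
(`exists_critical_weight`). Its characteristic cannot be smaller than `Q`, because then the reverse
Hölder inequality would hold for the exponent `1 / s` (`not_hasJointBound_of_lt`).
-/

namespace StrongWeights

/-! ### The Bellman function -/

theorem one_add_le_mul_add_rpow_neg {k t : ℝ} (hk : 0 < k) (ht : 0 < t) :
    1 + k ≤ k * t + t ^ (-k) := by
  have h1 : (0 : ℝ) ≤ k / (1 + k) := by positivity
  have h2 : (0 : ℝ) ≤ 1 / (1 + k) := by positivity
  have h := Real.geom_mean_le_arith_mean2_weighted h1 h2 ht.le (Real.rpow_nonneg ht.le (-k))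
    (by field_simp; ring)
  have h3 : t ^ (k / (1 + k)) * (t ^ (-k)) ^ (1 / (1 + k)) = 1 := by
    rw [← Real.rpow_mul ht.le, ← Real.rpow_add ht]
    have : k / (1 + k) + -k * (1 / (1 + k)) = 0 := by field_simp; ring
    rw [this, Real.rpow_zero]
  rw [h3] at h
  have h4 : k / (1 + k) * t + 1 / (1 + k) * t ^ (-k) = (k * t + t ^ (-k)) / (1 + k) := by ring
  rw [h4, le_div_iff₀ (by positivity)] at h
  linarith

/-- The number `(1 - s) ^ k (1 + k s)`, which is `charFun (-k) s ^ k`. -/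
noncomputable def criticalFun (k s : ℝ) : ℝ := (1 - s) ^ k * (1 + k * s)

theorem charFun_rpow_eq_criticalFun {k s : ℝ} (hk : 0 < k) (h0 : 0 ≤ 1 - s)
    (h1 : 0 ≤ 1 + k * s) : charFun (-k) s ^ k = criticalFun k s := by
  have h2 : 1 - -k * s = 1 + k * s := by ring
  have h3 : -1 / -k = 1 / k := by rw [neg_div_neg_eq]
  rw [charFun, criticalFun, h2, h3, Real.mul_rpow h0 (Real.rpow_nonneg h1 _),
    ← Real.rpow_mul h1, one_div_mul_cancel hk.ne', Real.rpow_one]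

theorem criticalFun_pos {k s : ℝ} (hk : 0 < k) (h0 : 0 ≤ s) (h1 : s < 1) :
    0 < criticalFun k s :=
  mul_pos (Real.rpow_pos_of_pos (by linarith) _) (by positivity)

theorem criticalFun_strictAntiOn {k : ℝ} (hk : 0 < k) :
    StrictAntiOn (criticalFun k) (Icc 0 1) := by
  intro s hs t ht hst
  have hs1 : 0 ≤ 1 + k * s := by have := mul_nonneg hk.le hs.1; linarith
  have ht1 : 0 ≤ 1 + k * t := by have := mul_nonneg hk.le ht.1; linarith
  rw [← charFun_rpow_eq_criticalFun hk (by linarith [hs.2]) hs1,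
    ← charFun_rpow_eq_criticalFun hk (by linarith [ht.2]) ht1]
  refine Real.rpow_lt_rpow ?_ (charFun_strictAntiOn (by linarith : -k < 0) hs ht hst) hk
  refine mul_nonneg (by linarith [ht.2]) (Real.rpow_nonneg ?_ _)
  linarith

/-- The affine functions of `(x, y)` whose lower envelope is the Bellman function. Up to a positive
constant, `supportFn k r s u` is the affine function that agrees to first order with
`(x, x ^ (-k)) ↦ x ^ r` at `(u, u ^ (-k))`, and whose derivative in `u` vanishes exactly for the
points `(x, y)` of the line tangent to `x ^ k * y = 1 / criticalFun k s` at abscissa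
`u / (1 - s)`. -/
noncomputable def supportFn (k r s u x y : ℝ) : ℝ :=
  -((r + k) * (r - 1) * (1 + k)) * u ^ r + r * (1 - s) * (r + k) * k * x * u ^ (r - 1) +
    r * (r - 1) * (1 + s * k) * y * u ^ (r + k)

/-- On the lower boundary `y = x ^ (-k)` of the domain, `supportFn k r s u` equals `u ^ r` times a
function of `z = x / u`. That function is bounded below by a positive number because `r * s < 1`:
its minimum over `z` is positive exactly if `criticalFun k (1 / r) < criticalFun k s`. -/
theorem exists_forall_le_profile {k r s : ℝ} (hk : 0 < k) (hr : 1 < r) (hs : 0 < s)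
    (hrs : r * s < 1) :
    ∃ δ > 0, ∀ z > 0, δ ≤ -((r + k) * (r - 1) * (1 + k)) + r * (1 - s) * (r + k) * k * z +
      r * (r - 1) * (1 + s * k) * z ^ (-k) := by
  have hs1 : s < 1 := by nlinarith
  have hr0 : 0 < r := by linarith
  set y := (r - 1) / (r * (1 - s)) with hy
  set R := (r - 1) * (1 + s * k) / ((1 - s) * (r + k)) with hR
  have h1s : 0 < 1 - s := by linarith
  have hy0 : 0 < y := by positivity
  have hR0 : 0 < R := by positivity
  have hk1 : 0 < k + 1 := by linarith
  have hyR : y ^ (k + 1) < R := by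
    have hlt : criticalFun k (1 / r) < criticalFun k s := by
      refine criticalFun_strictAntiOn hk ⟨hs.le, hs1.le⟩ ⟨by positivity, ?_⟩ ?_
      · rw [div_le_one hr0]; exact hr.le
      · rw [lt_div_iff₀ hr0]; linarith
    unfold criticalFun at hlt
    have hy' : y = (1 - 1 / r) / (1 - s) := by rw [hy]; field_simp
    have hR' : R = y * ((1 + k * s) / (1 + k * (1 / r))) := by rw [hR, hy]; field_simp
    rw [Real.rpow_add_one hy0.ne', hR', mul_comm y]
    refine mul_lt_mul_of_pos_right ?_ hy0
    have h1r : 0 ≤ 1 - 1 / r := by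
      have : 1 / r ≤ 1 := by rw [div_le_one hr0]; exact hr.le
      linarith
    rw [hy', Real.div_rpow h1r h1s.le, div_lt_div_iff₀ (by positivity) (by positivity)]
    linarith
  set t := R ^ (1 / (k + 1)) with ht
  have ht0 : 0 < t := Real.rpow_pos_of_pos hR0 _
  have htR : t ^ (k + 1) = R := by
    rw [ht, ← Real.rpow_mul hR0.le, one_div_mul_cancel hk1.ne', Real.rpow_one]
  have hty : y < t := by
    by_contra! h
    exact absurd (Real.rpow_le_rpow ht0.le h hk1.le) (by rw [htR]; linarith)
  refine ⟨(r + k) * (1 + k) * (r * (1 - s) * t - (r - 1)), ?_, fun z hz => ?_⟩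
  · rw [hy, div_lt_iff₀ (by positivity)] at hty
    have : 0 < r * (1 - s) * t - (r - 1) := by linarith
    positivity
  · have h := one_add_le_mul_add_rpow_neg hk (div_pos hz ht0)
    rw [Real.div_rpow hz.le ht0.le, Real.rpow_neg ht0.le, div_inv_eq_mul] at h
    have htk : t ^ k * t = R := by rw [← Real.rpow_add_one ht0.ne', htR]
    -- the choice of `t` makes the linear terms of the tangent at `t` cancel
    have hR2 : r * (r - 1) * (1 + s * k) = r * (1 - s) * (r + k) * t * t ^ k := by
      have : r * (1 - s) * (r + k) * t * t ^ k = r * (1 - s) * (r + k) * R := by rw [← htk]; ring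
      rw [this, hR]; field_simp
    rw [hR2]
    have h5 : r * (1 - s) * (r + k) * t * (1 + k) ≤
        r * (1 - s) * (r + k) * t * (k * (z / t) + z ^ (-k) * t ^ k) :=
      mul_le_mul_of_nonneg_left h (by positivity)
    have h6 : r * (1 - s) * (r + k) * t * (k * (z / t) + z ^ (-k) * t ^ k) =
      r * (1 - s) * (r + k) * k * z + r * (1 - s) * (r + k) * t * t ^ k * z ^ (-k) := by
      field_simp
    linarith

theorem le_supportFn {k r s δ u x y : ℝ} (hk : 0 < k) (hr : 1 < r) (hs : 0 < s)
    (hδ : ∀ z > 0, δ ≤ -((r + k) * (r - 1) * (1 + k)) + r * (1 - s) * (r + k) * k * z +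
      r * (r - 1) * (1 + s * k) * z ^ (-k))
    (hu : 0 < u) (hx : 0 < x) (hxy : 1 ≤ x ^ k * y) :
    δ * u ^ r ≤ supportFn k r s u x y := by
  have h := mul_le_mul_of_nonneg_right (hδ (x / u) (div_pos hx hu)) (Real.rpow_nonneg hu.le r)
  refine h.trans ?_
  have h1 : u ^ (r - 1) = u ^ r / u := Real.rpow_sub_one hu.ne' r
  have h2 : u ^ (r + k) = u ^ r * u ^ k := Real.rpow_add hu r k
  have h3 : (x / u) ^ (-k) ≤ y * u ^ k := by
    rw [Real.rpow_neg (div_pos hx hu).le, Real.div_rpow hx.le hu.le, inv_div,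
      div_le_iff₀ (Real.rpow_pos_of_pos hx k)]
    have := mul_le_mul_of_nonneg_left hxy (Real.rpow_nonneg hu.le k)
    linarith
  have h4 : r * (r - 1) * (1 + s * k) * u ^ r * (x / u) ^ (-k) ≤
      r * (r - 1) * (1 + s * k) * u ^ r * (y * u ^ k) :=
    mul_le_mul_of_nonneg_left h3 (by positivity)
  rw [supportFn, h1, h2]
  have h5 : r * (1 - s) * (r + k) * k * x * (u ^ r / u) =
    r * (1 - s) * (r + k) * k * (x / u) * u ^ r := by ring
  rw [h5]
  linarith

theorem supportFn_hasDerivAt {k r s u x y : ℝ} (hu : 0 < u) :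
    HasDerivAt (fun u => supportFn k r s u x y)
      (r * (r - 1) * (r + k) * u ^ (r - 1) *
        (k * ((1 - s) * x / u) + (1 + s * k) * (y * u ^ k) - (1 + k))) u := by
  have h1 := (Real.hasDerivAt_rpow_const (p := r) (Or.inl hu.ne')).const_mul
    (-((r + k) * (r - 1) * (1 + k)))
  have h2 := (Real.hasDerivAt_rpow_const (p := r - 1) (Or.inl hu.ne')).const_mul
    (r * (1 - s) * (r + k) * k * x)
  have h3 := (Real.hasDerivAt_rpow_const (p := r + k) (Or.inl hu.ne')).const_mul
    (r * (r - 1) * (1 + s * k) * y)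
  refine ((h1.add h2).add h3).congr_deriv ?_
  have h4 : u ^ (r - 1 - 1) = u ^ (r - 1) / u := Real.rpow_sub_one hu.ne' _
  have h5 : u ^ (r + k - 1) = u ^ (r - 1) * u ^ k := by rw [← Real.rpow_add hu]; ring_nf
  rw [h4, h5]
  field_simp
  ring

/-- Below the critical level, the support functions decrease in the parameter up to
`(1 - s) * x`. This is what allows the two halves of a cut to stick out slightly. -/
theorem supportFn_le_of_le {k r s K u x y : ℝ} (hk : 0 < k) (hr : 1 < r) (hs : 0 < s) (hs1 : s < 1)
    (hK : K * criticalFun k s < 1) (hx : 0 < x) (hy : 0 < y)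
    (hxy : x ^ k * y ≤ K) (hu : u ≤ (1 - s) * x)
    (hu' : k * ((1 - s) * x) ≤ (1 + k - K * criticalFun k s) * u) :
    supportFn k r s ((1 - s) * x) x y ≤ supportFn k r s u x y := by
  have h1s : 0 < 1 - s := by linarith
  have hΘ := criticalFun_pos hk hs.le hs1
  have hcoef : 0 < 1 + k - K * criticalFun k s := by linarith
  have hu0 : 0 < u :=
    (mul_pos_iff_of_pos_left hcoef).1 (lt_of_lt_of_le (by positivity) hu')
  have hanti : AntitoneOn (fun u => supportFn k r s u x y) (Icc u ((1 - s) * x)) := by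
    refine antitoneOn_of_deriv_nonpos (convex_Icc _ _) ?_ ?_ ?_
    · exact fun v hv => (supportFn_hasDerivAt (hu0.trans_le hv.1)).continuousAt.continuousWithinAt
    · exact fun v hv => (supportFn_hasDerivAt
        (hu0.trans_le (interior_subset hv).1)).differentiableAt.differentiableWithinAt
    · intro v hv
      have hv := interior_subset hv
      have hv0 : 0 < v := hu0.trans_le hv.1
      rw [(supportFn_hasDerivAt hv0).deriv]
      refine mul_nonpos_of_nonneg_of_nonpos ?_ ?_
      · have : 0 < r - 1 := by linarith
        positivity
      · have h1 : k * ((1 - s) * x / v) ≤ 1 + k - K * criticalFun k s := by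
          rw [← mul_div_assoc, div_le_iff₀ hv0]
          exact hu'.trans (mul_le_mul_of_nonneg_left hv.1 hcoef.le)
        have h2 : (1 + s * k) * (y * v ^ k) ≤ K * criticalFun k s := by
          have h3 : v ^ k ≤ (1 - s) ^ k * x ^ k := by
            rw [← Real.mul_rpow h1s.le hx.le]
            exact Real.rpow_le_rpow hv0.le hv.2 hk.le
          calc (1 + s * k) * (y * v ^ k)
              ≤ (1 + s * k) * (y * ((1 - s) ^ k * x ^ k)) := by gcongr
            _ = x ^ k * y * criticalFun k s := by rw [criticalFun]; ring
            _ ≤ K * criticalFun k s := mul_le_mul_of_nonneg_right hxy hΘ.le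
        linarith
  exact hanti ⟨le_rfl, hu⟩ ⟨hu, le_rfl⟩ hu

/-- There is a function `B` on the domain `1 ≤ x ^ k * y ≤ K` that is comparable to `x ^ r` and
concave along all splittings `(x, y) = θ (x₁, y₁) + (1 - θ) (x₂, y₂)` whose parts satisfy
`xᵢ ≤ (1 + ε) x`. The segment itself need not lie in the domain. -/
theorem exists_bellman {k r s K : ℝ} (hk : 0 < k) (hr : 1 < r) (hs : 0 < s) (hrs : r * s < 1)
    (hK : K * criticalFun k s < 1) :
    ∃ (B : ℝ → ℝ → ℝ) (c C ε : ℝ), 0 < c ∧ 0 < C ∧ 0 < ε ∧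
      (∀ x y, 0 < x → 0 < y → 1 ≤ x ^ k * y → x ^ k * y ≤ K →
        c * x ^ r ≤ B x y ∧ B x y ≤ C * x ^ r) ∧
      ∀ m₁ m₂ x₁ y₁ x₂ y₂ x y, 0 < m₁ → 0 < m₂ →
        0 < x₁ → 0 < y₁ → 1 ≤ x₁ ^ k * y₁ → x₁ ^ k * y₁ ≤ K → x₁ ≤ (1 + ε) * x →
        0 < x₂ → 0 < y₂ → 1 ≤ x₂ ^ k * y₂ → x₂ ^ k * y₂ ≤ K → x₂ ≤ (1 + ε) * x →
        m₁ * x₁ + m₂ * x₂ = (m₁ + m₂) * x → m₁ * y₁ + m₂ * y₂ = (m₁ + m₂) * y →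
        m₁ * B x₁ y₁ + m₂ * B x₂ y₂ ≤ (m₁ + m₂) * B x y := by
  obtain ⟨δ, hδ0, hδ⟩ := exists_forall_le_profile hk hr hs hrs
  have hs1 : s < 1 := by nlinarith
  have h1s : 0 < 1 - s := by linarith
  let B : ℝ → ℝ → ℝ := fun x y => sInf ((fun u => supportFn k r s u x y) '' Ici ((1 - s) * x))
  have hbdd : ∀ x y, 0 < x → 1 ≤ x ^ k * y → δ * ((1 - s) * x) ^ r ∈
      lowerBounds ((fun u => supportFn k r s u x y) '' Ici ((1 - s) * x)) := by
    rintro x y hx hxy _ ⟨u, hu, rfl⟩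
    have hx' : 0 < (1 - s) * x := by positivity
    have hu0 : 0 < u := hx'.trans_le hu
    refine le_trans ?_ (le_supportFn hk hr hs hδ hu0 hx hxy)
    exact mul_le_mul_of_nonneg_left (Real.rpow_le_rpow hx'.le hu (by linarith)) hδ0.le
  have hBle : ∀ x y u, 0 < x → 1 ≤ x ^ k * y → (1 - s) * x ≤ u → B x y ≤ supportFn k r s u x y :=
    fun x y u hx hxy hu => csInf_le ⟨_, hbdd x y hx hxy⟩ ⟨u, hu, rfl⟩
  refine ⟨B, δ * (1 - s) ^ r, r * (1 - s) * (r + k) * k * (1 - s) ^ (r - 1) +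
      r * (r - 1) * (1 + s * k) * |K| * (1 - s) ^ (r + k) , (1 - K * criticalFun k s) / k,
      by positivity, by positivity, div_pos (by linarith) hk, ?_, ?_⟩
  · intro x y hx hy hxy hxyK
    constructor
    · have := le_csInf (nonempty_Ici.image _) (hbdd x y hx hxy)
      rwa [Real.mul_rpow h1s.le hx.le, ← mul_assoc] at this
    · refine (hBle x y _ hx hxy le_rfl).trans ?_
      have e1 : ((1 - s) * x) ^ (r - 1) = (1 - s) ^ (r - 1) * (x ^ r / x) := by
        rw [Real.mul_rpow h1s.le hx.le, Real.rpow_sub_one hx.ne']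
      have e2 : ((1 - s) * x) ^ (r + k) = (1 - s) ^ (r + k) * (x ^ r * x ^ k) := by
        rw [Real.mul_rpow h1s.le hx.le, Real.rpow_add hx]
      have e3 : 0 ≤ (r + k) * (r - 1) * (1 + k) * ((1 - s) * x) ^ r := by positivity
      have e4 : r * (r - 1) * (1 + s * k) * y * ((1 - s) ^ (r + k) * (x ^ r * x ^ k)) ≤
          r * (r - 1) * (1 + s * k) * |K| * (1 - s) ^ (r + k) * x ^ r := by
        have : r * (r - 1) * (1 + s * k) * y * ((1 - s) ^ (r + k) * (x ^ r * x ^ k)) =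
          r * (r - 1) * (1 + s * k) * (1 - s) ^ (r + k) * x ^ r * (x ^ k * y) := by ring
        rw [this]
        have := mul_le_mul_of_nonneg_left (hxyK.trans (le_abs_self K))
          (by positivity : 0 ≤ r * (r - 1) * (1 + s * k) * (1 - s) ^ (r + k) * x ^ r)
        linarith
      have e5 : r * (1 - s) * (r + k) * k * x * ((1 - s) ^ (r - 1) * (x ^ r / x)) =
        r * (1 - s) * (r + k) * k * (1 - s) ^ (r - 1) * x ^ r := by field_simp
      rw [supportFn, e1, e2, e5]
      linarith
  · intro m₁ m₂ x₁ y₁ x₂ y₂ x y hm₁ hm₂ hx₁ hy₁ h₁ h₁' h₁x hx₂ hy₂ h₂ h₂' h₂x hx hy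
    have key : ∀ u, (1 - s) * x ≤ u → ∀ a b, 0 < a → 0 < b → 1 ≤ a ^ k * b → a ^ k * b ≤ K →
        a ≤ (1 + (1 - K * criticalFun k s) / k) * x → B a b ≤ supportFn k r s u a b := by
      intro u hu a b ha hb hab habK hax
      rcases le_total ((1 - s) * a) u with hua | hua
      · exact hBle a b u ha hab hua
      · refine (hBle a b _ ha hab le_rfl).trans
          (supportFn_le_of_le hk hr hs hs1 hK ha hb habK hua ?_)
        have e : (1 + (1 - K * criticalFun k s) / k) * k = 1 + k - K * criticalFun k s := by
          field_simp; ring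
        rw [← e]
        have hc : 0 ≤ (1 + (1 - K * criticalFun k s) / k) * k := by rw [e]; linarith
        have e1 := mul_le_mul_of_nonneg_left hax (by positivity : 0 ≤ k * (1 - s))
        have e2 := mul_le_mul_of_nonneg_left hu hc
        linarith
    rw [mul_comm (m₁ + m₂), ← div_le_iff₀ (by positivity)]
    refine le_csInf (nonempty_Ici.image _) ?_
    rintro _ ⟨u, hu, rfl⟩
    rw [div_le_iff₀ (by positivity)]
    have e1 := mul_le_mul_of_nonneg_left (key u hu x₁ y₁ hx₁ hy₁ h₁ h₁' h₁x) hm₁.le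
    have e2 := mul_le_mul_of_nonneg_left (key u hu x₂ y₂ hx₂ hy₂ h₂ h₂' h₂x) hm₂.le
    have e3 : m₁ * supportFn k r s u x₁ y₁ + m₂ * supportFn k r s u x₂ y₂ =
        supportFn k r s u x y * (m₁ + m₂) := by
      simp only [supportFn]
      linear_combination (r * (1 - s) * (r + k) * k * u ^ (r - 1)) * hx +
        (r * (r - 1) * (1 + s * k) * u ^ (r + k)) * hy
    linarith

/-! ### Cutting a box by a hyperplane -/

theorem continuous_setIntegral_le_coord {n : ℕ} {ν : Measure (Fin n → ℝ)} {f : (Fin n → ℝ) → ℝ}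
    (hf : Integrable f ν) (i : Fin n) (hν : ∀ c : ℝ, ν {x | x i = c} = 0) :
    Continuous fun c : ℝ => ∫ x in {x | x i ≤ c}, f x ∂ν := by
  have hmeas : ∀ c : ℝ, MeasurableSet {x : Fin n → ℝ | x i ≤ c} := fun c =>
    measurableSet_le (measurable_pi_apply i) measurable_const
  simp_rw [← fun c : ℝ => integral_indicator (μ := ν) (f := f) (hmeas c)]
  refine continuous_iff_continuousAt.2 fun c => ?_
  refine continuousAt_of_dominated (bound := fun x => ‖f x‖)
    (.of_forall fun d => (hf.aestronglyMeasurable.indicator (hmeas d)))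
    (.of_forall fun d => .of_forall fun x => norm_indicator_le_norm_self _ _) hf.norm ?_
  have h : ∀ᵐ x ∂ν, x i ≠ c := by
    rw [ae_iff]; simpa using hν c
  filter_upwards [h] with x hx
  rcases lt_or_gt_of_ne hx with hlt | hlt
  · refine ContinuousAt.congr (f := fun _ => f x) continuousAt_const ?_
    filter_upwards [lt_mem_nhds hlt] with d hd
    rw [indicator_of_mem]
    exact hd.le
  · refine ContinuousAt.congr (f := fun _ => 0) continuousAt_const ?_
    filter_upwards [gt_mem_nhds hlt] with d hd
    rw [indicator_of_notMem]
    exact not_le.2 hd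

/-- The intermediate value argument behind the choice of a cut. Here `m c` is the mass and `W c`
the integral of the weight to the left of the cut. The cut that bisects the mass is moved, if one
side has too large an average, until that average is exactly `1 + ε` times the full one. -/
theorem exists_balanced_cut {m W : ℝ → ℝ} {a b ε M I : ℝ} (hm : Continuous m) (hW : Continuous W)
    (hmm : Monotone m) (hWm : Monotone W) (hab : a ≤ b) (hma : m a = 0) (hWa : W a = 0)
    (hmb : m b = M) (hWb : W b = I) (hM : 0 < M) (hI : 0 < I) (hε : 0 < ε) :
    ∃ c ∈ Icc a b, ε / (2 * (1 + ε)) * M ≤ m c ∧ ε / (2 * (1 + ε)) * M ≤ M - m c ∧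
      W c * M ≤ (1 + ε) * I * m c ∧ (I - W c) * M ≤ (1 + ε) * I * (M - m c) := by
  obtain ⟨c₀, hc₀, hmc₀⟩ := intermediate_value_Icc hab hm.continuousOn
    (show M / 2 ∈ Icc (m a) (m b) by rw [hma, hmb]; constructor <;> linarith)
  set α := ε / (2 * (1 + ε)) with hα
  have hα2 : α * (2 * (1 + ε)) = ε := by rw [hα]; field_simp
  by_cases h1 : W c₀ * M ≤ (1 + ε) * I * m c₀
  · by_cases h2 : (I - W c₀) * M ≤ (1 + ε) * I * (M - m c₀)
    · exact ⟨c₀, hc₀, by rw [hmc₀]; nlinarith, by rw [hmc₀]; nlinarith, h1, h2⟩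
    · push Not at h2
      obtain ⟨c, hc, hkc⟩ := intermediate_value_Icc hc₀.1
        (f := fun c => (I - W c) * M - (1 + ε) * I * (M - m c)) (by fun_prop)
        (show (0 : ℝ) ∈ Icc _ _ by
          simp only [hWa, hma]
          constructor
          · nlinarith [mul_pos hI hM, mul_pos hε (mul_pos hI hM)]
          · linarith)
      have hWc : 0 ≤ W c := hWa ▸ hWm hc.1
      have hmc : m c ≤ M / 2 := hmc₀ ▸ hmm hc.2
      have hkc : (I - W c) * M = (1 + ε) * I * (M - m c) := by simpa [sub_eq_zero] using hkc
      have hle : (1 + ε) * (M - m c) ≤ M := by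
        have h : I * ((1 + ε) * (M - m c)) ≤ I * M := by nlinarith [mul_nonneg hWc hM.le]
        exact le_of_mul_le_mul_left h hI
      have hmc0 : 0 ≤ m c := hma ▸ hmm hc.1
      refine ⟨c, ⟨hc.1, hc.2.trans hc₀.2⟩, ?_, by nlinarith, ?_, hkc.le⟩
      · have h : (1 + ε) * (α * M) ≤ (1 + ε) * m c := by nlinarith
        exact le_of_mul_le_mul_left h (by linarith)
      · nlinarith [mul_nonneg (mul_nonneg hε.le hI.le) hmc0,
          mul_nonneg (mul_nonneg hε.le hI.le) (by linarith : 0 ≤ M - m c)]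
  · push Not at h1
    obtain ⟨c, hc, hkc⟩ := intermediate_value_Icc' hc₀.2
      (f := fun c => W c * M - (1 + ε) * I * m c) (by fun_prop)
      (show (0 : ℝ) ∈ Icc _ _ by
        simp only [hWb, hmb]
        constructor
        · nlinarith [mul_pos hI hM, mul_pos hε (mul_pos hI hM)]
        · linarith)
    have hWc : W c ≤ I := hWb ▸ hWm hc.2
    have hmc : M / 2 ≤ m c := hmc₀ ▸ hmm hc.1
    have hmcM : m c ≤ M := hmb ▸ hmm hc.2
    have hkc : W c * M = (1 + ε) * I * m c := by simpa [sub_eq_zero] using hkc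
    have hle : (1 + ε) * m c ≤ M := by
      have h : I * ((1 + ε) * m c) ≤ I * M := by nlinarith
      exact le_of_mul_le_mul_left h hI
    refine ⟨c, ⟨hc₀.1.trans hc.1, hc.2⟩, by nlinarith, ?_, hkc.le, ?_⟩
    · have h : (1 + ε) * (α * M) ≤ (1 + ε) * (M - m c) := by nlinarith
      exact le_of_mul_le_mul_left h (by linarith)
    · nlinarith [mul_nonneg (mul_nonneg hε.le hI.le) (by linarith : 0 ≤ M - m c),
        mul_nonneg (mul_nonneg hε.le hI.le) (by linarith : 0 ≤ m c)]

/-- A box `∏ [P.1 i, P.2 i]` with nonempty interior and positive measure, one of those over which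
the characteristics of weights are formed. -/
def IsAdmissible {n : ℕ} (μ : Measure (Fin n → ℝ)) (P : (Fin n → ℝ) × (Fin n → ℝ)) : Prop :=
  (∀ i, P.1 i < P.2 i) ∧ μ (Icc P.1 P.2) ≠ 0

theorem Icc_update_right {n : ℕ} {a b : Fin n → ℝ} {i : Fin n} {c : ℝ} (hc : c ≤ b i) :
    Icc a (Function.update b i c) = Icc a b ∩ {x | x i ≤ c} := by
  ext x
  simp only [mem_Icc, Pi.le_def, mem_inter_iff, mem_ofPred_eq]
  constructor
  · rintro ⟨h1, h2⟩
    have hi : x i ≤ c := by simpa using h2 i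
    refine ⟨⟨h1, fun j => ?_⟩, hi⟩
    by_cases hj : j = i
    · subst hj; exact hi.trans hc
    · simpa [hj] using h2 j
  · rintro ⟨⟨h1, h2⟩, h3⟩
    refine ⟨h1, fun j => ?_⟩
    by_cases hj : j = i
    · subst hj; simpa using h3
    · simpa [hj] using h2 j

theorem Icc_update_left {n : ℕ} {a b : Fin n → ℝ} {i : Fin n} {c : ℝ} (hc : a i ≤ c) :
    Icc (Function.update a i c) b = Icc a b ∩ {x | c ≤ x i} := by
  ext x
  simp only [mem_Icc, Pi.le_def, mem_inter_iff, mem_ofPred_eq]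
  constructor
  · rintro ⟨h1, h2⟩
    have hi : c ≤ x i := by simpa using h1 i
    refine ⟨⟨fun j => ?_, h2⟩, hi⟩
    by_cases hj : j = i
    · subst hj; exact hc.trans hi
    · simpa [hj] using h1 j
  · rintro ⟨⟨h1, h2⟩, h3⟩
    refine ⟨fun j => ?_, h2⟩
    by_cases hj : j = i
    · subst hj; simpa using h3
    · simpa [hj] using h1 j

/-- Every admissible box can be cut in every direction into two boxes with a fixed share of the
mass each, such that neither average of `w` exceeds that of the box by more than a factor
`1 + ε`. -/
theorem exists_cut {n : ℕ} {μ : Measure (Fin n → ℝ)} [IsLocallyFiniteMeasure μ]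
    (hμ : ∀ (i : Fin n) (c : ℝ), μ {x | x i = c} = 0) {w : (Fin n → ℝ) → ℝ}
    (hw : ∀ᵐ x ∂μ, 0 < w x) {P : (Fin n → ℝ) × (Fin n → ℝ)} (hP : IsAdmissible μ P)
    (hwP : IntegrableOn w (Icc P.1 P.2) μ) {ε : ℝ} (hε : 0 < ε) (i : Fin n) :
    ∃ c, P.1 i < c ∧ c < P.2 i ∧ ∃ P₁ P₂, IsAdmissible μ P₁ ∧ IsAdmissible μ P₂ ∧
      P₁ = (P.1, Function.update P.2 i c) ∧ P₂ = (Function.update P.1 i c, P.2) ∧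
      (∀ f : (Fin n → ℝ) → ℝ, IntegrableOn f (Icc P.1 P.2) μ →
        IntegrableOn f (Icc P₁.1 P₁.2) μ ∧ IntegrableOn f (Icc P₂.1 P₂.2) μ ∧
        ∫ x in Icc P.1 P.2, f x ∂μ =
          ∫ x in Icc P₁.1 P₁.2, f x ∂μ + ∫ x in Icc P₂.1 P₂.2, f x ∂μ) ∧
      μ.real (Icc P.1 P.2) = μ.real (Icc P₁.1 P₁.2) + μ.real (Icc P₂.1 P₂.2) ∧
      ε / (2 * (1 + ε)) * μ.real (Icc P.1 P.2) ≤ μ.real (Icc P₁.1 P₁.2) ∧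
      ε / (2 * (1 + ε)) * μ.real (Icc P.1 P.2) ≤ μ.real (Icc P₂.1 P₂.2) ∧
      (∫ x in Icc P₁.1 P₁.2, w x ∂μ) * μ.real (Icc P.1 P.2) ≤
        (1 + ε) * (∫ x in Icc P.1 P.2, w x ∂μ) * μ.real (Icc P₁.1 P₁.2) ∧
      (∫ x in Icc P₂.1 P₂.2, w x ∂μ) * μ.real (Icc P.1 P.2) ≤
        (1 + ε) * (∫ x in Icc P.1 P.2, w x ∂μ) * μ.real (Icc P₂.1 P₂.2) := by
  obtain ⟨a, b⟩ := P
  obtain ⟨hab, hP0⟩ := hP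
  simp only at hab hP0 hwP ⊢
  set R := Icc a b
  have hfin : μ R < ∞ := isCompact_Icc.measure_lt_top
  set ν := μ.restrict R with hν
  have : IsFiniteMeasure ν := ⟨by rwa [hν, Measure.restrict_apply_univ]⟩
  have hmeas : ∀ c : ℝ, MeasurableSet {x : Fin n → ℝ | x i ≤ c} := fun c =>
    measurableSet_le (measurable_pi_apply i) measurable_const
  have hν0 : ∀ c : ℝ, ν {x | x i = c} = 0 := fun c =>
    le_antisymm ((Measure.restrict_apply_le _ _).trans (hμ i c).le) (zero_le)
  have hwν : ∀ᵐ x ∂ν, 0 < w x := ae_restrict_of_ae hw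
  have hL : ∀ c ≤ b i, Icc a (Function.update b i c) = R ∩ {x | x i ≤ c} :=
    fun c hc => Icc_update_right hc
  have hrestr : ∀ c ≤ b i, ν.restrict {x | x i ≤ c} =
      μ.restrict (Icc a (Function.update b i c)) := fun c hc => by
    rw [hν, Measure.restrict_restrict (hmeas c), hL c hc, inter_comm]
  -- the two parts of a cut overlap only in a hyperplane
  have hRr : ∀ c, a i ≤ c → (Icc (Function.update a i c) b : Set (Fin n → ℝ)) =ᵐ[μ]
      (R \ {x | x i ≤ c} : Set (Fin n → ℝ)) := fun c hc => by
    rw [Icc_update_left hc]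
    have : ∀ᵐ x ∂μ, x i ≠ c := by rw [ae_iff]; simpa using hμ i c
    filter_upwards [this] with x hx
    apply propext
    change (x ∈ R ∧ c ≤ x i) ↔ (x ∈ R ∧ ¬ x i ≤ c)
    rw [not_le, le_iff_lt_or_eq]
    tauto
  have hsplit : ∀ c, a i ≤ c → c ≤ b i → ∀ f : (Fin n → ℝ) → ℝ, IntegrableOn f R μ →
      IntegrableOn f (Icc a (Function.update b i c)) μ ∧
      IntegrableOn f (Icc (Function.update a i c) b) μ ∧
      ∫ x in R, f x ∂μ = ∫ x in Icc a (Function.update b i c), f x ∂μ +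
        ∫ x in Icc (Function.update a i c) b, f x ∂μ := fun c hac hcb f hf => by
    refine ⟨hf.mono_set ?_, hf.mono_set ?_, ?_⟩
    · rw [hL c hcb]; exact inter_subset_left
    · rw [Icc_update_left hac]; exact inter_subset_left
    · rw [setIntegral_congr_set (hRr c hac), hL c hcb]
      exact (integral_inter_add_sdiff (hmeas c) hf).symm
  have hmass : ∀ c, a i ≤ c → c ≤ b i → μ.real R = μ.real (Icc a (Function.update b i c)) +
      μ.real (Icc (Function.update a i c) b) := fun c hac hcb => by
    have h := (hsplit c hac hcb (fun _ => (1 : ℝ)) (integrableOn_const hfin.ne)).2.2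
    simpa using h
  let m : ℝ → ℝ := fun c => ∫ _ in {x | x i ≤ c}, (1 : ℝ) ∂ν
  let W : ℝ → ℝ := fun c => ∫ x in {x | x i ≤ c}, w x ∂ν
  have hmc : ∀ c ≤ b i, m c = μ.real (Icc a (Function.update b i c)) := fun c hc => by
    simp only [m, hrestr c hc]; simp
  have hWc : ∀ c ≤ b i, W c = ∫ x in Icc a (Function.update b i c), w x ∂μ := fun c hc => by
    simp only [W, hrestr c hc]
  have hzero : ν {x | x i ≤ a i} = 0 := by
    refine le_antisymm ?_ zero_le
    rw [hν, Measure.restrict_apply (hmeas _), ← hμ i (a i)]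
    refine measure_mono fun x hx => le_antisymm hx.1 (hx.2.1 i)
  have hfull : ν.restrict {x | x i ≤ b i} = ν := by
    rw [hrestr _ le_rfl, Function.update_eq_self]
  have hM : 0 < μ.real R := ENNReal.toReal_pos hP0 hfin.ne
  have hI : 0 < ∫ x in R, w x ∂μ := by
    rw [integral_pos_iff_support_of_nonneg_ae (hwν.mono fun x hx => hx.le) hwP]
    refine lt_of_lt_of_eq (pos_iff_ne_zero.2 hP0) ?_
    have h1 : ∀ᵐ x ∂ν, x ∈ Function.support w := hwν.mono fun x hx => hx.ne'
    rw [measure_eq_measure_of_null_sdiff (subset_univ (Function.support w))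
      (by rw [← compl_eq_univ_sdiff]; exact h1), hν, Measure.restrict_apply_univ]
  obtain ⟨c, hc, h1, h2, h3, h4⟩ := exists_balanced_cut (m := m) (W := W) (a := a i) (b := b i)
    (M := μ.real R) (I := ∫ x in R, w x ∂μ) (ε := ε)
    (continuous_setIntegral_le_coord (integrable_const 1) i hν0)
    (continuous_setIntegral_le_coord hwP i hν0)
    (fun c d hcd => setIntegral_mono_set (integrable_const (1 : ℝ)).integrableOn
      (.of_forall fun _ => zero_le_one) (.of_forall fun x hx => le_trans hx hcd))
    (fun c d hcd => setIntegral_mono_set (Integrable.integrableOn hwP)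
      (ae_restrict_of_ae (hwν.mono fun x hx => hx.le)) (.of_forall fun x hx => le_trans hx hcd))
    (hab i).le (by simp only [m, Measure.restrict_eq_zero.2 hzero, integral_zero_measure])
    (by simp only [W, Measure.restrict_eq_zero.2 hzero, integral_zero_measure])
    (by simp only [m, hfull]; simp [hν]) (by simp only [W, hfull]; rfl) hM hI hε
  have hadd := hmass c hc.1 hc.2
  have haddw := (hsplit c hc.1 hc.2 w hwP).2.2
  rw [hmc c hc.2] at h1 h2 h3 h4
  rw [hWc c hc.2] at h3 h4
  have hα : 0 < ε / (2 * (1 + ε)) * μ.real R := by positivity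
  have hac : a i < c := by
    refine lt_of_le_of_ne hc.1 ?_
    rintro rfl
    have h0 : m (a i) = 0 := by
      simp only [m, Measure.restrict_eq_zero.2 hzero, integral_zero_measure]
    rw [hmc _ hc.2] at h0
    linarith
  have hcb : c < b i := by
    refine lt_of_le_of_ne hc.2 ?_
    rintro rfl
    rw [Function.update_eq_self] at h2
    linarith
  have e2 : μ.real (Icc (Function.update a i c) b) =
      μ.real R - μ.real (Icc a (Function.update b i c)) := by linarith
  have ew : ∫ x in Icc (Function.update a i c) b, w x ∂μ =
      ∫ x in R, w x ∂μ - ∫ x in Icc a (Function.update b i c), w x ∂μ := by linarith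
  refine ⟨c, hac, hcb, _, _, ⟨fun j => ?_, fun h => ?_⟩, ⟨fun j => ?_, fun h => ?_⟩, rfl, rfl,
    hsplit c hc.1 hc.2, hadd, h1, by rw [e2]; exact h2, h3, by rw [e2, ew]; exact h4⟩
  · by_cases hj : j = i
    · subst hj; simpa using hac
    · simpa [hj] using hab j
  · have : μ.real (Icc a (Function.update b i c)) = 0 := by simp [Measure.real, h]
    linarith
  · by_cases hj : j = i
    · subst hj; simpa using hcb
    · simpa [hj] using hab j
  · have : μ.real (Icc (Function.update a i c) b) = 0 := by simp [Measure.real, h]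
    linarith

/-! ### Iterated cuts -/

/-- Every admissible box can be cut in every direction into two admissible boxes that both carry at
least the share `α` of its mass, so that `V` does not increase in total. -/
def HasCuts {n : ℕ} (μ : Measure (Fin n → ℝ)) (V : (Fin n → ℝ) × (Fin n → ℝ) → ℝ) (α : ℝ) : Prop :=
  ∀ P, IsAdmissible μ P → ∀ i, ∃ c, P.1 i < c ∧ c < P.2 i ∧ ∃ P₁ P₂,
    IsAdmissible μ P₁ ∧ IsAdmissible μ P₂ ∧
    P₁ = (P.1, Function.update P.2 i c) ∧ P₂ = (Function.update P.1 i c, P.2) ∧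
    (∀ f : (Fin n → ℝ) → ℝ, IntegrableOn f (Icc P.1 P.2) μ →
      IntegrableOn f (Icc P₁.1 P₁.2) μ ∧ IntegrableOn f (Icc P₂.1 P₂.2) μ ∧
      ∫ x in Icc P.1 P.2, f x ∂μ =
        ∫ x in Icc P₁.1 P₁.2, f x ∂μ + ∫ x in Icc P₂.1 P₂.2, f x ∂μ) ∧
    μ.real (Icc P.1 P.2) = μ.real (Icc P₁.1 P₁.2) + μ.real (Icc P₂.1 P₂.2) ∧
    α * μ.real (Icc P.1 P.2) ≤ μ.real (Icc P₁.1 P₁.2) ∧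
    α * μ.real (Icc P.1 P.2) ≤ μ.real (Icc P₂.1 P₂.2) ∧ V P₁ + V P₂ ≤ V P

/-- Iterating cuts along a prescribed list of directions. Every cut in direction `i` removes a
fixed share of the mass of those boxes whose `i`-th side contains a given interval `[c, d]`; so
sides become short on most of the mass. -/
theorem exists_partition {n : ℕ} {μ : Measure (Fin n → ℝ)}
    {V : (Fin n → ℝ) × (Fin n → ℝ) → ℝ} {α : ℝ} (hα : α ≤ 1)
    (hcut : HasCuts μ V α)
    (ds : List (Fin n)) (R : (Fin n → ℝ) × (Fin n → ℝ)) (hR : IsAdmissible μ R) :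
    ∃ Ps : List ((Fin n → ℝ) × (Fin n → ℝ)),
      (∀ P ∈ Ps, IsAdmissible μ P ∧ R.1 ≤ P.1 ∧ P.2 ≤ R.2) ∧
      (∀ f : (Fin n → ℝ) → ℝ, IntegrableOn f (Icc R.1 R.2) μ →
        ∫ x in Icc R.1 R.2, f x ∂μ = (Ps.map fun P => ∫ x in Icc P.1 P.2, f x ∂μ).sum) ∧
      (Ps.map V).sum ≤ V R ∧
      ∀ i c d, c < d → (Ps.map fun P =>
        if P.1 i ≤ c ∧ d ≤ P.2 i then μ.real (Icc P.1 P.2) else 0).sum ≤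
        (1 - α) ^ ds.count i * if R.1 i ≤ c ∧ d ≤ R.2 i then μ.real (Icc R.1 R.2) else 0 := by
  induction ds generalizing R with
  | nil => exact ⟨[R], by simpa using hR, by simp, by simp, by simp⟩
  | cons i ds ih =>
    obtain ⟨e, he1, he2, P₁, P₂, h₁, h₂, hP₁, hP₂, hf, hadd, hm₁, hm₂, hV⟩ := hcut R hR i
    obtain ⟨Q₁, hQ₁, hf₁, hV₁, hs₁⟩ := ih P₁ h₁
    obtain ⟨Q₂, hQ₂, hf₂, hV₂, hs₂⟩ := ih P₂ h₂
    have hle₁ : R.1 ≤ P₁.1 ∧ P₁.2 ≤ R.2 := by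
      rw [hP₁]
      exact ⟨le_rfl, update_le_self_iff.2 he2.le⟩
    have hle₂ : R.1 ≤ P₂.1 ∧ P₂.2 ≤ R.2 := by
      rw [hP₂]
      exact ⟨le_update_self_iff.2 he1.le, le_rfl⟩
    refine ⟨Q₁ ++ Q₂, ?_, ?_, ?_, ?_⟩
    · intro P hP
      rcases List.mem_append.1 hP with hP | hP
      · exact ⟨(hQ₁ P hP).1, hle₁.1.trans (hQ₁ P hP).2.1, (hQ₁ P hP).2.2.trans hle₁.2⟩
      · exact ⟨(hQ₂ P hP).1, hle₂.1.trans (hQ₂ P hP).2.1, (hQ₂ P hP).2.2.trans hle₂.2⟩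
    · intro f hfR
      obtain ⟨k₁, k₂, k₃⟩ := hf f hfR
      rw [List.map_append, List.sum_append, ← hf₁ f k₁, ← hf₂ f k₂, k₃]
    · rw [List.map_append, List.sum_append]
      linarith
    · intro j c d hcd
      rw [List.map_append, List.sum_append]
      refine (add_le_add (hs₁ j c d hcd) (hs₂ j c d hcd)).trans ?_
      rw [← mul_add]
      have hα0 : 0 ≤ (1 - α) ^ ds.count j := pow_nonneg (by linarith) _
      have hr₁ : 0 ≤ μ.real (Icc P₁.1 P₁.2) := measureReal_nonneg
      have hr₂ : 0 ≤ μ.real (Icc P₂.1 P₂.2) := measureReal_nonneg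
      by_cases hRj : R.1 j ≤ c ∧ d ≤ R.2 j
      · rw [if_pos hRj]
        by_cases hij : i = j
        · subst hij
          rw [List.count_cons_self, pow_succ, mul_assoc]
          refine mul_le_mul_of_nonneg_left ?_ hα0
          by_cases hc₁ : P₁.1 i ≤ c ∧ d ≤ P₁.2 i
          · have hc₂ : ¬ (P₂.1 i ≤ c ∧ d ≤ P₂.2 i) := by
              rintro ⟨h, _⟩
              have h' := hc₁.2
              rw [hP₂] at h
              rw [hP₁] at h'
              simp only [Function.update_self] at h h'
              linarith
            rw [if_pos hc₁, if_neg hc₂]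
            linarith
          · rw [if_neg hc₁]
            split_ifs <;> nlinarith
        · rw [List.count_cons_of_ne hij]
          refine mul_le_mul_of_nonneg_left ?_ hα0
          split_ifs <;> linarith
      · have n₁ : ¬ (P₁.1 j ≤ c ∧ d ≤ P₁.2 j) := fun h =>
          hRj ⟨(hle₁.1 j).trans h.1, h.2.trans (hle₁.2 j)⟩
        have n₂ : ¬ (P₂.1 j ≤ c ∧ d ≤ P₂.2 j) := fun h =>
          hRj ⟨(hle₂.1 j).trans h.1, h.2.trans (hle₂.2 j)⟩
        rw [if_neg n₁, if_neg n₂, if_neg hRj]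
        simp

theorem exists_list_le_count (n N : ℕ) : ∃ ds : List (Fin n), ∀ i, N ≤ ds.count i := by
  induction N with
  | zero => exact ⟨[], fun i => Nat.zero_le _⟩
  | succ N ih =>
    obtain ⟨ds, h⟩ := ih
    refine ⟨List.finRange n ++ ds, fun i => ?_⟩
    rw [List.count_append, List.count_eq_one_of_mem (List.nodup_finRange n) (List.mem_finRange i)]
    have := h i
    omega

/-- Finitely many intervals such that every interval of length at least `δ` with left end point in
`[A, B]` contains one of them. -/
theorem exists_grid (δ A B : ℝ) (hδ : 0 < δ) :
    ∃ J : ℕ, ∀ a b, A ≤ a → a ≤ B → δ ≤ b - a →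
      ∃ j < J, a ≤ A + δ / 2 * j ∧ A + δ / 2 * j + δ / 2 ≤ b := by
  obtain ⟨J, hJ⟩ := exists_nat_gt ((B - A) / (δ / 2) + 1)
  refine ⟨J, fun a b ha haB hab => ⟨⌈(a - A) / (δ / 2)⌉₊, ?_, ?_, ?_⟩⟩
  · have h1 : (0 : ℝ) ≤ (a - A) / (δ / 2) := div_nonneg (by linarith) (by linarith)
    have h2 := Nat.ceil_lt_add_one h1
    have h3 : (a - A) / (δ / 2) ≤ (B - A) / (δ / 2) := by gcongr
    exact_mod_cast h2.trans_le (by linarith : (a - A) / (δ / 2) + 1 ≤ (J : ℝ))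
  · have h := Nat.le_ceil ((a - A) / (δ / 2))
    rw [div_le_iff₀ (by positivity)] at h
    linarith
  · have h1 : (0 : ℝ) ≤ (a - A) / (δ / 2) := div_nonneg (by linarith) (by linarith)
    have h2 := (Nat.ceil_lt_add_one h1).le
    have h3 : δ / 2 * (⌈(a - A) / (δ / 2)⌉₊ : ℝ) ≤ δ / 2 * ((a - A) / (δ / 2) + 1) := by gcongr
    have h4 : δ / 2 * ((a - A) / (δ / 2) + 1) = a - A + δ / 2 := by field_simp
    linarith

/-- The mean `μ(P)⁻¹ ∫_P f dμ` as a real number. -/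
noncomputable def boxMean {n : ℕ} (μ : Measure (Fin n → ℝ)) (f : (Fin n → ℝ) → ℝ)
    (P : (Fin n → ℝ) × (Fin n → ℝ)) : ℝ :=
  (∫ x in Icc P.1 P.2, f x ∂μ) / μ.real (Icc P.1 P.2)

theorem IsAdmissible.measureReal_pos {n : ℕ} {μ : Measure (Fin n → ℝ)} [IsLocallyFiniteMeasure μ]
    {P : (Fin n → ℝ) × (Fin n → ℝ)} (hP : IsAdmissible μ P) : 0 < μ.real (Icc P.1 P.2) :=
  ENNReal.toReal_pos hP.2 isCompact_Icc.measure_lt_top.ne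

theorem integral_abs_sub_boxMean_le {n : ℕ} {μ : Measure (Fin n → ℝ)} [IsLocallyFiniteMeasure μ]
    {P : (Fin n → ℝ) × (Fin n → ℝ)} (hP : IsAdmissible μ P) {w : (Fin n → ℝ) → ℝ}
    (hw : IntegrableOn w (Icc P.1 P.2) μ) (c : ℝ) :
    ∫ x in Icc P.1 P.2, |w x - boxMean μ w P| ∂μ ≤ 2 * ∫ x in Icc P.1 P.2, |w x - c| ∂μ := by
  have hm := hP.measureReal_pos
  have hfin : μ (Icc P.1 P.2) ≠ ∞ := isCompact_Icc.measure_lt_top.ne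
  have hc : ∀ d : ℝ, IntegrableOn (fun _ => d) (Icc P.1 P.2) μ := fun d => integrableOn_const hfin
  have hwc : IntegrableOn (fun x => w x - c) (Icc P.1 P.2) μ := hw.sub (hc c)
  have h1 : |c - boxMean μ w P| * μ.real (Icc P.1 P.2) ≤ ∫ x in Icc P.1 P.2, |w x - c| ∂μ := by
    have h2 : ∫ x in Icc P.1 P.2, (w x - c) ∂μ =
        (boxMean μ w P - c) * μ.real (Icc P.1 P.2) := by
      rw [integral_sub hw (hc c), boxMean, sub_mul, div_mul_cancel₀ _ hm.ne']
      simp [mul_comm]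
    have h3 := abs_integral_le_integral_abs (f := fun x => w x - c) (μ := μ.restrict (Icc P.1 P.2))
    rw [h2, abs_mul, abs_of_pos hm, abs_sub_comm] at h3
    exact h3
  calc ∫ x in Icc P.1 P.2, |w x - boxMean μ w P| ∂μ
      ≤ ∫ x in Icc P.1 P.2, (|w x - c| + |c - boxMean μ w P|) ∂μ := by
        refine integral_mono (hw.sub (hc _)).abs (hwc.abs.add (hc _)) fun x => ?_
        exact abs_sub_le _ _ _
    _ = ∫ x in Icc P.1 P.2, |w x - c| ∂μ + |c - boxMean μ w P| * μ.real (Icc P.1 P.2) := by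
        rw [integral_add hwc.abs (hc _)]; simp [mul_comm]
    _ ≤ _ := by linarith

/-- Along suitable partitions by iterated cuts, the weight is close in `L¹` to its means. -/
theorem exists_partition_integral_abs_sub_le {n : ℕ} {μ : Measure (Fin n → ℝ)}
    [IsLocallyFiniteMeasure μ]
    {V : (Fin n → ℝ) × (Fin n → ℝ) → ℝ} {α : ℝ} (hα0 : 0 < α) (hα : α ≤ 1)
    (hcut : HasCuts μ V α)
    (R : (Fin n → ℝ) × (Fin n → ℝ)) (hR : IsAdmissible μ R) {w : (Fin n → ℝ) → ℝ}
    (hw : IntegrableOn w (Icc R.1 R.2) μ) {η : ℝ} (hη : 0 < η) :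
    ∃ Ps : List ((Fin n → ℝ) × (Fin n → ℝ)),
      (∀ P ∈ Ps, IsAdmissible μ P ∧ R.1 ≤ P.1 ∧ P.2 ≤ R.2) ∧
      (∀ f : (Fin n → ℝ) → ℝ, IntegrableOn f (Icc R.1 R.2) μ →
        ∫ x in Icc R.1 R.2, f x ∂μ = (Ps.map fun P => ∫ x in Icc P.1 P.2, f x ∂μ).sum) ∧
      (Ps.map V).sum ≤ V R ∧
      (Ps.map fun P => ∫ x in Icc P.1 P.2, |w x - boxMean μ w P| ∂μ).sum ≤ η := by
  have hm := hR.measureReal_pos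
  set m := μ.real (Icc R.1 R.2)
  obtain ⟨g, hgc, hgw, hg, -⟩ := Integrable.exists_hasCompactSupport_integral_sub_le
    (μ := μ.restrict (Icc R.1 R.2)) hw (ε := η / 8) (by positivity)
  obtain ⟨G, hG⟩ := hgc.exists_bound_of_continuous hg
  have hG0 : 0 ≤ G := (norm_nonneg _).trans (hG 0)
  obtain ⟨δ, hδ0, hδ⟩ := Metric.uniformContinuous_iff.1
    (hgc.uniformContinuous_of_continuous hg) (η / (8 * m)) (by positivity)
  choose J hJ using fun i : Fin n => exists_grid δ (R.1 i) (R.2 i) hδ0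
  let T : ℝ := ∑ i : Fin n, (J i : ℝ)
  have hT0 : 0 ≤ T := Finset.sum_nonneg fun i _ => Nat.cast_nonneg _
  obtain ⟨N, hN⟩ := exists_pow_lt_of_lt_one (x := η / (8 * (G + 1) * (T + 1) * m))
    (by positivity) (by linarith : 1 - α < 1)
  obtain ⟨ds, hds⟩ := exists_list_le_count n N
  obtain ⟨Ps, h1, h2, h3, h4⟩ := exists_partition hα hcut ds R hR
  refine ⟨Ps, h1, h2, h3, ?_⟩
  have hsub : ∀ P ∈ Ps, Icc P.1 P.2 ⊆ Icc R.1 R.2 := fun P hP =>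
    Icc_subset_Icc (h1 P hP).2.1 (h1 P hP).2.2
  have hmP : ∀ P : (Fin n → ℝ) × (Fin n → ℝ), 0 ≤ μ.real (Icc P.1 P.2) :=
    fun P => measureReal_nonneg
  have hgR : IntegrableOn g (Icc R.1 R.2) μ := hg.continuousOn.integrableOn_compact isCompact_Icc
  have hwg : IntegrableOn (fun x => |w x - g x|) (Icc R.1 R.2) μ := (hw.sub hgR).abs
  let φ : (Fin n → ℝ) × (Fin n → ℝ) → Fin n → ℕ → ℝ := fun P i j =>
    if P.1 i ≤ R.1 i + δ / 2 * j ∧ R.1 i + δ / 2 * j + δ / 2 ≤ P.2 i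
    then μ.real (Icc P.1 P.2) else 0
  have hφ0 : ∀ P i j, 0 ≤ φ P i j := fun P i j => by
    simp only [φ]; split_ifs; exacts [hmP P, le_rfl]
  -- the oscillation of the continuous approximation `g` on one box
  have hosc : ∀ P ∈ Ps, ∫ x in Icc P.1 P.2, |g x - g P.1| ∂μ ≤
      η / (8 * m) * μ.real (Icc P.1 P.2) + 2 * G * ∑ i, ∑ j ∈ Finset.range (J i), φ P i j := by
    intro P hP
    have hfinP : μ (Icc P.1 P.2) < ∞ := isCompact_Icc.measure_lt_top
    have hbound : ∀ C : ℝ, (∀ x ∈ Icc P.1 P.2, |g x - g P.1| ≤ C) →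
        ∫ x in Icc P.1 P.2, |g x - g P.1| ∂μ ≤ C * μ.real (Icc P.1 P.2) := fun C hC => by
      refine (le_abs_self _).trans ?_
      have hC' : ∀ x ∈ Icc P.1 P.2, ‖|g x - g P.1|‖ ≤ C := fun x hx => by
        rw [Real.norm_eq_abs, abs_abs]; exact hC x hx
      exact norm_setIntegral_le_of_norm_le_const hfinP hC'
    by_cases hsmall : ∀ i, P.2 i - P.1 i < δ
    · refine (hbound (η / (8 * m)) fun x hx => ?_).trans
        (le_add_of_nonneg_right (by positivity))
      refine (hδ ?_).le
      rw [dist_pi_lt_iff hδ0]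
      intro i
      rw [Real.dist_eq, abs_of_nonneg (by linarith [hx.1 i])]
      linarith [hx.2 i, hsmall i]
    · push Not at hsmall
      obtain ⟨i, hi⟩ := hsmall
      have hPR := (h1 P hP).2
      obtain ⟨j, hj, hj1, hj2⟩ := hJ i (P.1 i) (P.2 i) (hPR.1 i)
        (((h1 P hP).1.1 i).le.trans (hPR.2 i)) hi
      have hle : μ.real (Icc P.1 P.2) ≤ ∑ i, ∑ j ∈ Finset.range (J i), φ P i j := by
        have e1 : μ.real (Icc P.1 P.2) = φ P i j := by simp only [φ]; rw [if_pos ⟨hj1, hj2⟩]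
        rw [e1]
        refine le_trans (Finset.single_le_sum (f := fun j => φ P i j) (fun j _ => hφ0 P i j)
          (Finset.mem_range.2 hj)) ?_
        exact Finset.single_le_sum (f := fun i => ∑ j ∈ Finset.range (J i), φ P i j)
          (fun i _ => Finset.sum_nonneg fun j _ => hφ0 P i j) (Finset.mem_univ i)
      refine (hbound (2 * G) fun x _ => ?_).trans ?_
      · have a1 := hG x
        have a2 := hG P.1
        rw [Real.norm_eq_abs] at a1 a2
        have := abs_sub (g x) (g P.1)
        linarith
      · have : 2 * G * μ.real (Icc P.1 P.2) ≤
            2 * G * ∑ i, ∑ j ∈ Finset.range (J i), φ P i j := by gcongr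
        have : 0 ≤ η / (8 * m) * μ.real (Icc P.1 P.2) := mul_nonneg (by positivity) (hmP P)
        linarith
  have hone : ∀ P ∈ Ps, ∫ x in Icc P.1 P.2, |w x - boxMean μ w P| ∂μ ≤
      2 * ∫ x in Icc P.1 P.2, |w x - g x| ∂μ + (η / (4 * m) * μ.real (Icc P.1 P.2) +
        4 * G * ∑ i, ∑ j ∈ Finset.range (J i), φ P i j) := by
    intro P hP
    have hwP := hw.mono_set (hsub P hP)
    have hgP := hgR.mono_set (hsub P hP)
    have hcP : IntegrableOn (fun _ => g P.1) (Icc P.1 P.2) μ :=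
      integrableOn_const isCompact_Icc.measure_lt_top.ne
    have e1 := integral_abs_sub_boxMean_le (h1 P hP).1 hwP (g P.1)
    have e2 : ∫ x in Icc P.1 P.2, |w x - g P.1| ∂μ ≤ ∫ x in Icc P.1 P.2, |w x - g x| ∂μ +
        ∫ x in Icc P.1 P.2, |g x - g P.1| ∂μ := by
      have a1 : IntegrableOn (fun x => |w x - g x|) (Icc P.1 P.2) μ := (hwP.sub hgP).abs
      have a2 : IntegrableOn (fun x => |g x - g P.1|) (Icc P.1 P.2) μ := (hgP.sub hcP).abs
      rw [← integral_add a1 a2]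
      exact integral_mono (hwP.sub hcP).abs (a1.add a2) fun x => abs_sub_le _ _ _
    have e3 := hosc P hP
    have e4 : η / (4 * m) = 2 * (η / (8 * m)) := by field_simp; norm_num
    rw [e4]
    linarith
  have hmass : (Ps.map fun P => μ.real (Icc P.1 P.2)).sum = m := by
    have := h2 (fun _ => 1) (integrableOn_const isCompact_Icc.measure_lt_top.ne)
    simpa using this.symm
  have hcells : (Ps.map fun P => ∑ i, ∑ j ∈ Finset.range (J i), φ P i j).sum ≤
      T * ((1 - α) ^ N * m) := by
    have hswap : (Ps.map fun P => ∑ i, ∑ j ∈ Finset.range (J i), φ P i j).sum =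
        ∑ i, ∑ j ∈ Finset.range (J i), (Ps.map fun P => φ P i j).sum := by
      clear * -
      induction Ps with
      | nil => simp
      | cons P Ps ih => simp only [List.map_cons, List.sum_cons, ih, Finset.sum_add_distrib]
    rw [hswap]
    calc ∑ i, ∑ j ∈ Finset.range (J i), (Ps.map fun P => φ P i j).sum
        ≤ ∑ i, ∑ j ∈ Finset.range (J i), (1 - α) ^ N * m := by
          refine Finset.sum_le_sum fun i _ => Finset.sum_le_sum fun j _ => ?_
          refine (h4 i _ _ (by linarith)).trans ?_
          have p1 : (1 - α) ^ ds.count i ≤ (1 - α) ^ N :=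
            pow_le_pow_of_le_one (by linarith) (by linarith) (hds i)
          have p2 : 0 ≤ (1 - α) ^ ds.count i := pow_nonneg (by linarith) _
          split_ifs
          · exact mul_le_mul_of_nonneg_right p1 hm.le
          · rw [mul_zero]; positivity
      _ = T * ((1 - α) ^ N * m) := by
          simp only [Finset.sum_const, Finset.card_range, nsmul_eq_mul, T, Finset.sum_mul]
  have hfin : G * (T * ((1 - α) ^ N * m)) ≤ η / 8 := by
    have p1 : G * (T * ((1 - α) ^ N * m)) ≤
        (G + 1) * ((T + 1) * (η / (8 * (G + 1) * (T + 1) * m) * m)) := by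
      gcongr <;> linarith
    have p2 : (G + 1) * ((T + 1) * (η / (8 * (G + 1) * (T + 1) * m) * m)) = η / 8 := by
      field_simp
    linarith
  have hwgsum := h2 _ hwg
  refine (List.sum_le_sum hone).trans ?_
  rw [List.sum_map_add, List.sum_map_add, List.sum_map_mul_left, List.sum_map_mul_left,
    List.sum_map_mul_left, ← hwgsum, hmass]
  have e5 : ∫ x in Icc R.1 R.2, |w x - g x| ∂μ ≤ η / 8 := by
    simpa only [Real.norm_eq_abs] using hgw
  have e6 : η / (4 * m) * m = η / 4 := by field_simp
  have e7 : G * (Ps.map fun P => ∑ i, ∑ j ∈ Finset.range (J i), φ P i j).sum ≤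
    G * (T * ((1 - α) ^ N * m)) := by gcongr
  rw [e6]
  linarith

/-! ### The reverse Hölder inequality below the critical exponent -/

/-- The condition `⟨w⟩_P ^ k ⟨w ^ (-k)⟩_P ≤ K` on all admissible boxes. For `k = 1 / (p - 1)` and
`K = Q ^ k` it says `[w]_p ≤ Q`. Interchanging `w` and `w ^ (-k)` turns it into the condition for
`1 / k` and `K ^ (1 / k)`. -/
def HasJointBound {n : ℕ} (μ : Measure (Fin n → ℝ)) (w : (Fin n → ℝ) → ℝ) (k K : ℝ) : Prop :=
  ∀ P, IsAdmissible μ P →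
    boxAvg μ w 1 P.1 P.2 ^ k * boxAvg μ w (-k) P.1 P.2 ≤ ENNReal.ofReal K

theorem boxAvg_ne_zero {n : ℕ} {μ : Measure (Fin n → ℝ)} [IsLocallyFiniteMeasure μ]
    {w : (Fin n → ℝ) → ℝ} (hw : IsWeight μ w) {P : (Fin n → ℝ) × (Fin n → ℝ)}
    (hP : IsAdmissible μ P) (ρ : ℝ) : boxAvg μ w ρ P.1 P.2 ≠ 0 := by
  rw [boxAvg, setLAverage_eq]
  refine (ENNReal.div_pos ?_ isCompact_Icc.measure_lt_top.ne).ne'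
  have hm : AEMeasurable (fun x => ENNReal.ofReal (w x ^ ρ)) (μ.restrict (Icc P.1 P.2)) :=
    (hw.aemeasurable.restrict.pow_const ρ).ennreal_ofReal
  rw [Ne, lintegral_eq_zero_iff' hm]
  intro h
  have hfalse : ∀ᵐ x ∂(μ.restrict (Icc P.1 P.2)), False := by
    filter_upwards [h, ae_restrict_of_ae hw.pos] with x h1 h2
    have := Real.rpow_pos_of_pos h2 ρ
    simp only [Pi.zero_apply, ENNReal.ofReal_eq_zero] at h1
    linarith
  have h0 : μ.restrict (Icc P.1 P.2) = 0 := by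
    rwa [Filter.eventually_false_iff_eq_bot, ae_eq_bot] at hfalse
  exact hP.2 (by rwa [Measure.restrict_eq_zero] at h0)

theorem boxAvg_eq_ofReal_boxMean {n : ℕ} {μ : Measure (Fin n → ℝ)} [IsLocallyFiniteMeasure μ]
    {w : (Fin n → ℝ) → ℝ} (hw : IsWeight μ w) {P : (Fin n → ℝ) × (Fin n → ℝ)}
    (hP : IsAdmissible μ P) {ρ : ℝ} (h : boxAvg μ w ρ P.1 P.2 ≠ ∞) :
    IntegrableOn (fun x => w x ^ ρ) (Icc P.1 P.2) μ ∧
      boxAvg μ w ρ P.1 P.2 = ENNReal.ofReal (boxMean μ (fun x => w x ^ ρ) P) := by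
  have hfin : μ (Icc P.1 P.2) ≠ ∞ := isCompact_Icc.measure_lt_top.ne
  have hm : AEMeasurable (fun x => w x ^ ρ) (μ.restrict (Icc P.1 P.2)) :=
    hw.aemeasurable.restrict.pow_const ρ
  have h0 : 0 ≤ᵐ[μ.restrict (Icc P.1 P.2)] fun x => w x ^ ρ :=
    ae_restrict_of_ae (hw.pos.mono fun x hx => (Real.rpow_pos_of_pos hx ρ).le)
  have hlt : ∫⁻ x in Icc P.1 P.2, ENNReal.ofReal (w x ^ ρ) ∂μ ≠ ∞ := by
    intro htop
    rw [boxAvg, setLAverage_eq, htop, ENNReal.top_div_of_ne_top hfin] at h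
    exact h rfl
  have hint : IntegrableOn (fun x => w x ^ ρ) (Icc P.1 P.2) μ :=
    (lintegral_ofReal_ne_top_iff_integrable hm.aestronglyMeasurable h0).1 hlt
  refine ⟨hint, ?_⟩
  rw [boxAvg, setLAverage_eq, boxMean, ← ofReal_integral_eq_lintegral_ofReal hint h0,
    ENNReal.ofReal_div_of_pos hP.measureReal_pos, Measure.real, ENNReal.ofReal_toReal hfin]

theorem boxMean_pos {n : ℕ} {μ : Measure (Fin n → ℝ)} [IsLocallyFiniteMeasure μ]
    {w : (Fin n → ℝ) → ℝ} (hw : IsWeight μ w) {P : (Fin n → ℝ) × (Fin n → ℝ)}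
    (hP : IsAdmissible μ P) {ρ : ℝ} (h : boxAvg μ w ρ P.1 P.2 ≠ ∞) :
    0 < boxMean μ (fun x => w x ^ ρ) P := by
  have h1 := boxAvg_ne_zero hw hP ρ
  rw [(boxAvg_eq_ofReal_boxMean hw hP h).2] at h1
  simpa using h1

/-- Both averages that enter `HasJointBound` are finite, and the pair of them lies in the domain
of the Bellman function. The lower bound `1 ≤ ⟨w⟩ ^ k ⟨w ^ (-k)⟩` is Jensen's inequality. -/
theorem HasJointBound.mean_mem {n : ℕ} {μ : Measure (Fin n → ℝ)} [IsLocallyFiniteMeasure μ]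
    {w : (Fin n → ℝ) → ℝ} (hw : IsWeight μ w) {k K : ℝ} (hk : 0 < k) (hA : HasJointBound μ w k K)
    {P : (Fin n → ℝ) × (Fin n → ℝ)} (hP : IsAdmissible μ P) :
    IntegrableOn w (Icc P.1 P.2) μ ∧ IntegrableOn (fun x => w x ^ (-k)) (Icc P.1 P.2) μ ∧
      boxAvg μ w 1 P.1 P.2 = ENNReal.ofReal (boxMean μ w P) ∧
      0 < boxMean μ w P ∧ 0 < boxMean μ (fun x => w x ^ (-k)) P ∧
      1 ≤ boxMean μ w P ^ k * boxMean μ (fun x => w x ^ (-k)) P ∧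
      boxMean μ w P ^ k * boxMean μ (fun x => w x ^ (-k)) P ≤ K := by
  have h := hA P hP
  have hx0 := boxAvg_ne_zero hw hP 1
  have hy0 := boxAvg_ne_zero hw hP (-k)
  have hlt := h.trans_lt ENNReal.ofReal_lt_top
  have hx : boxAvg μ w 1 P.1 P.2 ≠ ∞ := by
    intro htop
    rw [htop, ENNReal.top_rpow_of_pos hk, ENNReal.top_mul hy0] at hlt
    exact lt_irrefl _ hlt
  have hy : boxAvg μ w (-k) P.1 P.2 ≠ ∞ := by
    intro htop
    rw [htop, ENNReal.mul_top] at hlt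
    · exact lt_irrefl _ hlt
    · rw [Ne, ENNReal.rpow_eq_zero_iff]
      rintro (h | h)
      · exact hx0 h.1
      · exact absurd h.2 (by linarith)
  have ex := boxAvg_eq_ofReal_boxMean hw hP hx
  have ey := boxAvg_eq_ofReal_boxMean hw hP hy
  have px := boxMean_pos hw hP hx
  have py := boxMean_pos hw hP hy
  simp only [Real.rpow_one] at ex px
  rw [ex.2, ey.2, ENNReal.ofReal_rpow_of_pos px, ← ENNReal.ofReal_mul (by positivity)] at h
  have hm := hP.measureReal_pos
  have hfin : μ (Icc P.1 P.2) ≠ ∞ := isCompact_Icc.measure_lt_top.ne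
  set x := boxMean μ w P with hxdef
  set y := boxMean μ (fun x => w x ^ (-k)) P with hydef
  refine ⟨ex.1, ey.1, ex.2, px, py, ?_, ?_⟩
  · have hi : ∫ z in Icc P.1 P.2, (1 + k) ∂μ ≤
        ∫ z in Icc P.1 P.2, (k / x * w z + x ^ k * w z ^ (-k)) ∂μ := by
      refine integral_mono_ae (integrableOn_const hfin)
        ((ex.1.const_mul _).add (ey.1.const_mul _)) (ae_restrict_of_ae ?_)
      filter_upwards [hw.pos] with z hz
      have h1 := one_add_le_mul_add_rpow_neg hk (div_pos hz px)
      have h2 : (w z / x) ^ (-k) = x ^ k * w z ^ (-k) := by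
        rw [Real.div_rpow hz.le px.le, Real.rpow_neg px.le, div_inv_eq_mul, mul_comm]
      rw [h2] at h1
      have h3 : k * (w z / x) = k / x * w z := by ring
      rwa [h3] at h1
    rw [integral_add (ex.1.const_mul _) (ey.1.const_mul _), integral_const_mul,
      integral_const_mul] at hi
    have hx' : ∫ z in Icc P.1 P.2, w z ∂μ = x * μ.real (Icc P.1 P.2) := by
      rw [hxdef, boxMean, div_mul_cancel₀ _ hm.ne']
    have hy' : ∫ z in Icc P.1 P.2, w z ^ (-k) ∂μ = y * μ.real (Icc P.1 P.2) := by
      rw [hydef, boxMean, div_mul_cancel₀ _ hm.ne']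
    rw [hx', hy'] at hi
    have hc : ∫ z in Icc P.1 P.2, (1 + k) ∂μ = (1 + k) * μ.real (Icc P.1 P.2) := by
      simp [mul_comm]
    have hs : k / x * (x * μ.real (Icc P.1 P.2)) + x ^ k * (y * μ.real (Icc P.1 P.2)) =
        (k + x ^ k * y) * μ.real (Icc P.1 P.2) := by field_simp
    rw [hc, hs] at hi
    linarith [le_of_mul_le_mul_right hi hm]
  · rcases le_or_gt K 0 with hK | hK
    · rw [ENNReal.ofReal_eq_zero.2 hK, nonpos_iff_eq_zero, ENNReal.ofReal_eq_zero] at h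
      have : 0 < x ^ k * y := by positivity
      linarith
    · exact (ENNReal.ofReal_le_ofReal_iff hK.le).1 h

/-- The truncated powers are Lipschitz in one direction, uniformly in `t` and `x`. -/
theorem min_rpow_le_rpow_add {r M t x : ℝ} (hr : 1 < r) (hM : 0 < M) (ht : 0 < t) (hx : 0 < x) :
    min t M ^ r ≤ x ^ r + r * M ^ (r - 1) * |t - x| := by
  have hM' : 0 ≤ r * M ^ (r - 1) := by positivity
  set a := min t M
  have ha0 : 0 < a := lt_min ht hM
  rcases le_total a x with h | h
  · have := Real.rpow_le_rpow ha0.le h (by linarith : 0 ≤ r)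
    have := mul_nonneg hM' (abs_nonneg (t - x))
    linarith
  · have hx1 : -1 ≤ x / a - 1 := by
      have : 0 < x / a := by positivity
      linarith
    have hb := one_add_mul_self_le_rpow_one_add hx1 hr.le
    have e1 : 1 + (x / a - 1) = x / a := by ring
    rw [e1, Real.div_rpow hx.le ha0.le, le_div_iff₀ (by positivity)] at hb
    have e2 : a ^ r = a ^ (r - 1) * a := by rw [← Real.rpow_add_one ha0.ne']; ring_nf
    have e3 : (1 + r * (x / a - 1)) * a ^ r = a ^ r - r * a ^ (r - 1) * (a - x) := by
      rw [e2]; field_simp; ring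
    rw [e3] at hb
    have e4 : r * a ^ (r - 1) * (a - x) ≤ r * M ^ (r - 1) * |t - x| := by
      have h1 : a ^ (r - 1) ≤ M ^ (r - 1) :=
        Real.rpow_le_rpow ha0.le (min_le_right _ _) (by linarith)
      have h2 : a - x ≤ |t - x| := (sub_le_sub_right (min_le_left _ _) x).trans (le_abs_self _)
      gcongr
    linarith

/-- The reverse Hölder inequality `⟨w ^ r⟩ ≤ C ⟨w⟩ ^ r` for every exponent `r < 1 / s`, if `s` lies
strictly beyond the critical value, with a constant that depends neither on the weight nor on the
measure nor on the dimension. -/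
theorem exists_boxAvg_rpow_le {k r s K : ℝ} (hk : 0 < k) (hr : 1 < r) (hs : 0 < s)
    (hrs : r * s < 1) (hK : K * criticalFun k s < 1) :
    ∃ C : ℝ≥0, ∀ (n : ℕ) (μ : Measure (Fin n → ℝ)) [IsLocallyFiniteMeasure μ],
      (∀ (i : Fin n) (c : ℝ), μ {x | x i = c} = 0) → ∀ w : (Fin n → ℝ) → ℝ, IsWeight μ w →
        HasJointBound μ w k K → ∀ P, IsAdmissible μ P →
          boxAvg μ w r P.1 P.2 ≤ C * boxAvg μ w 1 P.1 P.2 ^ r := by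
  obtain ⟨B, c, C, ε, hc, hC, hε, hB1, hB2⟩ := exists_bellman hk hr hs hrs hK
  refine ⟨(C / c).toNNReal, fun n μ _ hμ w hw hA R hR => ?_⟩
  have hdom := fun P hP => HasJointBound.mean_mem hw hk hA (P := P) hP
  let X := boxMean μ w
  let Y := boxMean μ fun x => w x ^ (-k)
  let V : (Fin n → ℝ) × (Fin n → ℝ) → ℝ := fun P => μ.real (Icc P.1 P.2) * B (X P) (Y P)
  have hα1 : ε / (2 * (1 + ε)) ≤ 1 := by rw [div_le_one (by positivity)]; linarith
  have hcut : HasCuts μ V (ε / (2 * (1 + ε))) := by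
    intro P hP i
    obtain ⟨d, hd1, hd2, P₁, P₂, h₁, h₂, e₁, e₂, hf, hadd, hm₁, hm₂, hw₁, hw₂⟩ :=
      exists_cut hμ hw.pos hP (hdom P hP).1 hε i
    refine ⟨d, hd1, hd2, P₁, P₂, h₁, h₂, e₁, e₂, hf, hadd, hm₁, hm₂, ?_⟩
    have p := hP.measureReal_pos
    have p₁ := h₁.measureReal_pos
    have p₂ := h₂.measureReal_pos
    obtain ⟨i1, i2, -, -, -, -, -⟩ := hdom P hP
    obtain ⟨-, -, -, a3, a4, a5, a6⟩ := hdom P₁ h₁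
    obtain ⟨-, -, -, b3, b4, b5, b6⟩ := hdom P₂ h₂
    have hmul : ∀ (f : (Fin n → ℝ) → ℝ) (S : (Fin n → ℝ) × (Fin n → ℝ)), IsAdmissible μ S →
        μ.real (Icc S.1 S.2) * boxMean μ f S = ∫ x in Icc S.1 S.2, f x ∂μ := fun f S hS => by
      rw [boxMean, mul_div_cancel₀ _ hS.measureReal_pos.ne']
    have hratio : ∀ S, IsAdmissible μ S → (∫ x in Icc S.1 S.2, w x ∂μ) * μ.real (Icc P.1 P.2) ≤
        (1 + ε) * (∫ x in Icc P.1 P.2, w x ∂μ) * μ.real (Icc S.1 S.2) →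
        X S ≤ (1 + ε) * X P := fun S hS h => by
      simp only [X, boxMean]
      rw [← mul_div_assoc, div_le_div_iff₀ hS.measureReal_pos p]
      exact h
    have := hB2 (μ.real (Icc P₁.1 P₁.2)) (μ.real (Icc P₂.1 P₂.2)) (X P₁) (Y P₁) (X P₂) (Y P₂)
      (X P) (Y P) p₁ p₂ a3 a4 a5 a6 (hratio P₁ h₁ hw₁) b3 b4 b5 b6 (hratio P₂ h₂ hw₂)
      (by rw [← hadd, hmul _ _ hP, hmul _ _ h₁, hmul _ _ h₂, (hf w i1).2.2])
      (by rw [← hadd, hmul _ _ hP, hmul _ _ h₁, hmul _ _ h₂, (hf _ i2).2.2])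
    rw [← hadd] at this
    exact this
  obtain ⟨iw, -, hxR, x0, y0, hxy1, hxyK⟩ := hdom R hR
  have hm := hR.measureReal_pos
  have hfin : μ (Icc R.1 R.2) ≠ ∞ := isCompact_Icc.measure_lt_top.ne
  have hmin : ∀ M : ℝ, 0 < M → IntegrableOn (fun x => min (w x) M ^ r) (Icc R.1 R.2) μ := by
    intro M hM
    refine Integrable.mono' (g := fun _ => M ^ r) (integrableOn_const hfin)
      (((hw.aemeasurable.restrict.min aemeasurable_const).pow_const r).aestronglyMeasurable) ?_
    filter_upwards [ae_restrict_of_ae hw.pos] with x hx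
    have h0 : 0 ≤ min (w x) M := (lt_min hx hM).le
    rw [Real.norm_eq_abs, abs_of_nonneg (Real.rpow_nonneg h0 r)]
    exact Real.rpow_le_rpow h0 (min_le_right _ _) (by linarith)
  have hbound : ∀ M : ℝ, 0 < M → ∫ x in Icc R.1 R.2, min (w x) M ^ r ∂μ ≤
      C / c * X R ^ r * μ.real (Icc R.1 R.2) := by
    intro M hM
    refine le_of_forall_pos_le_add fun η hη => ?_
    have hΛ : 0 < r * M ^ (r - 1) := by positivity
    obtain ⟨Ps, h1, h2, h3, h4⟩ := exists_partition_integral_abs_sub_le (by positivity) hα1 hcut R hR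
      iw (η := η / (r * M ^ (r - 1))) (by positivity)
    rw [h2 _ (hmin M hM)]
    have hP : ∀ P ∈ Ps, ∫ x in Icc P.1 P.2, min (w x) M ^ r ∂μ ≤
        c⁻¹ * V P + r * M ^ (r - 1) * ∫ x in Icc P.1 P.2, |w x - X P| ∂μ := by
      intro P hP
      obtain ⟨hPa, hPR⟩ := h1 P hP
      have hsub : Icc P.1 P.2 ⊆ Icc R.1 R.2 := Icc_subset_Icc hPR.1 hPR.2
      have hfinP : μ (Icc P.1 P.2) ≠ ∞ := isCompact_Icc.measure_lt_top.ne
      obtain ⟨iP, -, -, a3, a4, a5, a6⟩ := hdom P hPa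
      have hc' : ∀ d : ℝ, IntegrableOn (fun _ => d) (Icc P.1 P.2) μ :=
        fun d => integrableOn_const hfinP
      have iabs : IntegrableOn (fun x => |w x - X P|) (Icc P.1 P.2) μ := (iP.sub (hc' _)).abs
      calc ∫ x in Icc P.1 P.2, min (w x) M ^ r ∂μ
          ≤ ∫ x in Icc P.1 P.2, (X P ^ r + r * M ^ (r - 1) * |w x - X P|) ∂μ := by
            refine integral_mono_ae ((hmin M hM).mono_set hsub) ((hc' _).add (iabs.const_mul _))
              (ae_restrict_of_ae (hw.pos.mono fun x hx => min_rpow_le_rpow_add hr hM hx a3))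
        _ = X P ^ r * μ.real (Icc P.1 P.2) +
              r * M ^ (r - 1) * ∫ x in Icc P.1 P.2, |w x - X P| ∂μ := by
            rw [integral_add (hc' _) (iabs.const_mul _), integral_const_mul]
            simp [mul_comm]
        _ ≤ _ := by
            refine add_le_add_left ?_ _
            rw [inv_mul_eq_div, le_div_iff₀ hc]
            have := mul_le_mul_of_nonneg_left (hB1 (X P) (Y P) a3 a4 a5 a6).1
              hPa.measureReal_pos.le
            simp only [V]
            linarith
    refine (List.sum_le_sum hP).trans ?_
    rw [List.sum_map_add, List.sum_map_mul_left, List.sum_map_mul_left]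
    have hVR : V R ≤ μ.real (Icc R.1 R.2) * (C * X R ^ r) :=
      mul_le_mul_of_nonneg_left (hB1 (X R) (Y R) x0 y0 hxy1 hxyK).2 hm.le
    have e1 : c⁻¹ * (Ps.map V).sum ≤ c⁻¹ * (μ.real (Icc R.1 R.2) * (C * X R ^ r)) :=
      mul_le_mul_of_nonneg_left (h3.trans hVR) (by positivity)
    have e2 := mul_le_mul_of_nonneg_left h4 hΛ.le
    rw [mul_div_cancel₀ _ hΛ.ne'] at e2
    have e3 : c⁻¹ * (μ.real (Icc R.1 R.2) * (C * X R ^ r)) =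
      C / c * X R ^ r * μ.real (Icc R.1 R.2) := by ring
    rw [e3] at e1
    exact add_le_add e1 e2
  have hlim : ∫⁻ x in Icc R.1 R.2, ENNReal.ofReal (w x ^ r) ∂μ ≤
      ENNReal.ofReal (C / c * X R ^ r * μ.real (Icc R.1 R.2)) := by
    have htend : Filter.Tendsto
        (fun j : ℕ => ∫⁻ x in Icc R.1 R.2, ENNReal.ofReal (min (w x) (j + 1) ^ r) ∂μ)
        Filter.atTop (nhds (∫⁻ x in Icc R.1 R.2, ENNReal.ofReal (w x ^ r) ∂μ)) := by
      refine lintegral_tendsto_of_tendsto_of_monotone (fun j => ?_) ?_ ?_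
      · exact ((hw.aemeasurable.restrict.min aemeasurable_const).pow_const r).ennreal_ofReal
      · filter_upwards [ae_restrict_of_ae hw.pos] with x hx i j hij
        refine ENNReal.ofReal_le_ofReal (Real.rpow_le_rpow (le_min hx.le (by positivity)) ?_
          (by linarith))
        have : (i : ℝ) ≤ j := by exact_mod_cast hij
        exact min_le_min_left _ (by linarith)
      · filter_upwards with x
        refine tendsto_const_nhds.congr' ?_
        obtain ⟨N, hN⟩ := exists_nat_ge (w x)
        filter_upwards [Filter.eventually_ge_atTop N] with j hj
        have : (N : ℝ) ≤ j := by exact_mod_cast hj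
        rw [min_eq_left (by linarith)]
    refine le_of_tendsto' htend fun j => ?_
    have hj : (0 : ℝ) < j + 1 := by positivity
    rw [← ofReal_integral_eq_lintegral_ofReal (hmin _ hj)]
    · exact ENNReal.ofReal_le_ofReal (hbound _ hj)
    · exact ae_restrict_of_ae (hw.pos.mono fun x hx =>
        Real.rpow_nonneg (lt_min hx hj).le r)
  rw [hxR, ENNReal.ofReal_rpow_of_pos x0, boxAvg, setLAverage_eq]
  refine ENNReal.div_le_of_le_mul (hlim.trans_eq ?_)
  rw [ENNReal.ofReal_mul (by positivity), ENNReal.ofReal_mul (by positivity), Measure.real,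
    ENNReal.ofReal_toReal hfin]
  rfl

/-! ### Tiling by translates of a bump -/

theorem intervalIntegrable_of_abs_le {f : ℝ → ℝ} (hf : Measurable f) {C : ℝ}
    (hC : ∀ x, |f x| ≤ C) (a b : ℝ) : IntervalIntegrable f volume a b :=
  (intervalIntegrable_const (c := C)).mono_fun' hf.aestronglyMeasurable (.of_forall hC)

/-- The periodic function with period `c` that equals `f (· - g)` on `[0, c)`. -/
noncomputable def periodize (c g : ℝ) (f : ℝ → ℝ) (x : ℝ) : ℝ := f (c * Int.fract (x / c) - g)

/-- The function that consists of `m` consecutive translates of `v • f` on cells of length `c`, the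
first of them being `[0, c)`, and equals `d` off the cells. In each cell `f` is shifted by `g`. -/
noncomputable def tile (c g : ℝ) (m : ℕ) (v d : ℝ) (f : ℝ → ℝ) (x : ℝ) : ℝ :=
  if x ∈ Ico 0 (m * c) then v * periodize c g f x else d

theorem periodize_periodic {c : ℝ} (hc : 0 < c) (g : ℝ) (f : ℝ → ℝ) :
    Function.Periodic (periodize c g f) c := fun x => by
  rw [periodize, periodize, add_div, div_self hc.ne', Int.fract_add_one]

theorem periodize_of_mem {c : ℝ} (hc : 0 < c) (g : ℝ) (f : ℝ → ℝ) {x : ℝ} {i : ℤ}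
    (hx : x ∈ Ico (i * c) ((i + 1) * c)) : periodize c g f x = f (x - i * c - g) := by
  have h : ⌊x / c⌋ = i := by
    rw [Int.floor_eq_iff, le_div_iff₀ hc, div_lt_iff₀ hc]
    exact hx
  rw [periodize, Int.fract, h, mul_sub, mul_div_cancel₀ _ hc.ne', mul_comm c]

theorem measurable_periodize (c g : ℝ) {f : ℝ → ℝ} (hf : Measurable f) :
    Measurable (periodize c g f) :=
  hf.comp (((measurable_fract.comp (measurable_id.div_const c)).const_mul c).sub_const g)

theorem measurable_tile (c g : ℝ) (m : ℕ) (v d : ℝ) {f : ℝ → ℝ} (hf : Measurable f) :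
    Measurable (tile c g m v d f) :=
  Measurable.ite measurableSet_Ico ((measurable_periodize c g hf).const_mul v) measurable_const

theorem abs_integral_le_of_periodic {p : ℝ → ℝ} {c δ : ℝ} (hc : 0 < c)
    (hp : Function.Periodic p c) (hint : ∀ a b, IntervalIntegrable p volume a b)
    (h0 : ∫ x in (0 : ℝ)..c, p x = 0)
    (hδ : ∀ t ∈ Icc 0 c, |∫ x in (0 : ℝ)..t, p x| ≤ δ) (t : ℝ) : |∫ x in (0 : ℝ)..t, p x| ≤ δ := by
  set i := ⌊t / c⌋
  have h1 : ∫ x in (0 : ℝ)..(i * c), p x = 0 := by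
    have := hp.intervalIntegral_add_zsmul_eq i 0 hint
    simpa [h0] using this
  have h2 : ∫ x in (i * c)..t, p x = ∫ x in (0 : ℝ)..(t - i * c), p x := by
    have h3 : ∀ x, p (x + i * c) = p x := fun x => by
      have := hp.zsmul i x
      simpa using this
    have h4 := intervalIntegral.integral_comp_add_right (a := 0) (b := t - i * c) p (i * c)
    simp only [h3, zero_add, sub_add_cancel] at h4
    exact h4.symm
  rw [← intervalIntegral.integral_add_adjacent_intervals (hint 0 (i * c)) (hint _ _), h1, zero_add,
    h2]
  refine hδ _ ⟨?_, ?_⟩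
  · have := Int.floor_le (t / c)
    rw [le_div_iff₀ hc] at this
    linarith
  · have := (Int.lt_floor_add_one (t / c)).le
    rw [div_le_iff₀ hc] at this
    linarith

theorem integral_periodize {c g : ℝ} (hc : 0 < c) (f : ℝ → ℝ) {t : ℝ} (h0 : 0 ≤ t) (ht : t ≤ c) :
    ∫ x in (0 : ℝ)..t, periodize c g f x = ∫ x in (-g)..(t - g), f x := by
  have h : ∫ x in (0 : ℝ)..t, periodize c g f x = ∫ x in (0 : ℝ)..t, f (x - g) := by
    refine intervalIntegral.integral_congr_Ioo_of_le h0 fun x hx => ?_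
    rw [periodize_of_mem hc g f (i := 0) (by simpa using ⟨hx.1.le, hx.2.trans_le ht⟩)]
    simp
  rw [h, intervalIntegral.integral_comp_sub_right (fun x => f x) g, zero_sub]

theorem integral_tile (c g : ℝ) (m : ℕ) (v d : ℝ) (f : ℝ → ℝ) {t : ℝ}
    (h0 : 0 ≤ t) (ht : t ≤ m * c) :
    ∫ x in (0 : ℝ)..t, tile c g m v d f x = ∫ x in (0 : ℝ)..t, v * periodize c g f x := by
  refine intervalIntegral.integral_congr_Ioo_of_le h0 fun x hx => ?_
  rw [tile, if_pos ⟨hx.1.le, hx.2.trans_le ht⟩]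

/-- A function of mean zero, supported in `[0, L)`, keeps small integrals over all intervals when it
is tiled. -/
theorem abs_integral_tile_le {L g v δ C : ℝ} {e : ℝ → ℝ} (hL : 0 < L) (hg : 0 < g) (hv : 0 ≤ v)
    (m : ℕ) (he : Measurable e) (hC : ∀ x, |e x| ≤ C) (hoff : ∀ x, x ∉ Ico 0 L → e x = 0)
    (h0 : ∫ x in (0 : ℝ)..L, e x = 0) (hδ : ∀ t ∈ Icc 0 L, |∫ x in (0 : ℝ)..t, e x| ≤ δ)
    {a b : ℝ} (hab : a ≤ b) :
    |∫ x in a..b, tile (L + 2 * g) g m v 0 e x| ≤ 2 * (v * δ) := by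
  have hδ0 : 0 ≤ δ := (abs_nonneg _).trans (hδ 0 ⟨le_rfl, hL.le⟩)
  set c := L + 2 * g with hc
  have hc0 : 0 < c := by positivity
  have hint := fun a b => intervalIntegrable_of_abs_le he hC a b
  have hpint : ∀ a b, IntervalIntegrable (periodize c g e) volume a b := fun a b =>
    intervalIntegrable_of_abs_le (measurable_periodize c g he) (fun x => hC _) a b
  have hneg : ∀ a b, a ≤ b → b ≤ 0 → ∫ x in a..b, e x = 0 := fun a b hab hb => by
    rw [intervalIntegral.integral_congr_Ioo_of_le (g := fun _ => 0) hab fun x hx =>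
      hoff x fun h => by linarith [h.1, hx.2]]
    simp
  have hpos : ∀ a b, a ≤ b → L ≤ a → ∫ x in a..b, e x = 0 := fun a b hab hb => by
    rw [intervalIntegral.integral_congr_Ioo_of_le (g := fun _ => 0) hab fun x hx =>
      hoff x fun h => by linarith [h.2, hx.1]]
    simp
  have hprim : ∀ t, -g ≤ t → |∫ x in (-g)..t, e x| ≤ δ := by
    intro t ht
    rcases le_total t 0 with h | h
    · rw [hneg _ _ ht h]; simpa using hδ0
    · rw [← intervalIntegral.integral_add_adjacent_intervals (hint (-g) 0) (hint 0 t),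
        hneg _ _ (by linarith) le_rfl, zero_add]
      rcases le_total t L with h' | h'
      · exact hδ t ⟨h, h'⟩
      · rw [← intervalIntegral.integral_add_adjacent_intervals (hint 0 L) (hint L t),
          hpos _ _ h' le_rfl, h0]
        simpa using hδ0
  have hcell : ∫ x in (0 : ℝ)..c, periodize c g e x = 0 := by
    rw [integral_periodize hc0 e hc0.le le_rfl,
      ← intervalIntegral.integral_add_adjacent_intervals (hint (-g) 0) (hint 0 _),
      ← intervalIntegral.integral_add_adjacent_intervals (hint 0 L) (hint L _),
      hneg _ _ (by linarith) le_rfl, hpos _ _ (by rw [hc]; linarith) le_rfl, h0]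
    simp
  have hper := abs_integral_le_of_periodic hc0 (periodize_periodic hc0 g e) hpint hcell
    (fun t ht => by
      rw [integral_periodize hc0 e ht.1 ht.2]
      exact hprim _ (by linarith [ht.1]))
  have htile : tile c g m v 0 e = (Ico 0 (m * c)).indicator fun x => v * periodize c g e x := by
    ext x
    simp only [tile, indicator]
  have hsets : (Ioc a b ∩ Ico 0 (m * c) : Set ℝ) =ᵐ[volume]
      (Ioc (max a 0) (min b (m * c)) : Set ℝ) := by
    rw [← Ioc_inter_Ioc]
    exact (Filter.EventuallyEq.refl _ _).inter Ico_ae_eq_Ioc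
  rw [intervalIntegral.integral_of_le hab, htile, setIntegral_indicator measurableSet_Ico,
    setIntegral_congr_set hsets]
  rcases le_total (max a 0) (min b (m * c)) with h | h
  · rw [← intervalIntegral.integral_of_le h, intervalIntegral.integral_const_mul,
      ← intervalIntegral.integral_interval_sub_left (hpint 0 _) (hpint 0 _), abs_mul,
      abs_of_nonneg hv]
    have h1 := hper (min b (m * c))
    have h2 := hper (max a 0)
    have h3 := abs_sub (∫ x in (0 : ℝ)..min b (m * c), periodize c g e x)
      (∫ x in (0 : ℝ)..max a 0, periodize c g e x)
    have := mul_le_mul_of_nonneg_left (h3.trans (add_le_add h1 h2)) hv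
    linarith
  · rw [Ioc_eq_empty (not_lt.2 h)]
    simp only [setIntegral_empty, abs_zero]
    positivity

/-! ### Self-similar bumps -/

/-- A bump of base value `1` on `[0, L)` that is homogeneous up to the relative error `η`: its
powers with exponents at most `1` are, in the sense of integrals over intervals, close to their
means. The number `M ρ` is the mean of `w ^ ρ` over `[0, L]`. -/
structure IsBump (k K η L : ℝ) (M : ℝ → ℝ) (w : ℝ → ℝ) : Prop where
  measurable : Measurable w
  one_le : ∀ x, 1 ≤ w x
  bounded : ∃ C, ∀ x, w x ≤ C
  eq_one : ∀ x, x ∉ Ico 0 L → w x = 1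
  mean : ∀ ρ, ∫ x in (0 : ℝ)..L, w x ^ ρ = L * M ρ
  deviation : ∀ ρ ≤ 1, ∀ t ∈ Icc 0 L, |∫ x in (0 : ℝ)..t, (w x ^ ρ - M ρ)| ≤ η * L
  joint : ∀ a b, a < b →
    (∫ x in a..b, w x) ^ k * ∫ x in a..b, w x ^ (-k) ≤ K * (b - a) ^ (k + 1)

theorem abs_rpow_le {x C : ℝ} (h1 : 1 ≤ x) (hC : x ≤ C) (ρ : ℝ) : |x ^ ρ| ≤ C ^ |ρ| := by
  have h0 : 0 < x := by linarith
  rw [abs_of_nonneg (Real.rpow_nonneg h0.le ρ)]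
  exact (Real.rpow_le_rpow_of_exponent_le h1 (le_abs_self ρ)).trans
    (Real.rpow_le_rpow h0.le hC (abs_nonneg ρ))

theorem isBump_one {k K η : ℝ} (hη : 0 ≤ η) (hK : 1 ≤ K) :
    IsBump k K η 1 (fun _ => 1) fun _ => 1 where
  measurable := measurable_const
  one_le _ := le_rfl
  bounded := ⟨1, fun _ => le_rfl⟩
  eq_one _ _ := rfl
  mean _ := by simp
  deviation _ _ _ _ := by simpa using hη
  joint a b hab := by
    have h : 0 < b - a := by linarith
    simp only [Real.one_rpow, intervalIntegral.integral_const, smul_eq_mul, mul_one]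
    rw [← Real.rpow_add_one h.ne']
    exact le_mul_of_one_le_left (by positivity) hK

theorem tile_rpow (c g : ℝ) (m : ℕ) {v : ℝ} (hv : 0 ≤ v) {w : ℝ → ℝ} (hw : ∀ x, 0 ≤ w x)
    (ρ x : ℝ) : tile c g m v 1 w x ^ ρ = tile c g m (v ^ ρ) 1 (fun x => w x ^ ρ) x := by
  unfold tile
  split_ifs
  · exact Real.mul_rpow hv (hw _)
  · rw [Real.one_rpow]

theorem tile_add (c g : ℝ) (m : ℕ) (v d₁ d₂ : ℝ) (f₁ f₂ : ℝ → ℝ) (x : ℝ) :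
    tile c g m v (d₁ + d₂) (fun x => f₁ x + f₂ x) x =
      tile c g m v d₁ f₁ x + tile c g m v d₂ f₂ x := by
  unfold tile periodize
  split_ifs
  · ring
  · rfl

/-- Integrals of a tiled bump are bounded by those of the tiled step function that has the same
mean, up to the deviation of a single bump at each end. -/
theorem IsBump.integral_tile_le {k K η L : ℝ} {M : ℝ → ℝ} {w : ℝ → ℝ} (hL : 0 < L)
    (hw : IsBump k K η L M w) {g v : ℝ} (hg : 0 < g) (hv : 0 ≤ v) (m : ℕ) {ρ : ℝ} (hρ : ρ ≤ 1)
    {a b : ℝ} (hab : a ≤ b) :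
    ∫ x in a..b, tile (L + 2 * g) g m v 1 (fun x => w x ^ ρ) x ≤
      (∫ x in a..b, tile (L + 2 * g) g m v 1 ((Ico 0 L).indicator (fun _ => M ρ - 1) + 1) x) +
        2 * (v * (η * L)) := by
  obtain ⟨C, hC⟩ := hw.bounded
  let h : ℝ → ℝ := (Ico 0 L).indicator (fun _ => M ρ - 1) + 1
  let e : ℝ → ℝ := fun x => w x ^ ρ - h x
  have hh : ∀ x, x ∈ Ico 0 L → h x = M ρ := fun x hx => by simp [h, hx]
  have hh' : ∀ x, x ∉ Ico 0 L → h x = 1 := fun x hx => by simp [h, hx]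
  have hhm : Measurable h := (measurable_const.indicator measurableSet_Ico).add measurable_const
  have hhb : ∀ x, |h x| ≤ |M ρ| + 1 := fun x => by
    by_cases hx : x ∈ Ico 0 L
    · rw [hh x hx]; linarith
    · rw [hh' x hx, abs_one]; linarith [abs_nonneg (M ρ)]
  have hem : Measurable e := (hw.measurable.pow_const ρ).sub hhm
  have heb : ∀ x, |e x| ≤ C ^ |ρ| + (|M ρ| + 1) := fun x =>
    (abs_sub _ _).trans (add_le_add (abs_rpow_le (hw.one_le x) (hC x) ρ) (hhb x))
  have heoff : ∀ x, x ∉ Ico 0 L → e x = 0 := fun x hx => by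
    simp only [e, hh' x hx, hw.eq_one x hx, Real.one_rpow, sub_self]
  have heint : ∀ t, 0 ≤ t → t ≤ L →
      ∫ x in (0 : ℝ)..t, e x = ∫ x in (0 : ℝ)..t, (w x ^ ρ - M ρ) := fun t h0 ht =>
    intervalIntegral.integral_congr_Ioo_of_le h0 fun x hx => by
      simp only [e, hh x ⟨hx.1.le, hx.2.trans_le ht⟩]
  have hwint := intervalIntegrable_of_abs_le (hw.measurable.pow_const ρ)
    (fun x => abs_rpow_le (hw.one_le x) (hC x) ρ)
  have key := abs_integral_tile_le hL hg hv m hem heb heoff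
    (by
      rw [heint L hL.le le_rfl, intervalIntegral.integral_sub (hwint _ _) (by simp), hw.mean]
      simp)
    (fun t ht => by rw [heint t ht.1 ht.2]; exact hw.deviation ρ hρ t ht) hab
  have hsplit : ∀ x, tile (L + 2 * g) g m v 1 (fun x => w x ^ ρ) x =
      tile (L + 2 * g) g m v 1 h x + tile (L + 2 * g) g m v 0 e x := fun x => by
    rw [← tile_add, add_zero]
    congr 1
    ext x
    simp [e]
  have hb1 : ∀ x, |tile (L + 2 * g) g m v 1 h x| ≤ v * (|M ρ| + 1) + 1 := fun x => by
    unfold tile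
    split_ifs
    · rw [abs_mul, abs_of_nonneg hv]
      have := mul_le_mul_of_nonneg_left (hhb ((L + 2 * g) * Int.fract (x / (L + 2 * g)) - g)) hv
      simp only [periodize]
      linarith
    · rw [abs_one]
      have : 0 ≤ v * (|M ρ| + 1) := by positivity
      linarith
  have hb2 : ∀ x, |tile (L + 2 * g) g m v 0 e x| ≤ v * (C ^ |ρ| + (|M ρ| + 1)) := fun x => by
    have hCe : 0 ≤ C ^ |ρ| + (|M ρ| + 1) := (abs_nonneg _).trans (heb 0)
    unfold tile
    split_ifs
    · rw [abs_mul, abs_of_nonneg hv]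
      exact mul_le_mul_of_nonneg_left (heb _) hv
    · rw [abs_zero]; positivity
  simp only [hsplit]
  rw [intervalIntegral.integral_add
    (intervalIntegrable_of_abs_le (measurable_tile _ _ _ _ _ hhm) hb1 _ _)
    (intervalIntegrable_of_abs_le (measurable_tile _ _ _ _ _ hem) hb2 _ _)]
  have := le_abs_self (∫ x in a..b, tile (L + 2 * g) g m v 0 e x)
  change _ ≤ (∫ x in a..b, tile (L + 2 * g) g m v 1 h x) + _
  linarith

/-- Tiling sufficiently many copies of `lam • w` inside a cell structure of base value `lam` gives
another bump. The linear functional `A x + B y` controls the pairs of means over intervals that are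
not contained in one cell; over short intervals, the bump hypothesis for `w` applies. -/
theorem IsBump.exists_tile {k K η L A B D σ γ lam : ℝ} {M : ℝ → ℝ} {w : ℝ → ℝ} (hL : 0 < L)
    (hw : IsBump k K η L M w) (hη : 0 < η) (hA : 0 ≤ A) (hB : 0 ≤ B) (hσ : 0 ≤ σ)
    (hγ0 : 0 < γ) (hγ1 : γ < 1) (hlam : 1 ≤ lam) (hk : 0 < k)
    (hK : ∀ x y, 0 < x → 0 < y → A * x + B * y ≤ D + σ → x ^ k * y ≤ K)
    (h1 : A + B ≤ D) (h2 : A * lam + B * lam ^ (-k) ≤ D)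
    (h3 : A * (lam * M 1) + B * (lam ^ (-k) * M (-k)) ≤ D)
    (hηsmall : 2 * (A + B) * (lam * η) ≤ σ * ((1 / γ - 1) / 2)) :
    ∃ L' w', 0 < L' ∧ IsBump k K η L' (fun ρ => lam ^ ρ * (1 - γ + γ * M ρ)) w' := by
  obtain ⟨C, hC⟩ := hw.bounded
  have hC1 : 1 ≤ C := (hw.one_le 0).trans (hC 0)
  set g := L * ((1 / γ - 1) / 2) with hgdef
  have hg : 0 < g := by
    have : 1 < 1 / γ := by rw [lt_div_iff₀ hγ0]; linarith
    positivity
  set c := L + 2 * g with hc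
  have hcL : γ * c = L := by rw [hc, hgdef]; field_simp; ring
  have hc0 : 0 < c := by positivity
  have hlam0 : 0 < lam := by linarith
  obtain ⟨m, hm⟩ := exists_nat_gt (lam * (2 * C) / η)
  have hm0 : (0 : ℝ) < m := by
    refine lt_trans ?_ hm
    positivity
  let w' := tile c g m lam 1 w
  have hw0 : ∀ x, 0 ≤ w x := fun x => by linarith [hw.one_le x]
  have hpow : ∀ ρ x : ℝ, w' x ^ ρ = tile c g m (lam ^ ρ) 1 (fun x => w x ^ ρ) x :=
    fun ρ x => tile_rpow c g m hlam0.le hw0 ρ x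
  have hw'1 : ∀ x, 1 ≤ w' x := fun x => by
    simp only [w', tile]
    split_ifs
    · have := hw.one_le (c * Int.fract (x / c) - g)
      simp only [periodize]
      nlinarith
    · exact le_rfl
  have hw'C : ∀ x, w' x ≤ lam * C := fun x => by
    simp only [w', tile]
    split_ifs
    · exact mul_le_mul_of_nonneg_left (hC _) hlam0.le
    · nlinarith
  have hw'm : Measurable w' := measurable_tile _ _ _ _ _ hw.measurable
  have hint : ∀ ρ a b : ℝ, IntervalIntegrable (fun x => w' x ^ ρ) volume a b := fun ρ a b =>
    intervalIntegrable_of_abs_le (hw'm.pow_const ρ)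
      (fun x => abs_rpow_le (hw'1 x) (hw'C x) ρ) a b
  have hwint : ∀ ρ a b : ℝ, IntervalIntegrable (fun x => w x ^ ρ) volume a b := fun ρ a b =>
    intervalIntegrable_of_abs_le (hw.measurable.pow_const ρ)
      (fun x => abs_rpow_le (hw.one_le x) (hC x) ρ) a b
  have hpint : ∀ ρ a b : ℝ, IntervalIntegrable (periodize c g fun x => w x ^ ρ) volume a b :=
    fun ρ a b => intervalIntegrable_of_abs_le (measurable_periodize _ _ (hw.measurable.pow_const ρ))
      (fun x => abs_rpow_le (hw.one_le _) (hC _) ρ) a b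
  have hcell : ∀ ρ : ℝ, ∫ x in (0 : ℝ)..c, periodize c g (fun x => w x ^ ρ) x =
      c * (1 - γ + γ * M ρ) := fun ρ => by
    rw [integral_periodize hc0 _ hc0.le le_rfl,
      ← intervalIntegral.integral_add_adjacent_intervals (hwint ρ (-g) 0) (hwint ρ 0 _),
      ← intervalIntegral.integral_add_adjacent_intervals (hwint ρ 0 L) (hwint ρ L _), hw.mean,
      intervalIntegral.integral_congr_Ioo_of_le (a := -g) (b := 0) (g := fun _ => 1)
        (by linarith) fun x hx => by
          simp only [hw.eq_one x fun h => by linarith [h.1, hx.2], Real.one_rpow],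
      intervalIntegral.integral_congr_Ioo_of_le (a := L) (b := c - g) (g := fun _ => 1)
        (by rw [hc]; linarith) fun x hx => by
          simp only [hw.eq_one x fun h => by linarith [h.2, hx.1], Real.one_rpow]]
    simp only [intervalIntegral.integral_const, smul_eq_mul, mul_one]
    linear_combination (1 - M ρ) * hcL
  have hL' : 0 < m * c := by positivity
  -- pairs of integrals below the line `A x + B y = D + σ` satisfy the joint bound
  have hlin : ∀ a b, a < b →
      A * (∫ x in a..b, w' x) + B * (∫ x in a..b, w' x ^ (-k)) ≤ (D + σ) * (b - a) →
      (∫ x in a..b, w' x) ^ k * ∫ x in a..b, w' x ^ (-k) ≤ K * (b - a) ^ (k + 1) := by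
    intro a b hab h
    have hba : 0 < b - a := by linarith
    have i1 : 0 < ∫ x in a..b, w' x := by
      refine intervalIntegral.intervalIntegral_pos_of_pos ?_ (fun x => by linarith [hw'1 x]) hab
      simpa using hint 1 a b
    have i2 : 0 < ∫ x in a..b, w' x ^ (-k) :=
      intervalIntegral.intervalIntegral_pos_of_pos (hint _ a b)
        (fun x => Real.rpow_pos_of_pos (by linarith [hw'1 x]) _) hab
    have := hK _ _ (div_pos i1 hba) (div_pos i2 hba) (by
      rw [← mul_div_assoc, ← mul_div_assoc, ← add_div, div_le_iff₀ hba]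
      exact h)
    rw [Real.div_rpow i1.le hba.le, div_mul_div_comm, ← Real.rpow_add_one hba.ne',
      div_le_iff₀ (by positivity)] at this
    exact this
  -- the same with a pointwise hypothesis
  have hpt : ∀ a b, a < b → (∀ x ∈ Icc a b, A * w' x + B * w' x ^ (-k) ≤ D) →
      (∫ x in a..b, w' x) ^ k * ∫ x in a..b, w' x ^ (-k) ≤ K * (b - a) ^ (k + 1) := by
    intro a b hab h
    refine hlin a b hab ?_
    have i1 : IntervalIntegrable w' volume a b := by simpa using hint 1 a b
    have i2 := hint (-k) a b
    rw [← intervalIntegral.integral_const_mul, ← intervalIntegral.integral_const_mul,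
      ← intervalIntegral.integral_add (i1.const_mul A) (i2.const_mul B)]
    calc ∫ x in a..b, (A * w' x + B * w' x ^ (-k)) ≤ ∫ _ in a..b, D :=
          intervalIntegral.integral_mono_on hab.le ((i1.const_mul A).add (i2.const_mul B))
            (by simp) h
      _ ≤ (D + σ) * (b - a) := by
          simp only [intervalIntegral.integral_const, smul_eq_mul]
          nlinarith
  refine ⟨m * c, w', hL', hw'm, hw'1, ⟨_, hw'C⟩, fun x hx => ?_, fun ρ => ?_, fun ρ hρ t ht => ?_,
    fun a b hab => ?_⟩
  · simp only [w', tile, if_neg hx]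
  · simp only [hpow]
    rw [integral_tile _ _ _ _ _ _ hL'.le le_rfl, intervalIntegral.integral_const_mul]
    have := (periodize_periodic hc0 g fun x => w x ^ ρ).intervalIntegral_add_zsmul_eq m 0
      (hpint ρ)
    simp only [zero_add, hcell, natCast_zsmul, nsmul_eq_mul] at this
    rw [this]
    ring
  · -- the primitive of a periodic function of mean zero is bounded, whatever the number of cells
    simp only [hpow]
    set F := 1 - γ + γ * M ρ with hF
    have hρb : ∀ x, |w x ^ ρ| ≤ C := fun x => by
      rw [abs_of_nonneg (Real.rpow_nonneg (hw0 x) ρ)]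
      refine (Real.rpow_le_rpow_of_exponent_le (hw.one_le x) hρ).trans ?_
      rw [Real.rpow_one]; exact hC x
    have hlamρ : lam ^ ρ ≤ lam := by
      simpa using Real.rpow_le_rpow_of_exponent_le hlam hρ
    have hlamρ0 : 0 < lam ^ ρ := Real.rpow_pos_of_pos hlam0 ρ
    have hF' : |F| ≤ C := by
      have hcF := hcell ρ
      have := intervalIntegral.norm_integral_le_of_norm_le_const (a := 0) (b := c) (C := C)
        (f := periodize c g fun x => w x ^ ρ) fun x _ => hρb _
      rw [hcF, Real.norm_eq_abs, abs_mul, sub_zero, abs_of_pos hc0, mul_comm] at this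
      exact le_of_mul_le_mul_right this hc0
    have hq : ∀ a b, IntervalIntegrable (fun x => periodize c g (fun x => w x ^ ρ) x - F)
        volume a b := fun a b => (hpint ρ a b).sub (by simp)
    have hbd := abs_integral_le_of_periodic (δ := 2 * C * c) hc0
      (p := fun x => periodize c g (fun x => w x ^ ρ) x - F)
      (fun x => by simp only [periodize_periodic hc0 g _ x]) hq
      (by
        rw [intervalIntegral.integral_sub (hpint ρ _ _) (by simp), hcell,
          intervalIntegral.integral_const, smul_eq_mul, hF]
        ring)
      (fun s hs => by
        have := intervalIntegral.norm_integral_le_of_norm_le_const (a := 0) (b := s) (C := 2 * C)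
          (f := fun x => periodize c g (fun x => w x ^ ρ) x - F) fun x _ => by
            refine (norm_sub_le _ _).trans ?_
            have := hρb (c * Int.fract (x / c) - g)
            simp only [Real.norm_eq_abs, periodize]
            linarith
        rw [Real.norm_eq_abs, sub_zero, abs_of_nonneg hs.1] at this
        exact this.trans (mul_le_mul_of_nonneg_left hs.2 (by linarith))) t
    have heq : ∫ x in (0 : ℝ)..t, (tile c g m (lam ^ ρ) 1 (fun x => w x ^ ρ) x - lam ^ ρ * F) =
        lam ^ ρ * ∫ x in (0 : ℝ)..t, (periodize c g (fun x => w x ^ ρ) x - F) := by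
      rw [← intervalIntegral.integral_const_mul]
      refine intervalIntegral.integral_congr_Ioo_of_le ht.1 fun x hx => ?_
      simp only [tile, if_pos (show x ∈ Ico 0 (m * c) from ⟨hx.1.le, hx.2.trans_le ht.2⟩)]
      ring
    rw [heq, abs_mul, abs_of_pos hlamρ0]
    rw [div_lt_iff₀ hη] at hm
    calc lam ^ ρ * |∫ x in (0 : ℝ)..t, (periodize c g (fun x => w x ^ ρ) x - F)|
        ≤ lam * (2 * C * c) := by gcongr
      _ = lam * (2 * C) * c := by ring
      _ ≤ m * η * c := by gcongr
      _ = η * (m * c) := by ring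
  · by_cases hlong : g ≤ b - a
    · refine hlin a b hab ?_
      have hlamk0 : 0 < lam ^ (-k) := Real.rpow_pos_of_pos hlam0 (-k)
      have hlamk : lam ^ (-k) ≤ lam := by
        simpa using Real.rpow_le_rpow_of_exponent_le hlam (by linarith : -k ≤ 1)
      let T : ℝ → ℝ → ℝ := fun ρ =>
        tile c g m (lam ^ ρ) 1 ((Ico 0 L).indicator (fun _ => M ρ - 1) + 1)
      have b1 : ∫ x in a..b, w' x ≤ (∫ x in a..b, T 1 x) + 2 * (lam * (η * L)) := by
        have := hw.integral_tile_le hL hg hlam0.le m le_rfl hab.le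
        have e : T 1 = tile c g m lam 1 ((Ico 0 L).indicator (fun _ => M 1 - 1) + 1) := by
          simp only [T, Real.rpow_one]
        simp only [Real.rpow_one] at this
        rw [e]
        exact this
      have b2 : ∫ x in a..b, w' x ^ (-k) ≤
          (∫ x in a..b, T (-k) x) + 2 * (lam ^ (-k) * (η * L)) := by
        simp only [hpow]
        exact hw.integral_tile_le hL hg hlamk0.le m (by linarith : -k ≤ 1) hab.le
      have hTval : ∀ x, (∀ ρ, T ρ x = 1) ∨ (∀ ρ, T ρ x = lam ^ ρ) ∨ ∀ ρ, T ρ x = lam ^ ρ * M ρ := by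
        intro x
        by_cases hx : x ∈ Ico 0 (m * c)
        · by_cases hx' : c * Int.fract (x / c) - g ∈ Ico 0 L
          · right; right
            intro ρ
            simp only [T, tile, if_pos hx, periodize, Pi.add_apply, indicator_of_mem hx',
              Pi.one_apply, sub_add_cancel]
          · right; left
            intro ρ
            simp only [T, tile, if_pos hx, periodize, Pi.add_apply, indicator_of_notMem hx',
              Pi.one_apply, zero_add, mul_one]
        · left
          intro ρ
          simp only [T, tile, if_neg hx]
      have hTb : ∀ ρ x, |T ρ x| ≤ 1 + |lam ^ ρ| + |lam ^ ρ * M ρ| := fun ρ x => by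
        have p1 := abs_nonneg (lam ^ ρ)
        have p2 := abs_nonneg (lam ^ ρ * M ρ)
        rcases hTval x with h | h | h
        · rw [h, abs_one]; linarith
        · rw [h]; linarith
        · rw [h]; linarith
      have hTint : ∀ ρ, IntervalIntegrable (T ρ) volume a b := fun ρ =>
        intervalIntegrable_of_abs_le (measurable_tile _ _ _ _ _
          ((measurable_const.indicator measurableSet_Ico).add measurable_const)) (hTb ρ) a b
      have hTD : A * (∫ x in a..b, T 1 x) + B * (∫ x in a..b, T (-k) x) ≤ D * (b - a) := by
        rw [← intervalIntegral.integral_const_mul, ← intervalIntegral.integral_const_mul,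
          ← intervalIntegral.integral_add ((hTint 1).const_mul A) ((hTint (-k)).const_mul B)]
        calc ∫ x in a..b, (A * T 1 x + B * T (-k) x) ≤ ∫ _ in a..b, D := by
              refine intervalIntegral.integral_mono_on hab.le
                (((hTint 1).const_mul A).add ((hTint (-k)).const_mul B)) (by simp) fun x _ => ?_
              rcases hTval x with h | h | h
              · rw [h, h, mul_one, mul_one]; exact h1
              · rw [h, h, Real.rpow_one]; exact h2
              · rw [h, h, Real.rpow_one]; exact h3
          _ = D * (b - a) := by
              rw [intervalIntegral.integral_const, smul_eq_mul, mul_comm]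
      calc A * (∫ x in a..b, w' x) + B * (∫ x in a..b, w' x ^ (-k))
          ≤ A * ((∫ x in a..b, T 1 x) + 2 * (lam * (η * L))) +
            B * ((∫ x in a..b, T (-k) x) + 2 * (lam * (η * L))) := by
            refine add_le_add (mul_le_mul_of_nonneg_left b1 hA)
              (mul_le_mul_of_nonneg_left (b2.trans ?_) hB)
            gcongr
        _ = (A * (∫ x in a..b, T 1 x) + B * (∫ x in a..b, T (-k) x)) +
            2 * (A + B) * (lam * η) * L := by ring
        _ ≤ D * (b - a) + σ * ((1 / γ - 1) / 2) * L :=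
            add_le_add hTD (mul_le_mul_of_nonneg_right hηsmall hL.le)
        _ = D * (b - a) + σ * g := by rw [hgdef]; ring
        _ ≤ (D + σ) * (b - a) := by
            have := mul_le_mul_of_nonneg_left hlong hσ
            linarith
    · push Not at hlong
      set i := ⌊a / c⌋
      have hia : i * c ≤ a := by rw [← le_div_iff₀ hc0]; exact Int.floor_le _
      have hai : a < (i + 1) * c := by rw [← div_lt_iff₀ hc0]; exact Int.lt_floor_add_one _
      by_cases hbi : b < (i + 1) * c
      · have hmem : ∀ x ∈ Icc a b, x ∈ Ico (i * c) ((i + 1) * c) := fun x hx =>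
          ⟨hia.trans hx.1, hx.2.trans_lt hbi⟩
        by_cases him : 0 ≤ i ∧ i < m
        · have him' : ((i : ℝ) + 1) * c ≤ m * c := by
            have : (i : ℝ) + 1 ≤ m := by exact_mod_cast him.2
            gcongr
          have hi0 : 0 ≤ (i : ℝ) * c := by
            have : (0 : ℝ) ≤ i := by exact_mod_cast him.1
            positivity
          have hval : ∀ x ∈ Icc a b, w' x = lam * w (x - (i * c + g)) := fun x hx => by
            have h := hmem x hx
            simp only [w', tile, if_pos (show x ∈ Ico 0 (m * c) from
              ⟨hi0.trans h.1, h.2.trans_le him'⟩), periodize_of_mem hc0 g w h]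
            rw [sub_sub]
          have e1 : ∫ x in a..b, w' x = lam * ∫ x in (a - (i * c + g))..(b - (i * c + g)), w x := by
            rw [← intervalIntegral.integral_comp_sub_right (fun x => w x),
              ← intervalIntegral.integral_const_mul]
            exact intervalIntegral.integral_congr_Ioo_of_le hab.le fun x hx =>
              hval x (Ioo_subset_Icc_self hx)
          have e2 : ∫ x in a..b, w' x ^ (-k) =
              lam ^ (-k) * ∫ x in (a - (i * c + g))..(b - (i * c + g)), w x ^ (-k) := by
            rw [← intervalIntegral.integral_comp_sub_right (fun x => w x ^ (-k)),
              ← intervalIntegral.integral_const_mul]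
            refine intervalIntegral.integral_congr_Ioo_of_le hab.le fun x hx => ?_
            simp only [hval x (Ioo_subset_Icc_self hx)]
            rw [Real.mul_rpow hlam0.le (hw0 _)]
          have hj := hw.joint (a - (i * c + g)) (b - (i * c + g)) (by linarith)
          rw [sub_sub_sub_cancel_right] at hj
          have i1 : 0 ≤ ∫ x in (a - (i * c + g))..(b - (i * c + g)), w x :=
            intervalIntegral.integral_nonneg (by linarith) fun x _ => hw0 x
          have hlamk : lam ^ k * lam ^ (-k) = 1 := by
            rw [← Real.rpow_add hlam0, add_neg_cancel, Real.rpow_zero]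
          rw [e1, e2, Real.mul_rpow hlam0.le i1, mul_mul_mul_comm, hlamk, one_mul]
          exact hj
        · refine hpt a b hab fun x hx => ?_
          have hx' : x ∉ Ico 0 (m * c) := fun h => him (by
            have h' := hmem x hx
            constructor
            · have h1 : 0 < ((i : ℝ) + 1) * c := h.1.trans_lt h'.2
              have h2 : (0 : ℝ) < i + 1 := (mul_pos_iff_of_pos_right hc0).1 h1
              have h3 : 0 < i + 1 := by exact_mod_cast h2
              omega
            · have h1 : (i : ℝ) * c < m * c := h'.1.trans_lt h.2
              have h2 : (i : ℝ) < m := lt_of_mul_lt_mul_right h1 hc0.le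
              exact_mod_cast h2)
          simp only [w', tile, if_neg hx', Real.one_rpow, mul_one]
          exact h1
      · push Not at hbi
        -- near the common end point of two cells, `w'` takes only the values `1` and `lam`
        refine hpt a b hab fun x hx => ?_
        have hone : periodize c g w x = 1 := by
          rcases lt_or_ge x ((i + 1) * c) with hxi | hxi
          · rw [periodize_of_mem hc0 g w ⟨hia.trans hx.1, hxi⟩]
            exact hw.eq_one _ fun h => by linarith [h.2, hx.1]
          · rw [periodize_of_mem hc0 g w (i := i + 1)
              ⟨by push_cast; exact hxi, by push_cast; linarith [hx.2]⟩]
            refine hw.eq_one _ fun h => ?_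
            have := h.1
            push_cast at this
            linarith [hx.2]
        simp only [w', tile, hone, mul_one]
        split_ifs
        · exact h2
        · simpa using h1

/-! ### Choice of the parameters of the bumps -/

open Filter Topology in
theorem tendsto_rpow_sub_one_div (a : ℝ) :
    Tendsto (fun x : ℝ => (x ^ a - 1) / (x - 1)) (𝓝[>] 1) (𝓝 a) := by
  have h := (Real.hasDerivAt_rpow_const (x := 1) (p := a) (Or.inl one_ne_zero)).tendsto_slope
  rw [Real.one_rpow, mul_one] at h
  refine (h.mono_left (nhdsWithin_mono _ fun x hx => ne_of_gt hx)).congr fun x => ?_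
  rw [slope_def_field, Real.one_rpow]

open Filter Topology in
theorem tendsto_rpow_sub_one_div_one_sub_rpow (ρ : ℝ) {d : ℝ} (hd : d ≠ 0) :
    Tendsto (fun x : ℝ => (x ^ ρ - 1) / (1 - x ^ (-d))) (𝓝[>] 1) (𝓝 (ρ / d)) := by
  have h := (tendsto_rpow_sub_one_div ρ).div (tendsto_rpow_sub_one_div (-d)).neg
    (by rwa [neg_neg])
  rw [neg_neg] at h
  refine h.congr' ?_
  filter_upwards [self_mem_nhdsWithin] with x hx
  have hx' : x - 1 ≠ 0 := sub_ne_zero.2 (ne_of_gt hx)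
  rw [Pi.div_apply, ← neg_div, neg_sub, div_div_div_cancel_right₀ hx']

/-- The means of the iterated bumps, see `IsBump.exists_tile`. -/
noncomputable def bumpMean (lam γ : ℝ) : ℕ → ℝ → ℝ
  | 0, _ => 1
  | N + 1, ρ => lam ^ ρ * (1 - γ + γ * bumpMean lam γ N ρ)

theorem bumpMean_eq {lam q ρ : ℝ} (hlam : 1 < lam) (hρ : ρ < q) (N : ℕ) :
    bumpMean lam (lam ^ (-q)) N ρ =
      1 + (lam ^ ρ - 1) / (1 - lam ^ (-(q - ρ))) * (1 - (lam ^ (-(q - ρ))) ^ N) := by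
  have hlam0 : 0 < lam := by linarith
  have hx : lam ^ (-(q - ρ)) < 1 := Real.rpow_lt_one_of_one_lt_of_neg hlam (by linarith)
  have hx' : 1 - lam ^ (-(q - ρ)) ≠ 0 := by linarith
  have hmul : lam ^ ρ * lam ^ (-q) = lam ^ (-(q - ρ)) := by
    rw [← Real.rpow_add hlam0]; ring_nf
  induction N with
  | zero => simp [bumpMean]
  | succ N ih =>
    rw [bumpMean, ih]
    have : lam ^ ρ * (1 - lam ^ (-q) + lam ^ (-q) * (1 + (lam ^ ρ - 1) / (1 - lam ^ (-(q - ρ))) *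
        (1 - (lam ^ (-(q - ρ))) ^ N))) = lam ^ ρ + (lam ^ ρ * lam ^ (-q)) *
          ((lam ^ ρ - 1) / (1 - lam ^ (-(q - ρ))) * (1 - (lam ^ (-(q - ρ))) ^ N)) := by ring
    rw [this, hmul]
    field_simp
    ring

theorem bumpMean_pos {lam γ : ℝ} (hlam : 0 < lam) (h0 : 0 < γ) (h1 : γ < 1) (N : ℕ) (ρ : ℝ) :
    0 < bumpMean lam γ N ρ := by
  induction N with
  | zero => exact one_pos
  | succ N ih =>
    rw [bumpMean]
    positivity

theorem rpow_mul_le_of_add_le {k x y S : ℝ} (hk : 0 < k) (hx : 0 < x) (hy : 0 < y)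
    (h : k * x + y ≤ (1 + k) * S) : x ^ k * y ≤ S ^ (1 + k) := by
  have h1 : (0 : ℝ) ≤ k / (1 + k) := by positivity
  have h2 : (0 : ℝ) ≤ 1 / (1 + k) := by positivity
  have hm := Real.geom_mean_le_arith_mean2_weighted h1 h2 hx.le hy.le (by field_simp; ring)
  have h3 : k / (1 + k) * x + 1 / (1 + k) * y ≤ S := by
    have : k / (1 + k) * x + 1 / (1 + k) * y = (k * x + y) / (1 + k) := by ring
    rw [this, div_le_iff₀ (by positivity)]
    linarith
  have h4 := Real.rpow_le_rpow (by positivity) (hm.trans h3) (by positivity : 0 ≤ 1 + k)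
  rw [Real.mul_rpow (by positivity) (by positivity), ← Real.rpow_mul hx.le,
    ← Real.rpow_mul hy.le, div_mul_cancel₀ _ (by positivity), div_mul_cancel₀ _ (by positivity),
    Real.rpow_one] at h4
  exact h4

/-- The pairs of means of the iterated bumps lie below the chord from `(1, 1)` to the fixed point
of the iteration. -/
theorem bumpMean_linear_le {k lam q A B D : ℝ} (hk : 0 < k) (hB : 0 ≤ B) (hq : 1 < q)
    (hlam : 1 < lam) (hD₁ : lam * (A + B) ≤ D)
    (hD₂ : lam * (A * (1 + (lam ^ (1 : ℝ) - 1) / (1 - lam ^ (-(q - 1)))) +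
      B * (1 + (lam ^ (-k) - 1) / (1 - lam ^ (-(q - -k))))) ≤ D) (N : ℕ) :
    A * (lam * bumpMean lam (lam ^ (-q)) N 1) +
      B * (lam ^ (-k) * bumpMean lam (lam ^ (-q)) N (-k)) ≤ D := by
  have hlam0 : 0 < lam := by linarith
  have hx₁ : 0 < lam ^ (-(q - 1)) := Real.rpow_pos_of_pos hlam0 _
  have hx₁' : lam ^ (-(q - 1)) < 1 := Real.rpow_lt_one_of_one_lt_of_neg hlam (by linarith)
  have hx₂ : 0 < lam ^ (-(q - -k)) := Real.rpow_pos_of_pos hlam0 _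
  have hx₂₁ : lam ^ (-(q - -k)) ≤ lam ^ (-(q - 1)) :=
    Real.rpow_le_rpow_of_exponent_le hlam.le (by linarith)
  have hlamk : lam ^ (-k) ≤ lam := by
    simpa using Real.rpow_le_rpow_of_exponent_le hlam.le (by linarith : -k ≤ 1)
  have hlamk1 : lam ^ (-k) < 1 := Real.rpow_lt_one_of_one_lt_of_neg hlam (by linarith)
  have hM0 := (bumpMean_pos hlam0 (Real.rpow_pos_of_pos hlam0 (-q))
    (Real.rpow_lt_one_of_one_lt_of_neg hlam (by linarith)) N (-k)).le
  have hM₁ := bumpMean_eq (q := q) (ρ := 1) hlam hq N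
  have hM₂ := bumpMean_eq (q := q) (ρ := -k) hlam (by linarith) N
  have hr₂ : (lam ^ (-k) - 1) / (1 - lam ^ (-(q - -k))) ≤ 0 :=
    div_nonpos_of_nonpos_of_nonneg (by linarith) (by linarith)
  have hp₁ := pow_le_one₀ (n := N) hx₁.le hx₁'.le
  have hp₂ := pow_pos hx₁ N
  have hp₃ := pow_le_pow_left₀ hx₂.le hx₂₁ N
  generalize (lam ^ (1 : ℝ) - 1) / (1 - lam ^ (-(q - 1))) = r₁ at *
  generalize (lam ^ (-k) - 1) / (1 - lam ^ (-(q - -k))) = r₂ at *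
  generalize (lam ^ (-(q - 1))) ^ N = y₁ at *
  generalize (lam ^ (-(q - -k))) ^ N = y₂ at *
  generalize bumpMean lam (lam ^ (-q)) N 1 = M₁ at *
  generalize bumpMean lam (lam ^ (-q)) N (-k) = M₂ at *
  generalize lam ^ (-k) = v at *
  have hM₂' : M₂ ≤ 1 + r₂ * (1 - y₁) := by
    have := mul_le_mul_of_nonpos_left hp₃ hr₂
    linarith
  have h1 : v * M₂ ≤ lam * (1 + r₂ * (1 - y₁)) :=
    mul_le_mul hlamk hM₂' hM0 hlam0.le
  have h2 := mul_le_mul_of_nonneg_left h1 hB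
  have h3 := mul_le_mul_of_nonneg_left hD₁ hp₂.le
  have h4 := mul_le_mul_of_nonneg_left hD₂ (by linarith : 0 ≤ 1 - y₁)
  rw [hM₁]
  linarith

open Filter Topology in
/-- Choice of an exponent `q` slightly beyond `1 / s`, of a slack `τ` between the levels that belong
to `1 / q` and to `s`, and of a factor `lam` close to `1`. In the limit `lam → 1` the fixed point of
the iteration of means tends to the point `(q / (q - 1), q / (q + k))` where the tangent through
`(1, 1)` touches the curve that belongs to `1 / q`. -/
theorem exists_bump_parameters {k s : ℝ} (hk : 0 < k) (hs0 : 0 < s) (hs1 : s < 1) (C : ℝ) :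
    ∃ q τ lam, 1 < q ∧ 1 / s < q ∧ 0 < τ ∧ 1 < lam ∧ lam < 1 + τ ∧
      (∀ x y, 0 < x → 0 < y → k * (1 - 1 / q) * x + (1 + k * (1 / q)) * y ≤
        (1 + k) * (1 + τ) + (1 + k) * τ → x ^ k * y ≤ 1 / criticalFun k s) ∧
      lam * (k * (1 - 1 / q) * (1 + (lam ^ (1 : ℝ) - 1) / (1 - lam ^ (-(q - 1)))) +
        (1 + k * (1 / q)) * (1 + (lam ^ (-k) - 1) / (1 - lam ^ (-(q - -k))))) <
          (1 + k) * (1 + τ) ∧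
      C < 1 + (lam ^ (1 / s) - 1) / (1 - lam ^ (-(q - 1 / s))) ∧
      1 + (lam ^ (1 : ℝ) - 1) / (1 - lam ^ (-(q - 1))) < 1 + 1 / (1 - s) := by
  have hΘ := criticalFun_pos hk hs0.le hs1
  set K := 1 / criticalFun k s with hKdef
  set q₀ := 1 / s with hq₀
  have hq₀1 : 1 < q₀ := by rw [hq₀, lt_div_iff₀ hs0]; linarith
  set q := q₀ + q₀ / (|C| + 2) with hq
  have hqq : q₀ < q := by
    have : 0 < q₀ / (|C| + 2) := by positivity
    linarith
  set t := 1 / q with ht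
  have ht0 : 0 < t := by positivity
  have hts : t < s := by
    rw [ht, div_lt_iff₀ (by linarith)]
    have : s * q₀ = 1 := by rw [hq₀]; field_simp
    nlinarith
  have ht1 : t < 1 := hts.trans hs1
  have hΘt := criticalFun_pos hk ht0.le ht1
  have hKt : 1 < K * criticalFun k t := by
    have := criticalFun_strictAntiOn hk ⟨ht0.le, ht1.le⟩ ⟨hs0.le, hs1.le⟩ hts
    rw [hKdef, one_div_mul_eq_div, one_lt_div hΘ]
    exact this
  obtain ⟨τ, hτ0, hτ⟩ : ∃ τ > 0, (1 + 2 * τ) ^ (1 + k) ≤ K * criticalFun k t := by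
    have hcont : Tendsto (fun τ : ℝ => (1 + 2 * τ) ^ (1 + k)) (𝓝[>] 0) (𝓝 1) := by
      have : ContinuousAt (fun τ : ℝ => (1 + 2 * τ) ^ (1 + k)) 0 :=
        ContinuousAt.rpow_const (by fun_prop) (Or.inr (by linarith))
      have h := this.tendsto.mono_left (nhdsWithin_le_nhds (s := Ioi 0))
      simpa using h
    obtain ⟨τ, h1, h2⟩ := ((hcont.eventually (gt_mem_nhds hKt)).and self_mem_nhdsWithin).exists
    exact ⟨τ, h2, h1.le⟩
  set A := k * (1 - t) with hA
  set B := 1 + k * t with hB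
  have hlim : ∀ ρ, ρ < q → Tendsto (fun lam : ℝ => 1 + (lam ^ ρ - 1) / (1 - lam ^ (-(q - ρ))))
      (𝓝[>] 1) (𝓝 (q / (q - ρ))) := fun ρ hρ => by
    have hne : q - ρ ≠ 0 := by linarith
    have := (tendsto_rpow_sub_one_div_one_sub_rpow ρ hne).const_add 1
    have e : 1 + ρ / (q - ρ) = q / (q - ρ) := by field_simp; ring
    rwa [e] at this
  have hq0 : 0 < q := by linarith
  have hid : Tendsto (fun lam : ℝ => lam) (𝓝[>] 1) (𝓝 1) := nhdsWithin_le_nhds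
  have ev1 : ∀ᶠ lam : ℝ in 𝓝[>] 1, lam < 1 + τ := hid.eventually (gt_mem_nhds (by linarith))
  have ev2 : ∀ᶠ lam : ℝ in 𝓝[>] 1, lam * (A * (1 + (lam ^ (1 : ℝ) - 1) / (1 - lam ^ (-(q - 1)))) +
      B * (1 + (lam ^ (-k) - 1) / (1 - lam ^ (-(q - -k))))) < (1 + k) * (1 + τ) := by
    refine (hid.mul (((hlim 1 (by linarith)).const_mul A).add
      ((hlim (-k) (by linarith)).const_mul B))).eventually (gt_mem_nhds ?_)
    have e1 : A * (q / (q - 1)) = k := by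
      rw [hA, ht]; have : q - 1 ≠ 0 := by linarith
      field_simp
    have e2 : B * (q / (q - -k)) = 1 := by
      rw [hB, ht]; have : q - -k ≠ 0 := by linarith
      field_simp; ring
    rw [e1, e2]
    nlinarith
  have ev3 : ∀ᶠ lam : ℝ in 𝓝[>] 1, C < 1 + (lam ^ q₀ - 1) / (1 - lam ^ (-(q - q₀))) := by
    refine (hlim q₀ hqq).eventually (lt_mem_nhds ?_)
    have e : q / (q - q₀) = |C| + 3 := by
      rw [hq]; field_simp; ring
    rw [e]
    linarith [le_abs_self C]
  have ev4 : ∀ᶠ lam : ℝ in 𝓝[>] 1,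
      1 + (lam ^ (1 : ℝ) - 1) / (1 - lam ^ (-(q - 1))) < 1 + 1 / (1 - s) := by
    refine (hlim 1 (by linarith)).eventually (gt_mem_nhds ?_)
    have e : q / (q - 1) = 1 / (1 - t) := by
      rw [ht]; have : q - 1 ≠ 0 := by linarith
      field_simp
    rw [e]
    have : 1 / (1 - t) < 1 / (1 - s) := one_div_lt_one_div_of_lt (by linarith) (by linarith)
    linarith
  obtain ⟨lam, ⟨⟨⟨hl1, hl2⟩, hl3⟩, hl4⟩, hlam⟩ :=
    ((((ev1.and ev2).and ev3).and ev4).and self_mem_nhdsWithin).exists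
  refine ⟨q, τ, lam, by linarith, hqq, hτ0, hlam, hl1, fun x y hx hy hxy => ?_, hl2, hl3, hl4⟩
  have h1t : 0 < 1 - t := by linarith
  have h1 := rpow_mul_le_of_add_le (x := (1 - t) * x) (y := (1 + k * t) * y)
    (S := 1 + 2 * τ) hk (by positivity) (by positivity) (by linarith)
  rw [Real.mul_rpow h1t.le hx.le] at h1
  have h2 : x ^ k * y * criticalFun k t ≤ K * criticalFun k t := by
    refine le_trans (le_of_eq ?_) (h1.trans hτ)
    rw [criticalFun]; ring
  exact le_of_mul_le_mul_right h2 hΘt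

open Filter Topology in
/-- Bumps with the critical joint bound, bounded mean, and arbitrarily large mean of the critical
power. -/
theorem exists_isBump {k s : ℝ} (hk : 0 < k) (hs0 : 0 < s) (hs1 : s < 1) (C : ℝ) :
    ∃ η L M w, 0 < L ∧ IsBump k (1 / criticalFun k s) η L M w ∧ M 1 ≤ 1 + 1 / (1 - s) ∧
      C ≤ M (1 / s) := by
  set K := 1 / criticalFun k s with hKdef
  have hΘ := criticalFun_pos hk hs0.le hs1
  have hK1 : 1 ≤ K := by
    have h := (criticalFun_strictAntiOn hk).antitoneOn ⟨le_rfl, zero_le_one⟩ ⟨hs0.le, hs1.le⟩ hs0.le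
    have h0 : criticalFun k 0 = 1 := by simp [criticalFun]
    rw [hKdef, le_div_iff₀ hΘ]
    linarith
  obtain ⟨q, τ, lam, hq1, hqq, hτ0, hlam, hl1, hKlin, hl2, hl3, hl4⟩ :=
    exists_bump_parameters hk hs0 hs1 C
  set A := k * (1 - 1 / q) with hA
  set B := 1 + k * (1 / q) with hB
  have h1q : 0 < 1 - 1 / q := by
    rw [sub_pos, div_lt_one (by linarith)]; exact hq1
  have hA0 : 0 < A := by positivity
  have hB0 : 0 < B := by positivity
  have hAB : A + B = 1 + k := by rw [hA, hB]; ring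
  have hlam0 : 0 < lam := by linarith
  set γ := lam ^ (-q) with hγ
  have hγ0 : 0 < γ := Real.rpow_pos_of_pos hlam0 _
  have hγ1 : γ < 1 := Real.rpow_lt_one_of_one_lt_of_neg hlam (by linarith)
  set β := (1 / γ - 1) / 2 with hβ
  have hβ0 : 0 < β := by
    have : 1 < 1 / γ := by rw [lt_div_iff₀ hγ0]; linarith
    rw [hβ]; linarith
  set σ := (1 + k) * τ
  set η := σ * β / (2 * (A + B) * lam) with hη
  have hη0 : 0 < η := by positivity
  have hx : ∀ ρ, ρ < q → 0 < lam ^ (-(q - ρ)) ∧ lam ^ (-(q - ρ)) < 1 := fun ρ hρ =>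
    ⟨Real.rpow_pos_of_pos hlam0 _, Real.rpow_lt_one_of_one_lt_of_neg hlam (by linarith)⟩
  have hpow : ∀ ρ, ρ < q → ∀ N : ℕ, 0 ≤ 1 - (lam ^ (-(q - ρ))) ^ N ∧
      1 - (lam ^ (-(q - ρ))) ^ N ≤ 1 := fun ρ hρ N => by
    have h1 := pow_le_one₀ (n := N) (hx ρ hρ).1.le (hx ρ hρ).2.le
    have h2 := pow_pos (hx ρ hρ).1 N
    constructor <;> linarith
  have hone : 0 ≤ (lam ^ (1 : ℝ) - 1) / (1 - lam ^ (-(q - 1))) := by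
    rw [Real.rpow_one]
    exact div_nonneg (by linarith) (by linarith [(hx 1 (by linarith)).2])
  have hlamk : lam ^ (-k) ≤ lam := by
    simpa using Real.rpow_le_rpow_of_exponent_le hlam.le (by linarith : -k ≤ 1)
  have hbumps : ∀ N, ∃ L w, 0 < L ∧ IsBump k K η L (bumpMean lam γ N) w := by
    intro N
    induction N with
    | zero => exact ⟨1, _, one_pos, isBump_one hη0.le hK1⟩
    | succ N ih =>
      obtain ⟨L, w, hL, hw⟩ := ih
      refine hw.exists_tile hL hη0 hA0.le hB0.le (σ := σ) (D := (1 + k) * (1 + τ))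
        (by positivity) hγ0 hγ1 hlam.le hk hKlin ?_ ?_ ?_ ?_
      · rw [hAB]; nlinarith
      · calc A * lam + B * lam ^ (-k) ≤ A * lam + B * lam := by gcongr
          _ = (1 + k) * lam := by rw [← hAB]; ring
          _ ≤ (1 + k) * (1 + τ) := by gcongr
      · exact bumpMean_linear_le hk hB0.le (by linarith) hlam
          (by rw [hAB]; nlinarith) hl2.le N
      · rw [hη]
        have : 2 * (A + B) * (lam * (σ * β / (2 * (A + B) * lam))) = σ * β := by field_simp
        exact this.le
  have htend : Tendsto (fun N : ℕ => bumpMean lam γ N (1 / s)) atTop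
      (𝓝 (1 + (lam ^ (1 / s) - 1) / (1 - lam ^ (-(q - (1 / s)))) * (1 - 0))) := by
    simp only [hγ, bumpMean_eq hlam hqq]
    refine ((tendsto_const_nhds.sub (tendsto_pow_atTop_nhds_zero_of_lt_one (hx (1 / s) hqq).1.le
      (hx (1 / s) hqq).2)).const_mul _).const_add 1
  obtain ⟨N, hN⟩ := (htend.eventually (lt_mem_nhds (show C < _ by linarith))).exists
  obtain ⟨L, w, hL, hw⟩ := hbumps N
  refine ⟨η, L, _, w, hL, hw, ?_, hN.le⟩
  rw [hγ, bumpMean_eq hlam (by linarith)]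
  have := mul_le_mul_of_nonneg_left (hpow 1 (by linarith) N).2 hone
  linarith

/-! ### Gluing bumps -/

theorem lintegral_Icc_ofReal_eq {f : ℝ → ℝ} {a b : ℝ} (hab : a ≤ b)
    (hf : IntervalIntegrable f volume a b) (h0 : ∀ x, 0 ≤ f x) :
    ∫⁻ x in Icc a b, ENNReal.ofReal (f x) = ENNReal.ofReal (∫ x in a..b, f x) := by
  rw [intervalIntegral.integral_of_le hab, ← setLIntegral_congr Ioc_ae_eq_Icc,
    ofReal_integral_eq_lintegral_ofReal hf.1 (.of_forall h0)]

theorem setLIntegral_Icc_comp_sub (F : ℝ → ℝ≥0∞) (a b d : ℝ) :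
    ∫⁻ x in Icc a b, F (x - d) = ∫⁻ x in Icc (a - d) (b - d), F x := by
  rw [← lintegral_indicator measurableSet_Icc, ← lintegral_indicator measurableSet_Icc,
    ← lintegral_sub_right_eq_self ((Icc (a - d) (b - d)).indicator F) d]
  refine lintegral_congr fun x => ?_
  have : x ∈ Icc a b ↔ x - d ∈ Icc (a - d) (b - d) := by
    simp only [mem_Icc, sub_le_sub_iff_right]
  by_cases hx : x ∈ Icc a b
  · rw [indicator_of_mem hx, indicator_of_mem (this.1 hx)]
  · rw [indicator_of_notMem hx, indicator_of_notMem (mt this.2 hx)]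

/-- The bumps rescaled to `[0, 1)`, with all properties in terms of the lower Lebesgue integral. -/
theorem exists_unit_bump {k s : ℝ} (hk : 0 < k) (hs0 : 0 < s) (hs1 : s < 1) (C : ℝ) :
    ∃ u : ℝ → ℝ, Measurable u ∧ (∀ x, 1 ≤ u x) ∧ (∀ x, x ∉ Ico 0 1 → u x = 1) ∧
      (∀ a b, a < b → (∫⁻ x in Icc a b, ENNReal.ofReal (u x)) ^ k *
        ∫⁻ x in Icc a b, ENNReal.ofReal (u x ^ (-k)) ≤
          ENNReal.ofReal (1 / criticalFun k s * (b - a) ^ (k + 1))) ∧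
      ∫⁻ x in Icc 0 1, ENNReal.ofReal (u x) ≤ ENNReal.ofReal (1 + 1 / (1 - s)) ∧
      ENNReal.ofReal C ≤ ∫⁻ x in Icc 0 1, ENNReal.ofReal (u x ^ (1 / s)) := by
  obtain ⟨η, L, M, w, hL, hw, hM1, hMC⟩ := exists_isBump hk hs0 hs1 C
  obtain ⟨D, hD⟩ := hw.bounded
  have hum : Measurable fun x => w (L * x) := hw.measurable.comp (measurable_const_mul L)
  have hw0 : ∀ ρ x : ℝ, 0 ≤ w x ^ ρ := fun ρ x => Real.rpow_nonneg (by linarith [hw.one_le x]) ρ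
  have hlint : ∀ ρ a b : ℝ, a ≤ b → ∫⁻ x in Icc a b, ENNReal.ofReal (w (L * x) ^ ρ) =
      ENNReal.ofReal (L⁻¹ * ∫ x in (L * a)..(L * b), w x ^ ρ) := fun ρ a b hab => by
    rw [lintegral_Icc_ofReal_eq hab (intervalIntegrable_of_abs_le (hum.pow_const ρ)
      (fun x => abs_rpow_le (hw.one_le _) (hD _) ρ) a b) (fun x => hw0 ρ _),
      intervalIntegral.integral_comp_mul_left (fun x => w x ^ ρ) hL.ne', smul_eq_mul]
  have hlint1 : ∀ a b : ℝ, a ≤ b → ∫⁻ x in Icc a b, ENNReal.ofReal (w (L * x)) =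
      ENNReal.ofReal (L⁻¹ * ∫ x in (L * a)..(L * b), w x) := fun a b hab => by
    simpa only [Real.rpow_one] using hlint 1 a b hab
  have hmean : ∀ ρ : ℝ, L⁻¹ * ∫ x in (L * 0)..(L * 1), w x ^ ρ = M ρ := fun ρ => by
    rw [mul_zero, mul_one, hw.mean, inv_mul_cancel_left₀ hL.ne']
  refine ⟨fun x => w (L * x), hum, fun x => hw.one_le _, fun x hx => hw.eq_one _ fun h => hx ?_,
    fun a b hab => ?_, ?_, ?_⟩
  · refine ⟨(mul_nonneg_iff_of_pos_left hL).1 h.1, ?_⟩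
    have : L * x < L * 1 := by rw [mul_one]; exact h.2
    exact lt_of_mul_lt_mul_left this hL.le
  · have hba : 0 < b - a := by linarith
    have hab' : L * a < L * b := by gcongr
    have hj := hw.joint _ _ hab'
    have i1 : 0 ≤ ∫ x in (L * a)..(L * b), w x :=
      intervalIntegral.integral_nonneg hab'.le fun x _ => by linarith [hw.one_le x]
    rw [hlint1 a b hab.le, hlint (-k) a b hab.le,
      ENNReal.ofReal_rpow_of_nonneg (by positivity) hk.le, ← ENNReal.ofReal_mul (by positivity)]
    refine ENNReal.ofReal_le_ofReal ?_
    rw [← mul_sub, Real.mul_rpow hL.le hba.le] at hj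
    rw [Real.mul_rpow (by positivity) i1, mul_mul_mul_comm, ← Real.rpow_add_one (by positivity),
      Real.inv_rpow hL.le, inv_mul_le_iff₀ (by positivity)]
    linarith
  · rw [hlint1 0 1 zero_le_one]
    have := hmean 1
    simp only [Real.rpow_one] at this
    rw [this]
    exact ENNReal.ofReal_le_ofReal hM1
  · rw [hlint _ 0 1 zero_le_one, hmean]
    exact ENNReal.ofReal_le_ofReal hMC

/-- The function that carries the bump `u j`, moved by `g`, on the cell `[j c, (j + 1) c)` of length
`c = 1 + 2 g`, and the bump `u 0` on all cells on the negative half-line. -/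
noncomputable def glue (g : ℝ) (u : ℕ → ℝ → ℝ) (x : ℝ) : ℝ :=
  u ⌊x / (1 + 2 * g)⌋.toNat ((1 + 2 * g) * Int.fract (x / (1 + 2 * g)) - g)

theorem glue_of_mem {g : ℝ} (hg : 0 < g) (u : ℕ → ℝ → ℝ) {x : ℝ} {i : ℤ}
    (hx : x ∈ Ico (i * (1 + 2 * g)) ((i + 1) * (1 + 2 * g))) :
    glue g u x = u i.toNat (x - (i * (1 + 2 * g) + g)) := by
  have hc : 0 < 1 + 2 * g := by positivity
  have h : ⌊x / (1 + 2 * g)⌋ = i := by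
    rw [Int.floor_eq_iff, le_div_iff₀ hc, div_lt_iff₀ hc]
    exact hx
  rw [glue, Int.fract, h, mul_sub, mul_div_cancel₀ _ hc.ne', mul_comm (1 + 2 * g) (i : ℝ), sub_sub]

theorem measurable_glue (g : ℝ) {u : ℕ → ℝ → ℝ} (hu : ∀ j, Measurable (u j)) :
    Measurable (glue g u) := by
  have h : Measurable fun p : ℕ × ℝ => u p.1 p.2 := measurable_from_prod_countable_right hu
  have hd : Measurable fun x : ℝ => x / (1 + 2 * g) := measurable_id.div_const _
  have h1 : Measurable fun x : ℝ => ⌊x / (1 + 2 * g)⌋.toNat :=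
    (measurable_of_countable Int.toNat).comp (Int.measurable_floor.comp hd)
  have h2 : Measurable fun x : ℝ => (1 + 2 * g) * Int.fract (x / (1 + 2 * g)) - g :=
    ((measurable_fract.comp hd).const_mul _).sub_const g
  exact h.comp (h1.prodMk h2)

theorem lintegral_glue_sub_one_le {g A : ℝ} (hg : 0 < g) {u : ℕ → ℝ → ℝ}
    (hoff : ∀ j x, x ∉ Ico 0 1 → u j x = 1)
    (hA : ∀ j, ∫⁻ x in Icc 0 1, ENNReal.ofReal (u j x) ≤ ENNReal.ofReal A) {a b : ℝ}
    (hab : g ≤ b - a) :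
    ∫⁻ x in Icc a b, ENNReal.ofReal (glue g u x - 1) ≤ ENNReal.ofReal (3 * A / g * (b - a)) := by
  set c := 1 + 2 * g with hc
  have hc0 : 0 < c := by positivity
  have hcell : ∀ i : ℤ, ∫⁻ x in Ico (i * c) ((i + 1) * c), ENNReal.ofReal (glue g u x - 1) ≤
      ENNReal.ofReal A := fun i => by
    calc ∫⁻ x in Ico (i * c) ((i + 1) * c), ENNReal.ofReal (glue g u x - 1)
        = ∫⁻ x in Ico (i * c) ((i + 1) * c),
            ENNReal.ofReal (u i.toNat (x - (i * c + g)) - 1) :=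
          setLIntegral_congr_fun measurableSet_Ico fun x hx => by
            simp only [glue_of_mem hg u hx, ← hc]
      _ ≤ ∫⁻ x, ENNReal.ofReal (u i.toNat (x - (i * c + g)) - 1) := setLIntegral_le_lintegral _ _
      _ = ∫⁻ x, ENNReal.ofReal (u i.toNat x - 1) :=
          lintegral_sub_right_eq_self (fun x => ENNReal.ofReal (u i.toNat x - 1)) _
      _ = ∫⁻ x in Icc 0 1, ENNReal.ofReal (u i.toNat x - 1) := by
          rw [← lintegral_indicator measurableSet_Icc]
          refine lintegral_congr fun x => ?_
          by_cases hx : x ∈ Icc (0 : ℝ) 1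
          · rw [indicator_of_mem hx]
          · rw [indicator_of_notMem hx, hoff _ x fun h => hx (Ico_subset_Icc_self h), sub_self,
              ENNReal.ofReal_zero]
      _ ≤ ∫⁻ x in Icc 0 1, ENNReal.ofReal (u i.toNat x) :=
          lintegral_mono fun x => ENNReal.ofReal_le_ofReal (by linarith)
      _ ≤ _ := hA _
  have hcover : Icc a b ⊆ ⋃ i ∈ Finset.Icc ⌊a / c⌋ ⌊b / c⌋, Ico ((i : ℝ) * c) ((i + 1) * c) := by
    intro x hx
    simp only [mem_iUnion]
    refine ⟨⌊x / c⌋, Finset.mem_Icc.2 ⟨Int.floor_mono ?_, Int.floor_mono ?_⟩, ?_, ?_⟩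
    · have := hx.1; gcongr
    · have := hx.2; gcongr
    · rw [← le_div_iff₀ hc0]; exact Int.floor_le _
    · rw [← div_lt_iff₀ hc0]; exact Int.lt_floor_add_one _
  have hle : ⌊a / c⌋ ≤ ⌊b / c⌋ := Int.floor_mono (by gcongr; linarith)
  calc ∫⁻ x in Icc a b, ENNReal.ofReal (glue g u x - 1)
      ≤ ∫⁻ x in ⋃ i ∈ Finset.Icc ⌊a / c⌋ ⌊b / c⌋, Ico ((i : ℝ) * c) ((i + 1) * c),
          ENNReal.ofReal (glue g u x - 1) := lintegral_mono_set hcover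
    _ = ∑ i ∈ Finset.Icc ⌊a / c⌋ ⌊b / c⌋, ∫⁻ x in Ico ((i : ℝ) * c) ((i + 1) * c),
          ENNReal.ofReal (glue g u x - 1) := by
        refine lintegral_biUnion_finset (fun i _ j _ hij => ?_) (fun _ _ => measurableSet_Ico) _
        rw [Function.onFun, Set.disjoint_left]
        intro x hx hx'
        have h1 : ⌊x / c⌋ = i := by
          rw [Int.floor_eq_iff, le_div_iff₀ hc0, div_lt_iff₀ hc0]; exact hx
        have h2 : ⌊x / c⌋ = j := by
          rw [Int.floor_eq_iff, le_div_iff₀ hc0, div_lt_iff₀ hc0]; exact hx'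
        exact hij (h1.symm.trans h2)
    _ ≤ ∑ i ∈ Finset.Icc ⌊a / c⌋ ⌊b / c⌋, ENNReal.ofReal A :=
        Finset.sum_le_sum fun i _ => hcell i
    _ = ENNReal.ofReal ((⌊b / c⌋ + 1 - ⌊a / c⌋).toNat * A) := by
        rw [Finset.sum_const, Int.card_Icc, nsmul_eq_mul, ENNReal.ofReal_mul (by positivity),
          ENNReal.ofReal_natCast]
    _ ≤ _ := by
        refine ENNReal.ofReal_le_ofReal_iff'.2 ?_
        rcases le_or_gt A 0 with hA0 | hA0
        · right; exact mul_nonpos_of_nonneg_of_nonpos (by positivity) hA0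
        · left
          have hnat : (((⌊b / c⌋ + 1 - ⌊a / c⌋).toNat : ℤ) : ℝ) = (⌊b / c⌋ : ℝ) + 1 - ⌊a / c⌋ := by
            rw [Int.toNat_of_nonneg (by linarith)]; push_cast; ring
          rw [Int.cast_natCast] at hnat
          rw [hnat]
          have h1 := Int.floor_le (b / c)
          have h2 := Int.lt_floor_add_one (a / c)
          have h3 : b / c - a / c ≤ (b - a) / g := by
            rw [← sub_div]
            have : g ≤ c := by rw [hc]; linarith
            exact div_le_div_of_nonneg_left (by linarith) hg this
          have h4 : 1 ≤ (b - a) / g := by rwa [le_div_iff₀ hg, one_mul]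
          have h5 : (⌊b / c⌋ : ℝ) + 1 - ⌊a / c⌋ ≤ 3 * ((b - a) / g) := by linarith
          calc ((⌊b / c⌋ : ℝ) + 1 - ⌊a / c⌋) * A ≤ 3 * ((b - a) / g) * A := by gcongr
            _ = 3 * A / g * (b - a) := by ring

/-- Bumps that are glued at large distances keep their common joint bound: long intervals see mostly
the base value `1`. -/
theorem exists_glue_joint {k K A : ℝ} (hk : 0 < k) (hK : 1 < K) (hA : 0 < A) :
    ∃ g > 0, ∀ u : ℕ → ℝ → ℝ, (∀ j, Measurable (u j)) → (∀ j x, 1 ≤ u j x) →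
      (∀ j x, x ∉ Ico 0 1 → u j x = 1) →
      (∀ j a b, a < b → (∫⁻ x in Icc a b, ENNReal.ofReal (u j x)) ^ k *
        ∫⁻ x in Icc a b, ENNReal.ofReal (u j x ^ (-k)) ≤
          ENNReal.ofReal (K * (b - a) ^ (k + 1))) →
      (∀ j, ∫⁻ x in Icc 0 1, ENNReal.ofReal (u j x) ≤ ENNReal.ofReal A) →
      ∀ a b, a < b → (∫⁻ x in Icc a b, ENNReal.ofReal (glue g u x)) ^ k *
        ∫⁻ x in Icc a b, ENNReal.ofReal (glue g u x ^ (-k)) ≤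
          ENNReal.ofReal (K * (b - a) ^ (k + 1)) := by
  set κ := K ^ (1 / k) - 1 with hκ
  have hκ0 : 0 < κ := by
    have := Real.one_lt_rpow hK (by positivity : 0 < 1 / k)
    rw [hκ]; linarith
  refine ⟨3 * A / κ, by positivity, fun u hum hu1 hoff hjoint huA a b hab => ?_⟩
  set g := 3 * A / κ with hgdef
  have hg : 0 < g := by positivity
  have hgκ : 3 * A / g = κ := by rw [hgdef]; field_simp
  have hba : 0 < b - a := by linarith
  have hglue1 : ∀ x, 1 ≤ glue g u x := fun x => hu1 _ _
  -- bounds for functions that are at most `1` or at most a multiple of the length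
  have hconst : ∀ {S T : ℝ≥0∞} {C : ℝ}, 0 ≤ C → C ^ k ≤ K → S ≤ ENNReal.ofReal (C * (b - a)) →
      T ≤ ENNReal.ofReal (b - a) → S ^ k * T ≤ ENNReal.ofReal (K * (b - a) ^ (k + 1)) := by
    intro S T C hC hCK hS hT
    calc S ^ k * T ≤ ENNReal.ofReal (C * (b - a)) ^ k * ENNReal.ofReal (b - a) := by gcongr
      _ = ENNReal.ofReal (C ^ k * (b - a) ^ (k + 1)) := by
          rw [ENNReal.ofReal_rpow_of_nonneg (by positivity) hk.le,
            ← ENNReal.ofReal_mul (by positivity), Real.mul_rpow hC hba.le, mul_assoc,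
            ← Real.rpow_add_one hba.ne']
      _ ≤ _ := ENNReal.ofReal_le_ofReal (by gcongr)
  have hvol : volume (Icc a b) = ENNReal.ofReal (b - a) := Real.volume_Icc
  have hT : ∫⁻ x in Icc a b, ENNReal.ofReal (glue g u x ^ (-k)) ≤ ENNReal.ofReal (b - a) := by
    calc ∫⁻ x in Icc a b, ENNReal.ofReal (glue g u x ^ (-k)) ≤ ∫⁻ x in Icc a b, 1 := by
          refine lintegral_mono fun x => ?_
          rw [ENNReal.ofReal_le_one]
          exact Real.rpow_le_one_of_one_le_of_nonpos (hglue1 x) (by linarith)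
      _ = _ := by rw [setLIntegral_one, hvol]
  by_cases hlong : g ≤ b - a
  · have hS : ∫⁻ x in Icc a b, ENNReal.ofReal (glue g u x) ≤
        ENNReal.ofReal (K ^ (1 / k) * (b - a)) := by
      calc ∫⁻ x in Icc a b, ENNReal.ofReal (glue g u x)
          = ∫⁻ x in Icc a b, (1 + ENNReal.ofReal (glue g u x - 1)) := by
            refine lintegral_congr fun x => ?_
            rw [← ENNReal.ofReal_one, ← ENNReal.ofReal_add zero_le_one
              (by linarith [hglue1 x]), add_sub_cancel]
        _ = ENNReal.ofReal (b - a) + ∫⁻ x in Icc a b, ENNReal.ofReal (glue g u x - 1) := by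
            rw [lintegral_add_left measurable_const, setLIntegral_one, hvol]
        _ ≤ ENNReal.ofReal (b - a) + ENNReal.ofReal (3 * A / g * (b - a)) :=
            add_le_add_right (lintegral_glue_sub_one_le hg hoff huA hlong) _
        _ = _ := by
            rw [← ENNReal.ofReal_add hba.le (by positivity), hgκ, hκ]
            congr 1; ring
    refine hconst (by positivity) ?_ hS hT
    rw [← Real.rpow_mul (by linarith), one_div_mul_cancel hk.ne', Real.rpow_one]
  · push Not at hlong
    set c := 1 + 2 * g with hc
    have hc0 : 0 < c := by positivity
    set i := ⌊a / c⌋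
    have hia : i * c ≤ a := by rw [← le_div_iff₀ hc0]; exact Int.floor_le _
    have hai : a < (i + 1) * c := by rw [← div_lt_iff₀ hc0]; exact Int.lt_floor_add_one _
    by_cases hbi : b < (i + 1) * c
    · have hval : ∀ x ∈ Icc a b, glue g u x = u i.toNat (x - (i * c + g)) := fun x hx =>
        glue_of_mem hg u ⟨hia.trans hx.1, hx.2.trans_lt hbi⟩
      have e1 : ∫⁻ x in Icc a b, ENNReal.ofReal (glue g u x) =
          ∫⁻ x in Icc (a - (i * c + g)) (b - (i * c + g)), ENNReal.ofReal (u i.toNat x) := by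
        rw [← setLIntegral_Icc_comp_sub fun x => ENNReal.ofReal (u i.toNat x)]
        exact setLIntegral_congr_fun measurableSet_Icc fun x hx => by simp only [hval x hx]
      have e2 : ∫⁻ x in Icc a b, ENNReal.ofReal (glue g u x ^ (-k)) =
          ∫⁻ x in Icc (a - (i * c + g)) (b - (i * c + g)),
            ENNReal.ofReal (u i.toNat x ^ (-k)) := by
        rw [← setLIntegral_Icc_comp_sub fun x => ENNReal.ofReal (u i.toNat x ^ (-k))]
        exact setLIntegral_congr_fun measurableSet_Icc fun x hx => by simp only [hval x hx]
      have := hjoint i.toNat (a - (i * c + g)) (b - (i * c + g)) (by linarith)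
      rw [e1, e2]
      rwa [sub_sub_sub_cancel_right] at this
    · push Not at hbi
      have hone : ∀ x ∈ Icc a b, glue g u x = 1 := by
        intro x hx
        rcases lt_or_ge x ((i + 1) * c) with hxi | hxi
        · rw [glue_of_mem hg u (i := i) ⟨hia.trans hx.1, hxi⟩]
          exact hoff _ _ fun h => by linarith [h.2, hx.1]
        · rw [glue_of_mem hg u (i := i + 1)
            ⟨by push_cast; exact hxi, by push_cast; linarith [hx.2]⟩]
          refine hoff _ _ fun h => ?_
          have := h.1
          push_cast at this
          linarith [hx.2]
      refine hconst (C := 1) zero_le_one (by rw [Real.one_rpow]; exact hK.le) ?_ hT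
      rw [one_mul, setLIntegral_congr_fun (g := fun _ => 1) measurableSet_Icc
        fun x hx => by simp only [hone x hx, ENNReal.ofReal_one], setLIntegral_one, hvol]

/-- A weight on the line with the critical joint bound in which the reverse Hölder quotients with
the critical exponent are unbounded. -/
theorem exists_line_weight {k s : ℝ} (hk : 0 < k) (hs0 : 0 < s) (hs1 : s < 1) :
    ∃ w : ℝ → ℝ, Measurable w ∧ (∀ x, 1 ≤ w x) ∧
      (∀ a b, a < b → (∫⁻ x in Icc a b, ENNReal.ofReal (w x)) ^ k *
        ∫⁻ x in Icc a b, ENNReal.ofReal (w x ^ (-k)) ≤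
          ENNReal.ofReal (1 / criticalFun k s * (b - a) ^ (k + 1))) ∧
      ∀ j : ℕ, ∃ a, ∫⁻ x in Icc a (a + 1), ENNReal.ofReal (w x) ≤
          ENNReal.ofReal (1 + 1 / (1 - s)) ∧
        (j : ℝ≥0∞) ≤ ∫⁻ x in Icc a (a + 1), ENNReal.ofReal (w x ^ (1 / s)) := by
  have hΘ := criticalFun_pos hk hs0.le hs1
  have hK : 1 < 1 / criticalFun k s := by
    have h := criticalFun_strictAntiOn hk ⟨le_rfl, zero_le_one⟩ ⟨hs0.le, hs1.le⟩ hs0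
    have h0 : criticalFun k 0 = 1 := by simp [criticalFun]
    rw [lt_div_iff₀ hΘ]
    linarith
  obtain ⟨g, hg, hglue⟩ := exists_glue_joint (A := 1 + 1 / (1 - s)) hk hK (by positivity)
  choose u hum hu1 hoff hjoint huA huj using fun j : ℕ => exists_unit_bump hk hs0 hs1 (j : ℝ)
  refine ⟨glue g u, measurable_glue g hum, fun x => hu1 _ _, hglue u hum hu1 hoff hjoint huA,
    fun j => ⟨j * (1 + 2 * g) + g, ?_⟩⟩
  set d := (j : ℝ) * (1 + 2 * g) + g with hd
  have hval : ∀ x ∈ Icc d (d + 1), glue g u x = u j (x - d) := fun x hx => by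
    have := glue_of_mem hg u (x := x) (i := (j : ℤ))
      ⟨by push_cast; linarith [hx.1], by push_cast; linarith [hx.2]⟩
    simpa [hd] using this
  have hshift : ∀ F : ℝ → ℝ≥0∞, ∫⁻ x in Icc d (d + 1), F (x - d) = ∫⁻ x in Icc 0 1, F x :=
    fun F => by rw [setLIntegral_Icc_comp_sub, sub_self, add_sub_cancel_left]
  constructor
  · rw [setLIntegral_congr_fun (g := fun x => ENNReal.ofReal (u j (x - d))) measurableSet_Icc
      fun x hx => by simp only [hval x hx], hshift fun x => ENNReal.ofReal (u j x)]
    exact huA j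
  · rw [setLIntegral_congr_fun (g := fun x => ENNReal.ofReal (u j (x - d) ^ (1 / s)))
      measurableSet_Icc fun x hx => by simp only [hval x hx],
      hshift fun x => ENNReal.ofReal (u j x ^ (1 / s))]
    have := huj j
    rwa [ENNReal.ofReal_natCast] at this

/-! ### Weights on the line -/

theorem boxAvg_comp_apply_zero (w : ℝ → ℝ) (ρ : ℝ) (a b : Fin 1 → ℝ) :
    boxAvg volume (fun x => w (x 0)) ρ a b =
      (∫⁻ t in Icc (a 0) (b 0), ENNReal.ofReal (w t ^ ρ)) / ENNReal.ofReal (b 0 - a 0) := by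
  have hmp := volume_preserving_funUnique (Fin 1) ℝ
  have hpre : Icc a b = MeasurableEquiv.funUnique (Fin 1) ℝ ⁻¹' Icc (a 0) (b 0) := by
    ext x
    simp [Pi.le_def, MeasurableEquiv.funUnique]
  have hint : ∫⁻ x in Icc a b, ENNReal.ofReal (w (x 0) ^ ρ) =
      ∫⁻ t in Icc (a 0) (b 0), ENNReal.ofReal (w t ^ ρ) := by
    rw [hpre]
    exact hmp.setLIntegral_comp_preimage_emb (MeasurableEquiv.measurableEmbedding _)
      (fun t => ENNReal.ofReal (w t ^ ρ)) _
  rw [boxAvg, setLAverage_eq, hint, Real.volume_Icc_pi]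
  simp

/-- A weight on the line with the critical joint bound that satisfies no reverse Hölder inequality
with the critical exponent. -/
theorem exists_critical_weight {k s : ℝ} (hk : 0 < k) (hs0 : 0 < s) (hs1 : s < 1) :
    ∃ w : (Fin 1 → ℝ) → ℝ, IsWeight volume w ∧
      HasJointBound volume w k (1 / criticalFun k s) ∧
      ∀ C : ℝ≥0, ∃ P, IsAdmissible volume P ∧
        C * boxAvg volume w 1 P.1 P.2 < boxAvg volume w (1 / s) P.1 P.2 ^ s := by
  obtain ⟨w, hwm, hw1, hjoint, hub⟩ := exists_line_weight hk hs0 hs1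
  have hΘ := criticalFun_pos hk hs0.le hs1
  refine ⟨fun x => w (x 0), ⟨(hwm.comp (measurable_pi_apply 0)).aemeasurable,
    .of_forall fun x => by linarith [hw1 (x 0)]⟩, fun P hP => ?_, fun C => ?_⟩
  · have hd : 0 < P.2 0 - P.1 0 := by linarith [hP.1 0]
    rw [boxAvg_comp_apply_zero, boxAvg_comp_apply_zero]
    simp only [Real.rpow_one]
    rw [ENNReal.div_rpow_of_nonneg _ _ hk.le, ENNReal.ofReal_rpow_of_pos hd, div_eq_mul_inv,
      div_eq_mul_inv, mul_mul_mul_comm, ← ENNReal.mul_inv (by simp) (by simp),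
      ← ENNReal.ofReal_mul (by positivity), ← Real.rpow_add_one hd.ne', ← div_eq_mul_inv]
    refine ENNReal.div_le_of_le_mul ?_
    rw [← ENNReal.ofReal_mul (by positivity)]
    exact hjoint _ _ (hP.1 0)
  · obtain ⟨j, hj⟩ := exists_nat_gt ((C * (1 + 1 / (1 - s))) ^ (1 / s))
    obtain ⟨a, ha1, ha2⟩ := hub j
    refine ⟨(fun _ => a, fun _ => a + 1), ⟨fun _ => by simp, ?_⟩, ?_⟩
    · rw [Real.volume_Icc_pi]; simp
    · rw [boxAvg_comp_apply_zero, boxAvg_comp_apply_zero]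
      simp only [Real.rpow_one, add_sub_cancel_left, ENNReal.ofReal_one, div_one]
      calc (C : ℝ≥0∞) * ∫⁻ t in Icc a (a + 1), ENNReal.ofReal (w t)
          ≤ C * ENNReal.ofReal (1 + 1 / (1 - s)) := by gcongr
        _ = ENNReal.ofReal (C * (1 + 1 / (1 - s))) := by
            rw [ENNReal.ofReal_mul C.coe_nonneg]; simp
        _ < ENNReal.ofReal ((j : ℝ) ^ s) := by
            rw [ENNReal.ofReal_lt_ofReal_iff_of_nonneg (by positivity)]
            have := Real.rpow_lt_rpow (by positivity) hj hs0
            rwa [← Real.rpow_mul (by positivity), one_div_mul_cancel hs0.ne', Real.rpow_one] at this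
        _ = (j : ℝ≥0∞) ^ s := by
            rw [← ENNReal.ofReal_rpow_of_nonneg (by positivity) hs0.le, ENNReal.ofReal_natCast]
        _ ≤ _ := by gcongr

/-! ### Power means and duality -/

/-- Power means increase with the exponent. -/
theorem boxAvg_rpow_one_div_le {n : ℕ} {μ : Measure (Fin n → ℝ)} [IsLocallyFiniteMeasure μ]
    {w : (Fin n → ℝ) → ℝ} (hw : IsWeight μ w) {P : (Fin n → ℝ) × (Fin n → ℝ)}
    (hP : IsAdmissible μ P) {ρ σ : ℝ} (hρ : 0 < ρ) (hρσ : ρ ≤ σ) :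
    boxAvg μ w ρ P.1 P.2 ^ (1 / ρ) ≤ boxAvg μ w σ P.1 P.2 ^ (1 / σ) := by
  have hfin : μ (Icc P.1 P.2) ≠ ∞ := isCompact_Icc.measure_lt_top.ne
  set ν := (μ (Icc P.1 P.2))⁻¹ • μ.restrict (Icc P.1 P.2) with hν
  have : IsProbabilityMeasure ν := ⟨by
    rw [hν, Measure.smul_apply, Measure.restrict_apply_univ, smul_eq_mul,
      ENNReal.inv_mul_cancel hP.2 hfin]⟩
  have hm : AEStronglyMeasurable w ν :=
    (hw.aemeasurable.restrict.smul_measure _).aestronglyMeasurable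
  have hpos : ∀ᵐ x ∂ν, 0 < w x := Measure.ae_smul_measure (ae_restrict_of_ae hw.pos) _
  have key : ∀ τ, 0 < τ → boxAvg μ w τ P.1 P.2 ^ (1 / τ) = eLpNorm' w τ ν := fun τ hτ => by
    have h1 : boxAvg μ w τ P.1 P.2 = ∫⁻ x, ENNReal.ofReal (w x ^ τ) ∂ν := by
      rw [boxAvg, setLAverage_eq', hν]
    rw [h1, eLpNorm'_eq_lintegral_enorm]
    congr 1
    refine lintegral_congr_ae (hpos.mono fun x hx => ?_)
    simp only
    rw [Real.enorm_of_nonneg hx.le, ENNReal.ofReal_rpow_of_nonneg hx.le hτ.le]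
  rw [key ρ hρ, key σ (hρ.trans_le hρσ)]
  exact eLpNorm'_le_eLpNorm'_of_exponent_le hρ hρσ ν hm

theorem boxAvg_rpow {n : ℕ} {μ : Measure (Fin n → ℝ)} {w : (Fin n → ℝ) → ℝ} (hw : IsWeight μ w)
    (c ρ : ℝ) (a b : Fin n → ℝ) :
    boxAvg μ (fun x => w x ^ c) ρ a b = boxAvg μ w (c * ρ) a b := by
  refine laverage_congr (ae_restrict_of_ae (hw.pos.mono fun x hx => ?_))
  simp only
  rw [Real.rpow_mul hx.le]

/-- Jensen's inequality for `x ↦ x ^ (-k)`. -/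
theorem HasJointBound.one_le {n : ℕ} {μ : Measure (Fin n → ℝ)} [IsLocallyFiniteMeasure μ]
    {w : (Fin n → ℝ) → ℝ} (hw : IsWeight μ w) {k K : ℝ} (hk : 0 < k) (hA : HasJointBound μ w k K)
    {P : (Fin n → ℝ) × (Fin n → ℝ)} (hP : IsAdmissible μ P) :
    1 ≤ boxAvg μ w 1 P.1 P.2 ^ k * boxAvg μ w (-k) P.1 P.2 := by
  obtain ⟨-, -, hX, hx, hy, hxy, -⟩ := hA.mean_mem hw hk hP
  by_cases htop : boxAvg μ w (-k) P.1 P.2 = ∞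
  · rw [htop, ENNReal.mul_top]
    · exact le_top
    · rw [hX, ENNReal.ofReal_rpow_of_pos hx]
      simpa using Real.rpow_pos_of_pos hx k
  · rw [hX, (boxAvg_eq_ofReal_boxMean hw hP htop).2, ENNReal.ofReal_rpow_of_pos hx,
      ← ENNReal.ofReal_mul (by positivity), ENNReal.one_le_ofReal]
    exact hxy

theorem IsWeight.rpow {n : ℕ} {μ : Measure (Fin n → ℝ)} {w : (Fin n → ℝ) → ℝ} (hw : IsWeight μ w)
    (c : ℝ) : IsWeight μ fun x => w x ^ c :=
  ⟨hw.aemeasurable.pow_const c, hw.pos.mono fun _ hx => Real.rpow_pos_of_pos hx c⟩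

theorem hasJointBound_rpow_neg_iff {n : ℕ} {μ : Measure (Fin n → ℝ)} {w : (Fin n → ℝ) → ℝ}
    (hw : IsWeight μ w) {k K : ℝ} (hk : 0 < k) (hK : 0 ≤ K) :
    HasJointBound μ (fun x => w x ^ (-k)) (1 / k) (K ^ (1 / k)) ↔ HasJointBound μ w k K := by
  refine forall₂_congr fun P hP => ?_
  have hk' : 0 < 1 / k := by positivity
  have e : -k * -(1 / k) = 1 := by field_simp
  rw [boxAvg_rpow hw, boxAvg_rpow hw, mul_one, e,
    ← ENNReal.rpow_le_rpow_iff (x := boxAvg μ w 1 P.1 P.2 ^ k * _) hk',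
    ENNReal.mul_rpow_of_nonneg _ _ hk'.le, ← ENNReal.rpow_mul, mul_one_div_cancel hk.ne',
    ENNReal.rpow_one, ENNReal.ofReal_rpow_of_nonneg hK hk'.le, mul_comm]

theorem apChar_le_iff_hasJointBound {n : ℕ} {μ : Measure (Fin n → ℝ)} {w : (Fin n → ℝ) → ℝ}
    {p Q : ℝ} (hp : 1 < p) (hQ : 0 ≤ Q) :
    apChar μ p w ≤ ENNReal.ofReal Q ↔ HasJointBound μ w (1 / (p - 1)) (Q ^ (1 / (p - 1))) := by
  have hp' : 0 < p - 1 := by linarith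
  have hk : 0 < 1 / (p - 1) := by positivity
  simp only [apChar, iSup_le_iff, HasJointBound, IsAdmissible, Prod.forall, and_imp]
  refine forall₄_congr fun a b _ _ => ?_
  rw [← ENNReal.rpow_le_rpow_iff (x := boxAvg μ w 1 a b * _) hk,
    ENNReal.mul_rpow_of_nonneg _ _ hk.le, ← ENNReal.rpow_mul, mul_one_div_cancel hp'.ne',
    ENNReal.rpow_one, ENNReal.ofReal_rpow_of_nonneg hQ hk.le, neg_div]

theorem apChar_eq_ofReal {n : ℕ} {μ : Measure (Fin n → ℝ)} {w : (Fin n → ℝ) → ℝ} {p Q : ℝ}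
    (hp : 1 < p) (hQ : 0 ≤ Q) (h : HasJointBound μ w (1 / (p - 1)) (Q ^ (1 / (p - 1))))
    (hlt : ∀ Q', 0 ≤ Q' → Q' < Q → ¬ HasJointBound μ w (1 / (p - 1)) (Q' ^ (1 / (p - 1)))) :
    apChar μ p w = ENNReal.ofReal Q := by
  refine le_antisymm ((apChar_le_iff_hasJointBound hp hQ).2 h) ?_
  by_contra! hc
  obtain ⟨t, ht1, ht2⟩ := ENNReal.lt_iff_exists_nnreal_btwn.1 hc
  rw [← ENNReal.ofReal_coe_nnreal] at ht1 ht2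
  exact hlt t t.coe_nonneg ((ENNReal.ofReal_lt_ofReal_iff_of_nonneg t.coe_nonneg).1 ht2)
    ((apChar_le_iff_hasJointBound hp t.coe_nonneg).1 ht1.le)

/-! ### The critical exponents -/

theorem sPlus_spec {k Q : ℝ} (hk : 0 < k) (hQ : 1 < Q) :
    0 < sPlus (-k) Q ∧ sPlus (-k) Q < 1 ∧ 1 / criticalFun k (sPlus (-k) Q) = Q ^ k := by
  have hQ0 : 0 < Q := by linarith
  have hQ1 : 1 / Q < 1 := by rw [div_lt_one hQ0]; exact hQ
  have hQ2 : 0 < 1 / Q := by positivity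
  have h : sPlus (-k) Q ∈ {u | u ∈ Icc (0 : ℝ) 1 ∧ charFun (-k) u = 1 / Q} := by
    rw [uPlus_spec (by linarith) ⟨hQ2.le, hQ1.le⟩]; rfl
  obtain ⟨⟨h0, h1⟩, h2⟩ := h
  refine ⟨lt_of_le_of_ne h0 fun e => ?_, lt_of_le_of_ne h1 fun e => ?_, ?_⟩
  · rw [← e] at h2
    simp [charFun] at h2
    linarith
  · rw [e] at h2
    simp [charFun] at h2
    linarith
  · rw [← charFun_rpow_eq_criticalFun hk (by linarith) (by positivity), h2,
      Real.div_rpow zero_le_one hQ0.le, Real.one_rpow, one_div_one_div]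

/-- Replacing `k` by `1 / k` interchanges the two critical exponents. -/
theorem sMinus_spec {k Q : ℝ} (hk : 0 < k) (hQ : 1 < Q) :
    0 < -k * sMinus (-k) Q ∧ -k * sMinus (-k) Q < 1 ∧
      1 / criticalFun (1 / k) (-k * sMinus (-k) Q) = Q := by
  have hQ0 : 0 < Q := by linarith
  have hQ1 : 1 / Q < 1 := by rw [div_lt_one hQ0]; exact hQ
  have hQ2 : 0 < 1 / Q := by positivity
  have h : sMinus (-k) Q ∈ {u | u ∈ Icc (1 / -k) (0 : ℝ) ∧ charFun (-k) u = 1 / Q} := by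
    rw [uMinus_spec (by linarith) ⟨hQ2.le, hQ1.le⟩]; rfl
  obtain ⟨⟨h0, h1⟩, h2⟩ := h
  set u := sMinus (-k) Q
  have hne0 : u ≠ 0 := fun e => by
    rw [e] at h2
    simp [charFun] at h2
    linarith
  have hne1 : -k * u ≠ 1 := fun e => by
    rw [charFun, e, sub_self, neg_div_neg_eq, Real.zero_rpow (by positivity), mul_zero] at h2
    linarith
  have hu0 : u < 0 := lt_of_le_of_ne h1 hne0
  refine ⟨by nlinarith, lt_of_le_of_ne ?_ hne1, ?_⟩
  · have := mul_le_mul_of_nonneg_left h0 hk.le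
    have e : k * (1 / -k) = -1 := by field_simp
    rw [e] at this
    linarith
  · have e : 1 + 1 / k * (-k * u) = 1 - u := by field_simp; ring
    rw [criticalFun, e, mul_comm, ← one_div_one_div Q, ← h2, charFun, neg_div_neg_eq]

/-- The reverse Hölder inequality for all exponents below `1 / s` under the joint bound that has `s`
as its critical value. For exponents at most `1` it is the monotonicity of power means. -/
theorem exists_boxAvg_rpow_one_div_le {k r s : ℝ} (hk : 0 < k) (hr : 0 < r) (hs : 0 < s)
    (hs1 : s < 1) (hrs : r * s < 1) :
    ∃ C : ℝ≥0, ∀ (n : ℕ) (μ : Measure (Fin n → ℝ)) [IsLocallyFiniteMeasure μ],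
      (∀ (i : Fin n) (c : ℝ), μ {x | x i = c} = 0) → ∀ w : (Fin n → ℝ) → ℝ, IsWeight μ w →
        HasJointBound μ w k (1 / criticalFun k s) → ∀ P, IsAdmissible μ P →
          boxAvg μ w r P.1 P.2 ^ (1 / r) ≤ C * boxAvg μ w 1 P.1 P.2 := by
  rcases le_or_gt r 1 with hr1 | hr1
  · refine ⟨1, fun n μ _ _ w hw _ P hP => ?_⟩
    simpa using boxAvg_rpow_one_div_le hw hP hr hr1
  · have hs2 : s < 1 / r := by rw [lt_div_iff₀ hr]; linarith
    obtain ⟨t, hst, htr⟩ := exists_between hs2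
    have ht1 : t < 1 := htr.trans (by rw [div_lt_one hr]; exact hr1)
    have hΘ := criticalFun_pos hk hs.le hs1
    obtain ⟨C, hC⟩ := exists_boxAvg_rpow_le (s := t) (K := 1 / criticalFun k s) hk hr1
      (hs.trans hst) (by rw [lt_div_iff₀ hr] at htr; linarith) (by
        rw [one_div_mul_eq_div, div_lt_one hΘ]
        exact criticalFun_strictAntiOn hk ⟨hs.le, hs1.le⟩ ⟨(hs.trans hst).le, ht1.le⟩ hst)
    refine ⟨C ^ (1 / r), fun n μ _ hμ w hw hA P hP => ?_⟩
    have hr' : 0 ≤ 1 / r := by positivity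
    refine (ENNReal.rpow_le_rpow (hC n μ hμ w hw hA P hP) hr').trans_eq ?_
    rw [ENNReal.mul_rpow_of_nonneg _ _ hr', ← ENNReal.rpow_mul, mul_one_div_cancel hr.ne',
      ENNReal.rpow_one, ENNReal.coe_rpow_of_nonneg _ hr']

/-- A weight that violates the reverse Hölder inequality with exponent `1 / s` satisfies no joint
bound below the one that has `s` as its critical value. -/
theorem not_hasJointBound_of_lt {n : ℕ} {μ : Measure (Fin n → ℝ)} [IsLocallyFiniteMeasure μ]
    (hμ : ∀ (i : Fin n) (c : ℝ), μ {x | x i = c} = 0) {w : (Fin n → ℝ) → ℝ} (hw : IsWeight μ w)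
    {k s K : ℝ} (hk : 0 < k) (hs0 : 0 < s) (hs1 : s < 1) (hK : K < 1 / criticalFun k s)
    (hub : ∀ C : ℝ≥0, ∃ P, IsAdmissible μ P ∧
      C * boxAvg μ w 1 P.1 P.2 < boxAvg μ w (1 / s) P.1 P.2 ^ s) :
    ¬ HasJointBound μ w k K := by
  intro hA
  have hΘ := criticalFun_pos hk hs0.le hs1
  have hcont : Continuous fun t => K * criticalFun k t := by
    have : Continuous fun t : ℝ => (1 - t) ^ k :=
      (by fun_prop : Continuous fun t : ℝ => 1 - t).rpow_const fun _ => Or.inr hk.le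
    unfold criticalFun
    fun_prop
  have hlt : K * criticalFun k s < 1 := by rwa [lt_div_iff₀ hΘ] at hK
  have hev : ∀ᶠ t in nhdsWithin s (Iio s), 0 < t ∧ K * criticalFun k t < 1 ∧ t < s :=
    ((eventually_gt_nhds hs0).filter_mono nhdsWithin_le_nhds).and
      (((hcont.tendsto s).eventually_lt_const hlt |>.filter_mono nhdsWithin_le_nhds).and
        self_mem_nhdsWithin)
  obtain ⟨t, ht0, htK, hts⟩ := hev.exists
  obtain ⟨C, hC⟩ := exists_boxAvg_rpow_le (r := 1 / s) hk (by rw [lt_div_iff₀ hs0]; linarith) ht0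
    (by rw [one_div_mul_eq_div, div_lt_one hs0]; exact hts) htK
  obtain ⟨P, hP, hlt⟩ := hub (C ^ s)
  refine absurd (ENNReal.rpow_le_rpow (hC n μ hμ w hw hA P hP) hs0.le) (not_le.2 ?_)
  rwa [ENNReal.mul_rpow_of_nonneg _ _ hs0.le, ← ENNReal.rpow_mul, one_div_mul_cancel hs0.ne',
    ENNReal.rpow_one, ← ENNReal.coe_rpow_of_nonneg _ hs0.le]

/-! ### The ranges of exponents and their sharpness -/

theorem exists_apChar_le {p Q q : ℝ} (hp : 1 < p) (hQ : 1 < Q)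
    (hq : 1 - sMinus (-(1 / (p - 1))) Q < q) :
    ∃ C : ℝ≥0, ∀ (n : ℕ) (μ : Measure (Fin n → ℝ)) [IsLocallyFiniteMeasure μ],
      (∀ (i : Fin n) (c : ℝ), μ {x | x i = c} = 0) → ∀ w : (Fin n → ℝ) → ℝ, IsWeight μ w →
        apChar μ p w = ENNReal.ofReal Q → apChar μ q w ≤ (C : ℝ≥0∞) := by
  have hp1 : 0 < p - 1 := by linarith
  set k := 1 / (p - 1) with hk
  have hk0 : 0 < k := by positivity
  have hkp : 1 / k = p - 1 := by rw [hk, one_div_one_div]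
  have hQ0 : 0 < Q := by linarith
  obtain ⟨hs0, hs1, hsQ⟩ := sMinus_spec hk0 hQ
  set s := -k * sMinus (-k) Q with hs
  have hsm : sMinus (-k) Q = -(s * (p - 1)) := by rw [hs, ← hkp]; field_simp
  have hsp : s * (p - 1) < q - 1 := by linarith
  have hq1 : 0 < q - 1 := lt_trans (by positivity) hsp
  obtain ⟨C, hC⟩ := exists_boxAvg_rpow_one_div_le (r := (p - 1) / (q - 1))
    (by positivity : 0 < 1 / k) (by positivity) hs0 hs1
    (by rw [div_mul_eq_mul_div, div_lt_one hq1]; linarith)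
  refine ⟨C ^ (p - 1) * Q.toNNReal, fun n μ _ hμ w hw hA => ?_⟩
  have hle := hA.le
  have hJ := (apChar_le_iff_hasJointBound hp hQ0.le).1 hle
  rw [← hk, ← hasJointBound_rpow_neg_iff hw hk0 (by positivity), ← Real.rpow_mul hQ0.le,
    mul_one_div_cancel hk0.ne', Real.rpow_one, ← hsQ] at hJ
  simp only [apChar, iSup_le_iff] at hle ⊢
  intro a b hab hμ0
  have h := hC n μ hμ _ (hw.rpow (-k)) hJ (a, b) ⟨hab, hμ0⟩
  have e1 : -k * ((p - 1) / (q - 1)) = -1 / (q - 1) := by rw [hk]; field_simp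
  have e2 : -k * 1 = -1 / (p - 1) := by rw [hk]; ring
  have e3 : 1 / ((p - 1) / (q - 1)) * (p - 1) = q - 1 := by field_simp
  rw [boxAvg_rpow hw, boxAvg_rpow hw, e1, e2] at h
  have h' := ENNReal.rpow_le_rpow h hp1.le
  rw [← ENNReal.rpow_mul, e3, ENNReal.mul_rpow_of_nonneg _ _ hp1.le] at h'
  calc boxAvg μ w 1 a b * boxAvg μ w (-1 / (q - 1)) a b ^ (q - 1)
      ≤ boxAvg μ w 1 a b * (C ^ (p - 1) * boxAvg μ w (-1 / (p - 1)) a b ^ (p - 1)) := by gcongr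
    _ = C ^ (p - 1) * (boxAvg μ w 1 a b * boxAvg μ w (-1 / (p - 1)) a b ^ (p - 1)) := by ring
    _ ≤ C ^ (p - 1) * ENNReal.ofReal Q := by gcongr; exact hle a b hab hμ0
    _ = _ := by rw [ENNReal.coe_mul, ENNReal.coe_rpow_of_nonneg _ hp1.le]; rfl

theorem exists_rhChar_le {p Q q : ℝ} (hp : 1 < p) (hQ : 1 < Q) (hq1 : 1 ≤ q)
    (hq : q < 1 / sPlus (-(1 / (p - 1))) Q) :
    ∃ C : ℝ≥0, ∀ (n : ℕ) (μ : Measure (Fin n → ℝ)) [IsLocallyFiniteMeasure μ],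
      (∀ (i : Fin n) (c : ℝ), μ {x | x i = c} = 0) → ∀ w : (Fin n → ℝ) → ℝ, IsWeight μ w →
        apChar μ p w = ENNReal.ofReal Q → rhChar μ q w ≤ (C : ℝ≥0∞) := by
  have hk0 : 0 < 1 / (p - 1) := by positivity
  obtain ⟨hs0, hs1, hsQ⟩ := sPlus_spec hk0 hQ
  rw [lt_div_iff₀ hs0] at hq
  obtain ⟨C, hC⟩ := exists_boxAvg_rpow_one_div_le hk0 (by linarith : 0 < q) hs0 hs1 hq
  refine ⟨C, fun n μ _ hμ w hw hA => ?_⟩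
  have hJ := (apChar_le_iff_hasJointBound hp (by linarith)).1 hA.le
  rw [← hsQ] at hJ
  simp only [rhChar, iSup_le_iff]
  intro a b hab hμ0
  exact ENNReal.div_le_of_le_mul (hC n μ hμ w hw hJ (a, b) ⟨hab, hμ0⟩)

theorem volume_setOf_apply_eq (n : ℕ) (i : Fin n) (c : ℝ) :
    volume {x : Fin n → ℝ | x i = c} = 0 := by
  rw [volume_pi]
  exact Measure.pi_hyperplane (α := fun _ => ℝ) _ i c

theorem exists_apChar_eq_top {p Q q : ℝ} (hp : 1 < p) (hQ : 1 < Q) (hq1 : 1 < q)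
    (hq : q ≤ 1 - sMinus (-(1 / (p - 1))) Q) :
    ∃ w : (Fin 1 → ℝ) → ℝ, IsWeight volume w ∧ apChar volume p w = ENNReal.ofReal Q ∧
      ¬ MemAp volume q w := by
  have hp1 : 0 < p - 1 := by linarith
  have hq1' : 0 < q - 1 := by linarith
  set k := 1 / (p - 1) with hk
  have hk0 : 0 < k := by positivity
  have hkp : 1 / k = p - 1 := by rw [hk, one_div_one_div]
  have hQ0 : 0 < Q := by linarith
  obtain ⟨hs0, hs1, hsQ⟩ := sMinus_spec hk0 hQ
  set s := -k * sMinus (-k) Q with hs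
  have hsm : sMinus (-k) Q = -(s * (p - 1)) := by rw [hs, ← hkp]; field_simp
  obtain ⟨v, hv, hJ, hub⟩ := exists_critical_weight (by positivity : 0 < 1 / k) hs0 hs1
  have hdual : ∀ K, 0 ≤ K → (HasJointBound volume (fun x => v x ^ (-(p - 1))) k (K ^ k) ↔
      HasJointBound volume v (1 / k) K) := fun K hK => by
    have := hasJointBound_rpow_neg_iff hv hp1 hK
    rw [← hk] at this
    rwa [hkp]
  refine ⟨fun x => v x ^ (-(p - 1)), hv.rpow _, apChar_eq_ofReal hp hQ0.le ?_ ?_, ?_⟩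
  · rwa [← hk, hdual Q hQ0.le, ← hsQ]
  · intro Q' hQ' hlt
    rw [← hk, hdual Q' hQ']
    rw [← hsQ] at hlt
    exact not_hasJointBound_of_lt (volume_setOf_apply_eq 1) hv (by positivity) hs0 hs1 hlt hub
  · intro hmem
    set D := (apChar volume q fun x => v x ^ (-(p - 1))).toNNReal
    have hDle : (apChar volume q fun x => v x ^ (-(p - 1))) ≤ D :=
      (ENNReal.coe_toNNReal hmem.ne).ge
    obtain ⟨P, hP, hlt⟩ := hub (D ^ k)
    refine absurd hlt (not_lt.2 ?_)
    simp only [apChar, iSup_le_iff] at hDle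
    have h := hDle P.1 P.2 hP.1 hP.2
    have e1 : -(p - 1) * (-1 / (q - 1)) = (p - 1) / (q - 1) := by ring
    rw [boxAvg_rpow hv, boxAvg_rpow hv, mul_one, e1] at h
    have hone := hJ.one_le hv (by positivity) hP
    rw [hkp] at hone
    have hsr : 1 / s ≤ (p - 1) / (q - 1) := by
      rw [div_le_div_iff₀ hs0 hq1']
      linarith
    have e2 : 1 / ((p - 1) / (q - 1)) = (q - 1) * k := by rw [hk]; field_simp
    have hmono := boxAvg_rpow_one_div_le hv hP (by positivity) hsr
    rw [one_div_one_div, e2] at hmono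
    refine hmono.trans ?_
    set X := boxAvg volume v 1 P.1 P.2
    set Y := boxAvg volume v (-(p - 1)) P.1 P.2
    set Z := boxAvg volume v ((p - 1) / (q - 1)) P.1 P.2
    have hZ : Z ^ (q - 1) ≤ D * X ^ (p - 1) := by
      calc Z ^ (q - 1) = 1 * Z ^ (q - 1) := (one_mul _).symm
        _ ≤ X ^ (p - 1) * Y * Z ^ (q - 1) := by gcongr
        _ = Y * Z ^ (q - 1) * X ^ (p - 1) := by ring
        _ ≤ D * X ^ (p - 1) := by gcongr
    have e3 : (p - 1) * k = 1 := by rw [hk]; field_simp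
    have := ENNReal.rpow_le_rpow hZ hk0.le
    rwa [← ENNReal.rpow_mul, ENNReal.mul_rpow_of_nonneg _ _ hk0.le, ← ENNReal.rpow_mul, e3,
      ENNReal.rpow_one, ← ENNReal.coe_rpow_of_nonneg _ hk0.le] at this

theorem exists_rhChar_eq_top {p Q q : ℝ} (hp : 1 < p) (hQ : 1 < Q)
    (hq : 1 / sPlus (-(1 / (p - 1))) Q ≤ q) :
    ∃ w : (Fin 1 → ℝ) → ℝ, IsWeight volume w ∧ apChar volume p w = ENNReal.ofReal Q ∧
      ¬ MemRH volume q w := by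
  set k := 1 / (p - 1) with hk
  have hk0 : 0 < k := by positivity
  have hQ0 : 0 < Q := by linarith
  obtain ⟨hs0, hs1, hsQ⟩ := sPlus_spec hk0 hQ
  set s := sPlus (-k) Q
  obtain ⟨w, hw, hJ, hub⟩ := exists_critical_weight hk0 hs0 hs1
  refine ⟨w, hw, apChar_eq_ofReal hp hQ0.le ?_ ?_, ?_⟩
  · rwa [← hk, ← hsQ]
  · intro Q' hQ' hlt
    refine not_hasJointBound_of_lt (volume_setOf_apply_eq 1) hw hk0 hs0 hs1 ?_ hub
    rw [hsQ]
    exact Real.rpow_lt_rpow hQ' hlt hk0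
  · intro hmem
    have hDle : rhChar volume q w ≤ (rhChar volume q w).toNNReal :=
      (ENNReal.coe_toNNReal hmem.ne).ge
    obtain ⟨P, hP, hlt⟩ := hub (rhChar volume q w).toNNReal
    refine absurd hlt (not_lt.2 ?_)
    simp only [rhChar, iSup_le_iff] at hDle
    have h := hDle P.1 P.2 hP.1 hP.2
    obtain ⟨-, -, hX, -⟩ := hJ.mean_mem hw hk0 hP
    rw [← div_eq_mul_inv, ENNReal.div_le_iff (boxAvg_ne_zero hw hP 1)
      (by rw [hX]; exact ENNReal.ofReal_ne_top)] at h
    have := boxAvg_rpow_one_div_le hw hP (by positivity) hq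
    rw [one_div_one_div] at this
    exact this.trans h

end StrongWeights

theorem theorem1 (p Q p₁ : ℝ) (hp : 1 < p) (hQ : 1 < Q) (hp₁ : p₁ = -1 / (p - 1)) :
    -- membership in `A_q^*`, with a bound that depends only on `p`, `Q`, `q`
    (∀ q : ℝ, 1 - StrongWeights.sMinus p₁ Q < q →
      ∃ C : ℝ≥0, ∀ (n : ℕ) (μ : Measure (Fin n → ℝ)) [IsLocallyFiniteMeasure μ],
        (∀ (i : Fin n) (c : ℝ), μ {x | x i = c} = 0) →
        ∀ w : (Fin n → ℝ) → ℝ, StrongWeights.IsWeight μ w →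
          StrongWeights.apChar μ p w = ENNReal.ofReal Q →
          StrongWeights.MemAp μ q w ∧ StrongWeights.apChar μ q w ≤ (C : ℝ≥0∞)) ∧
    -- membership in `RH_q^*`, with a bound that depends only on `p`, `Q`, `q`
    (∀ q : ℝ, 1 ≤ q → q < 1 / StrongWeights.sPlus p₁ Q →
      ∃ C : ℝ≥0, ∀ (n : ℕ) (μ : Measure (Fin n → ℝ)) [IsLocallyFiniteMeasure μ],
        (∀ (i : Fin n) (c : ℝ), μ {x | x i = c} = 0) →
        ∀ w : (Fin n → ℝ) → ℝ, StrongWeights.IsWeight μ w →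
          StrongWeights.apChar μ p w = ENNReal.ofReal Q →
          StrongWeights.MemRH μ q w ∧ StrongWeights.rhChar μ q w ≤ (C : ℝ≥0∞)) ∧
    -- both ranges are sharp for `n = 1` and Lebesgue measure
    (∀ q : ℝ, 1 < q → q ≤ 1 - StrongWeights.sMinus p₁ Q →
      ∃ w : (Fin 1 → ℝ) → ℝ, StrongWeights.IsWeight volume w ∧
        StrongWeights.apChar volume p w = ENNReal.ofReal Q ∧
        ¬ StrongWeights.MemAp volume q w) ∧
    (∀ q : ℝ, 1 / StrongWeights.sPlus p₁ Q ≤ q →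
      ∃ w : (Fin 1 → ℝ) → ℝ, StrongWeights.IsWeight volume w ∧
        StrongWeights.apChar volume p w = ENNReal.ofReal Q ∧
        ¬ StrongWeights.MemRH volume q w) := by
  rw [neg_div] at hp₁
  subst hp₁
  refine ⟨fun q hq => ?_, fun q hq1 hq => ?_, fun q hq1 hq => ?_, fun q hq => ?_⟩
  · obtain ⟨C, hC⟩ := StrongWeights.exists_apChar_le hp hQ hq
    exact ⟨C, fun n μ _ hμ w hw hA =>
      ⟨(hC n μ hμ w hw hA).trans_lt ENNReal.coe_lt_top, hC n μ hμ w hw hA⟩⟩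
  · obtain ⟨C, hC⟩ := StrongWeights.exists_rhChar_le hp hQ hq1 hq
    exact ⟨C, fun n μ _ hμ w hw hA =>
      ⟨(hC n μ hμ w hw hA).trans_lt ENNReal.coe_lt_top, hC n μ hμ w hw hA⟩⟩
  · exact StrongWeights.exists_apChar_eq_top hp hQ hq1 hq
  · exact StrongWeights.exists_rhChar_eq_top hp hQ hq
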